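/- Write $\langle x\rangle=(1+|x|^2)^{1/2}$, and let $\widehat f(\xi)$ and $\widetilde u(\tau,\xi)$ denote the Fourier transform on $\mathbb R$ and the space-time Fourier transform on $\mathbb R^{1+1}$ (for instance $\widetilde u(\tau,\xi)=\int e^{-i(t\tau+x\xi)}u(t,x)\,dt\,dx$). For either choice of sign and $s,b\in\mathbb R$ define, for (complex-valued, tempered) distributions, $$\|f\|_{H^s}=\|\langle\xi\rangle^s\widehat f\|_{L^2(\mathbb R)},\qquad \|u\|_{Z^{s,b}_\pm}=\big\|\langle\tau\mp\xi\rangle^s\langle\tau\pm\xi\rangle^b\,\widetilde u(\tau,\xi)\big\|_{L^2_{\tau,\xi}},\qquad \|u\|_{Y^{s,b}_\pm}=\big\|\langle\xi\rangle^s\langle\tau\pm\xi\rangle^b\,\widetilde u(\tau,\xi)\big\|_{L^2_\xi L^1_\tau},$$ with value $\infty$ if the Fourier transform is not a function. For $T>0$ let $S_T=[-T,T]\times\mathbb R$; equality of distributions on $S_T$ means equality on its interior, and $\|u\|_{Z^{s,b}_\pm(S_T)}=\inf\{\|g\|_{Z^{s,b}_\pm}: g=u\text{ on }S_T\}$. **Corollary.**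 Let $-\tfrac12<s<0$, $0<\epsilon<\tfrac16$ and $\tfrac12<b<\min\{1+\epsilon,1+s\}$. There is a constant $C$, depending only on $s$, $\epsilon$ and $b$, such that for either sign, every $0<T<1$, and every $\psi$ which on $S_T$ is a solution (in the sense of distributions) of $$\partial_t\psi\pm\partial_x\psi=F,\qquad \psi(0)=f,$$ where $\psi$ is weakly continuous in $t\in(-T,T)$ with values in $\mathcal S'(\mathbb R)$, one has $$\|\psi\|_{Z^{s,b}_\pm(S_T)}\le C\Big(T^{\frac12-b}\|f\|_{H^s}+T^{\epsilon}\inf_{F'=F\text{ on }S_T}\big(\|F'\|_{Y^{s,-1+2\epsilon}_\pm}+\|F'\|_{Z^{s,b-1+2\epsilon}_\pm}\big)\Big).$$ Here the infimum is over all tempered distributions $F'$ on $\mathbb R^{1+1}$ with $F'=F$ on $S_T$, and the right-hand side is $\infty$ if no such $F'$ has both norms finite. -/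

import Mathlib

open MeasureTheory Set
open scoped SchwartzMap FourierTransform LineDeriv ENNReal NNReal

namespace NullSobolev

/-- The space-time `ℝ^{1+1}`; the coordinate `p 0` is the time `t` (or its dual variable `τ`), and
the coordinate `p 1` is the space variable `x` (or its dual variable `ξ`). -/
abbrev SpaceTime : Type := EuclideanSpace ℝ (Fin 2)

/-- The bracket `⟨x⟩ = (1 + |x|²)^{1/2}`. -/
noncomputable def bracket (x : ℝ) : ℝ := Real.sqrt (1 + x ^ 2)

/-- The Fourier transform of the tempered distribution `u`, in the normalization
`û(ξ) = ∫ e^{-i x·ξ} u(x) dx`, is the function `G`. Mathlib's `𝓕` is taken with respect to the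
character `e^{-2πi x·k}`, so that `𝓕 u (k) = û(2πk)`. -/
def IsFourierTransform {E : Type*} [NormedAddCommGroup E] [InnerProductSpace ℝ E]
    [FiniteDimensional ℝ E] [MeasurableSpace E] [BorelSpace E]
    (u : 𝓢'(E, ℂ)) (G : E → ℂ) : Prop :=
  Measurable G ∧ ∀ φ : 𝓢(E, ℂ),
    Integrable (fun k : E => G ((2 * Real.pi) • k) * φ k) ∧
      (𝓕 u) φ = ∫ k : E, G ((2 * Real.pi) • k) * φ k

/-- The norm `‖f‖_{H^s} = ‖⟨ξ⟩^s f̂(ξ)‖_{L²}` of a tempered distribution on `ℝ`. It is `∞` if `f̂` is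
not a function. (The function `f̂` is unique up to null sets, so the infimum is over
representatives that all give the same value; the same holds for the two norms below.) -/
noncomputable def HNorm (s : ℝ) (f : 𝓢'(ℝ, ℂ)) : ℝ≥0∞ :=
  ⨅ (G : ℝ → ℂ) (_ : IsFourierTransform f G),
    (∫⁻ ξ : ℝ, (ENNReal.ofReal (bracket ξ ^ s) * ‖G ξ‖ₑ) ^ 2) ^ (1 / 2 : ℝ)

/-- The norm `‖u‖_{Z^{s,b}_±} = ‖⟨τ ∓ ξ⟩^s ⟨τ ± ξ⟩^b ũ(τ, ξ)‖_{L²_{τ,ξ}}`, where `σ = ±1` is the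
sign. -/
noncomputable def ZNorm (σ s b : ℝ) (u : 𝓢'(SpaceTime, ℂ)) : ℝ≥0∞ :=
  ⨅ (G : SpaceTime → ℂ) (_ : IsFourierTransform u G),
    (∫⁻ p : SpaceTime,
      (ENNReal.ofReal (bracket (p 0 - σ * p 1) ^ s * bracket (p 0 + σ * p 1) ^ b) * ‖G p‖ₑ) ^ 2)
      ^ (1 / 2 : ℝ)

/-- The norm `‖u‖_{Y^{s,b}_±} = ‖⟨ξ⟩^s ⟨τ ± ξ⟩^b ũ(τ, ξ)‖_{L²_ξ L¹_τ}`, where `σ = ±1` is the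
sign. -/
noncomputable def YNorm (σ s b : ℝ) (u : 𝓢'(SpaceTime, ℂ)) : ℝ≥0∞ :=
  ⨅ (G : SpaceTime → ℂ) (_ : IsFourierTransform u G),
    (∫⁻ ξ : ℝ, (∫⁻ τ : ℝ,
      ENNReal.ofReal (bracket ξ ^ s * bracket (τ + σ * ξ) ^ b) * ‖G !₂[τ, ξ]‖ₑ) ^ 2) ^ (1 / 2 : ℝ)

/-- The (interior of the) strip `S_T = [-T, T] × ℝ`. -/
def strip (T : ℝ) : Set SpaceTime := {p | p 0 ∈ Ioo (-T) T}

/-- `u = v` on `S_T`, in the sense of distributions. -/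
def EqOnStrip (T : ℝ) (u v : 𝓢'(SpaceTime, ℂ)) : Prop :=
  Distribution.IsVanishingOn (u - v : 𝓢'(SpaceTime, ℂ)) (strip T)

/-- The norm of the restriction space `Z^{s,b}_±(S_T)`. -/
noncomputable def ZNormStrip (σ s b T : ℝ) (u : 𝓢'(SpaceTime, ℂ)) : ℝ≥0∞ :=
  ⨅ (g : 𝓢'(SpaceTime, ℂ)) (_ : EqOnStrip T g u), ZNorm σ s b g

/-- The transport operator `∂_t ± ∂_x` on tempered distributions. -/
noncomputable def transport (σ : ℝ) (u : 𝓢'(SpaceTime, ℂ)) : 𝓢'(SpaceTime, ℂ) :=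
  ∂_{EuclideanSpace.single (0 : Fin 2) (1 : ℝ)} u +
    (σ : ℂ) • ∂_{EuclideanSpace.single (1 : Fin 2) (1 : ℝ)} u

/-- `ψ(0) = f`: on the strip, `ψ` is (given by) a curve `t ↦ ψ(t)` in `C((-T, T), 𝓢'(ℝ))`, where
`𝓢'(ℝ)` has the weak topology, that is, `⟨ψ, η ⊗ χ⟩ = ∫ η(t) ⟨ψ(t), χ⟩ dt` for all `χ ∈ 𝓢(ℝ)` and
all test functions `η` supported in `(-T, T)`; and the value of this curve at `t = 0` is `f`. -/
def HasInitialValue (T : ℝ) (ψ : 𝓢'(SpaceTime, ℂ)) (f : 𝓢'(ℝ, ℂ)) : Prop :=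
  ∃ u : ℝ → 𝓢'(ℝ, ℂ), ContinuousOn u (Ioo (-T) T) ∧ u 0 = f ∧
    ∀ (η χ : 𝓢(ℝ, ℂ)) (Φ : 𝓢(SpaceTime, ℂ)), tsupport η ⊆ Ioo (-T) T →
      (∀ p : SpaceTime, Φ p = η (p 0) * χ (p 1)) → ψ Φ = ∫ t : ℝ, η t * u t χ

/-- `ψ` solves `(∂_t ± ∂_x) ψ = F` on `S_T` with `ψ(0) = f`. -/
def IsSolution (σ T : ℝ) (ψ F : 𝓢'(SpaceTime, ℂ)) (f : 𝓢'(ℝ, ℂ)) : Prop :=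
  EqOnStrip T (transport σ ψ) F ∧ HasInitialValue T ψ f

end NullSobolev

/-!
Idea: in the frequency coordinates `θ = τ + σ ξ` and `ξ` the equation reads `i θ ψ̃ = F̃`, so an
extension of `ψ` can be built separately for each `ξ`. On the frequencies `|θ| ≥ 1 / T` the forcing
term is divided by `i θ`. The remaining free wave is cut off in time by a Schwartz kernel `K` whose
inverse Fourier transform is constant on `[-1, 1]`, and the contribution of the low frequencies by
the same kernel at scale `T`; they then enter through difference quotients of `K`, which are not
singular at `θ = 0`. Weighted Cauchy-Schwarz inequalities at fixed `ξ` bound this extension. It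
satisfies the same transport equation and has the same initial value as `ψ`, hence agrees with `ψ`
on the strip: a test function supported there whose integrals along the characteristics vanish is
the derivative along them of another such test function.
-/

namespace NullSobolev

theorem one_le_bracket (x : ℝ) : 1 ≤ bracket x :=
  Real.one_le_sqrt.2 (by nlinarith [sq_nonneg x])

theorem bracket_pos (x : ℝ) : 0 < bracket x := one_pos.trans_le (one_le_bracket x)

theorem bracket_rpow_pos (x r : ℝ) : 0 < bracket x ^ r := Real.rpow_pos_of_pos (bracket_pos x) r

theorem bracket_sq (x : ℝ) : bracket x ^ 2 = 1 + x ^ 2 :=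
  Real.sq_sqrt (by positivity)

theorem bracket_rpow_neg_two (x : ℝ) : bracket x ^ (-2 : ℝ) = (1 + x ^ 2)⁻¹ := by
  rw [Real.rpow_neg (bracket_pos x).le, ← bracket_sq]
  norm_cast

theorem bracket_neg (x : ℝ) : bracket (-x) = bracket x := by
  rw [bracket, bracket, neg_sq]

theorem abs_le_bracket (x : ℝ) : |x| ≤ bracket x :=
  Real.abs_le_sqrt (by linarith)

theorem bracket_le_one_add_abs (x : ℝ) : bracket x ≤ 1 + |x| := by
  refine abs_le_of_sq_le_sq' ?_ (by positivity) |>.2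
  rw [bracket_sq]
  nlinarith [sq_abs x, abs_nonneg x]

theorem one_add_abs_sq_le (x : ℝ) : (1 + |x|) ^ 2 ≤ 2 * (1 + x ^ 2) := by
  nlinarith [sq_abs x, sq_nonneg (1 - |x|)]

theorem bracket_le_bracket {x y : ℝ} (h : |x| ≤ |y|) : bracket x ≤ bracket y :=
  Real.sqrt_le_sqrt (by linarith [sq_le_sq.2 h])

@[fun_prop]
theorem continuous_bracket : Continuous bracket :=
  Real.continuous_sqrt.comp (by fun_prop)

@[fun_prop]
theorem measurable_bracket : Measurable bracket := continuous_bracket.measurable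

theorem bracket_rpow_mul_rpow (x a b : ℝ) : bracket x ^ a * bracket x ^ b = bracket x ^ (a + b) :=
  (Real.rpow_add (bracket_pos x) a b).symm

theorem bracket_add_le (x y : ℝ) : bracket (x + y) ≤ 2 * bracket x * bracket y := by
  have hx := one_add_abs_sq_le x
  have hy := one_add_abs_sq_le y
  rw [← bracket_sq] at hx hy
  have hxy : bracket (x + y) ≤ (1 + |x|) * (1 + |y|) := by
    have := bracket_le_one_add_abs (x + y)
    nlinarith [abs_add_le x y, mul_nonneg (abs_nonneg x) (abs_nonneg y)]
  refine hxy.trans (abs_le_of_sq_le_sq' ?_ (by have := bracket_pos x; have := bracket_pos y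
                                               positivity)).2
  have := mul_le_mul hx hy (by positivity) (by positivity)
  nlinarith

theorem bracket_sub_rpow_le {s : ℝ} (hs : s ≤ 0) (x y : ℝ) :
    bracket (x - y) ^ s ≤ 2 ^ (-s) * bracket y ^ s * bracket x ^ (-s) := by
  have hx := bracket_pos x
  have hy := bracket_pos y
  have peetre : bracket y / (2 * bracket x) ≤ bracket (x - y) := by
    have := bracket_add_le (y - x) x
    rw [sub_add_cancel, ← neg_sub, bracket_neg] at this
    rw [div_le_iff₀ (by positivity)]
    linarith
  calc bracket (x - y) ^ s ≤ (bracket y / (2 * bracket x)) ^ s :=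
        Real.rpow_le_rpow_of_nonpos (by positivity) peetre hs
    _ = 2 ^ (-s) * bracket y ^ s * bracket x ^ (-s) := by
        rw [Real.div_rpow hy.le (by positivity), Real.mul_rpow zero_le_two hx.le,
          Real.rpow_neg zero_le_two, Real.rpow_neg hx.le]
        field_simp

theorem bracket_rpow_le_abs_rpow_ae {p : ℝ} (hp : p ≤ 0) (k : ℝ) :
    ∀ᵐ θ : ℝ, bracket (θ - k) ^ p ≤ |θ - k| ^ p := by
  filter_upwards [compl_mem_ae_iff.2 (measure_singleton k)] with θ hθ
  exact Real.rpow_le_rpow_of_nonpos (abs_pos.2 (sub_ne_zero.2 hθ)) (abs_le_bracket _) hp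

theorem bracket_le_inv_mul {T : ℝ} (hT : 0 < T) (hT1 : T ≤ 1) (θ : ℝ) :
    bracket θ ≤ T⁻¹ * bracket (T * θ) := by
  have hb := bracket_pos (T * θ)
  refine (abs_le_of_sq_le_sq' ?_ (by positivity)).2
  calc bracket θ ^ 2 = 1 + θ ^ 2 := bracket_sq θ
    _ ≤ T⁻¹ ^ 2 + θ ^ 2 := by
        gcongr
        exact one_le_pow₀ ((one_le_inv₀ hT).2 hT1)
    _ = (T⁻¹ * bracket (T * θ)) ^ 2 := by
        rw [mul_pow, bracket_sq]
        field_simp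

theorem integrable_bracket_rpow {r : ℝ} (hr : r < -1) : Integrable fun x => bracket x ^ r := by
  have h := integrable_rpow_neg_one_add_norm_sq (E := ℝ) (μ := volume) (r := -r)
    (by rw [Module.finrank_self]; push_cast; linarith)
  refine h.congr (.of_forall fun x => ?_)
  simp only [bracket, Real.sqrt_eq_rpow, Real.norm_eq_abs, sq_abs]
  rw [← Real.rpow_mul (by positivity)]
  congr 1
  ring

theorem lintegral_inv_one_add_mul_sq {T : ℝ} (hT : 0 < T) :
    ∫⁻ x : ℝ, ENNReal.ofReal (1 + (T * x) ^ 2)⁻¹ = ENNReal.ofReal (T⁻¹ * Real.pi) := by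
  rw [← ofReal_integral_eq_lintegral_ofReal
    (integrable_inv_one_add_sq.comp_mul_left' hT.ne') (.of_forall fun x => by positivity),
    Measure.integral_comp_mul_left (fun x : ℝ => (1 + x ^ 2)⁻¹), integral_univ_inv_one_add_sq,
    abs_of_pos (inv_pos.2 hT), smul_eq_mul]

theorem lintegral_ball_abs_sub_rpow {r D : ℝ} (hr : -1 < r) (hD : 0 < D) (k : ℝ) :
    ∫⁻ x in Metric.ball k D, ENNReal.ofReal (|x - k| ^ r) =
      ENNReal.ofReal (2 * (D ^ (r + 1) / (r + 1))) := by
  set φ : ℝ → ℝ := fun u => (Iio D).indicator (fun x => x ^ r) |u|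
  have hr1 : 0 < r + 1 := by linarith
  have integral_φ : ∫ u, φ u = 2 * (D ^ (r + 1) / (r + 1)) := by
    rw [integral_comp_abs, setIntegral_indicator measurableSet_Iio, Ioi_inter_Iio,
      ← integral_Ioc_eq_integral_Ioo, ← intervalIntegral.integral_of_le hD.le,
      integral_rpow (Or.inl hr), Real.zero_rpow hr1.ne', sub_zero]
  have integrable_φ : Integrable φ := not_imp_comm.1 integral_undef <| by
    rw [integral_φ]
    positivity
  have φ_nonneg : ∀ u, 0 ≤ φ u := fun u => indicator_apply_nonneg fun _ => by positivity
  rw [← integral_φ, ofReal_integral_eq_lintegral_ofReal integrable_φ (.of_forall φ_nonneg),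
    ← lintegral_sub_right_eq_self (fun u => ENNReal.ofReal (φ u)) k,
      ← lintegral_indicator Metric.isOpen_ball.measurableSet]
  refine lintegral_congr fun x => ?_
  by_cases hx : |x - k| < D
  · rw [indicator_of_mem (by rwa [Metric.mem_ball, Real.dist_eq])]
    simp only [φ, indicator_of_mem (mem_Iio.2 hx)]
  · rw [indicator_of_notMem (by rwa [Metric.mem_ball, Real.dist_eq])]
    simp only [φ, indicator_of_notMem (mt mem_Iio.1 hx), ENNReal.ofReal_zero]

theorem lintegral_mul_sq_le {α : Type*} [MeasurableSpace α] {μ : Measure α} {f g : α → ℝ≥0∞}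
    (hf : AEMeasurable f μ) (hg : AEMeasurable g μ) :
    (∫⁻ x, f x * g x ∂μ) ^ 2 ≤ (∫⁻ x, f x ^ 2 ∂μ) * ∫⁻ x, g x ^ 2 ∂μ := by
  have h := ENNReal.lintegral_mul_le_Lp_mul_Lq μ Real.HolderConjugate.two_two hf hg
  calc (∫⁻ x, f x * g x ∂μ) ^ 2 ≤ ((∫⁻ x, f x ^ (2 : ℝ) ∂μ) ^ (1 / 2 : ℝ) *
        (∫⁻ x, g x ^ (2 : ℝ) ∂μ) ^ (1 / 2 : ℝ)) ^ 2 := by gcongr; exact h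
    _ = (∫⁻ x, f x ^ 2 ∂μ) * ∫⁻ x, g x ^ 2 ∂μ := by
        rw [mul_pow, ← ENNReal.rpow_mul_natCast, ← ENNReal.rpow_mul_natCast]
        norm_num

/-! ### Schwartz profiles against the weights -/

theorem exists_norm_le_bracket_rpow (K : 𝓢(ℝ, ℂ)) (p : ℝ) :
    ∃ C : ℝ, 0 ≤ C ∧ ∀ x, ‖K x‖ ≤ C * bracket x ^ p := by
  obtain ⟨N, hN⟩ := exists_nat_ge (-p)
  refine ⟨2 ^ N * (Finset.Iic (N, 0)).sup (fun m => SchwartzMap.seminorm ℝ m.1 m.2) K,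
    by positivity, fun x => ?_⟩
  have hx := bracket_pos x
  have decay := SchwartzMap.one_add_le_sup_seminorm_apply (𝕜 := ℝ) (m := (N, 0)) le_rfl le_rfl K x
  rw [norm_iteratedFDeriv_zero] at decay
  rw [← div_le_iff₀ (bracket_rpow_pos x p), div_eq_mul_inv, ← Real.rpow_neg hx.le, mul_comm]
  refine le_trans ?_ decay
  gcongr
  calc bracket x ^ (-p) ≤ bracket x ^ (N : ℝ) :=
        Real.rpow_le_rpow_of_exponent_le (one_le_bracket x) hN
    _ ≤ (1 + ‖x‖) ^ N := by
        rw [Real.rpow_natCast]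
        gcongr
        exact bracket_le_one_add_abs x

theorem weight_mul_sq_le {s : ℝ} (hs : s ≤ 0) {b k θ x A : ℝ} (hx₀ : 0 ≤ x)
    (hx : x ≤ A * bracket θ ^ (s - b - 1)) :
    (bracket (θ - k) ^ s * bracket θ ^ b * x) ^ 2 ≤
      (bracket k ^ s * (2 ^ (-s) * A)) ^ 2 * (1 + θ ^ 2)⁻¹ := by
  have hk := bracket_rpow_pos k s
  have hθb := bracket_rpow_pos θ b
  have hθs := bracket_rpow_pos θ (-s)
  have hθk := bracket_rpow_pos (θ - k) s
  calc (bracket (θ - k) ^ s * bracket θ ^ b * x) ^ 2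
      ≤ (2 ^ (-s) * bracket k ^ s * bracket θ ^ (-s) * bracket θ ^ b *
          (A * bracket θ ^ (s - b - 1))) ^ 2 := by
        gcongr
        exact bracket_sub_rpow_le hs θ k
    _ = (bracket k ^ s * (2 ^ (-s) * A)) ^ 2 *
          (bracket θ ^ (-s) * bracket θ ^ b * bracket θ ^ (s - b - 1)) ^ 2 := by ring
    _ = (bracket k ^ s * (2 ^ (-s) * A)) ^ 2 * (1 + θ ^ 2)⁻¹ := by
        rw [bracket_rpow_mul_rpow, bracket_rpow_mul_rpow, ← bracket_rpow_neg_two,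
          ← Real.rpow_mul_natCast (bracket_pos θ).le]
        congr 2
        push_cast
        ring

theorem exists_lintegral_weight_mul_schwartz_sq_le {s : ℝ} (hs : s ≤ 0) (b : ℝ) (K : 𝓢(ℝ, ℂ)) :
    ∃ C : ℝ≥0, ∀ k : ℝ,
      ∫⁻ θ, (ENNReal.ofReal (bracket (θ - k) ^ s * bracket θ ^ b) * ‖K θ‖ₑ) ^ 2 ≤
        C * ENNReal.ofReal (bracket k ^ s) ^ 2 := by
  obtain ⟨A, -, hA⟩ := exists_norm_le_bracket_rpow K (s - b - 1)
  set B : ℝ := 2 ^ (-s) * A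
  have pointwise (k θ : ℝ) :
      (ENNReal.ofReal (bracket (θ - k) ^ s * bracket θ ^ b) * ‖K θ‖ₑ) ^ 2 ≤
        ENNReal.ofReal ((bracket k ^ s * B) ^ 2) * ENNReal.ofReal (1 + (1 * θ) ^ 2)⁻¹ := by
    have hθ := bracket_rpow_pos θ b
    have hθk := bracket_rpow_pos (θ - k) s
    rw [← ofReal_norm, ← ENNReal.ofReal_mul (by positivity), ← ENNReal.ofReal_pow (by positivity),
      ← ENNReal.ofReal_mul (by positivity), one_mul]
    exact ENNReal.ofReal_le_ofReal (weight_mul_sq_le hs (norm_nonneg _) (hA θ))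
  refine ⟨(B ^ 2 * Real.pi).toNNReal, fun k => ?_⟩
  have hk := bracket_rpow_pos k s
  calc _ ≤ ∫⁻ θ, ENNReal.ofReal ((bracket k ^ s * B) ^ 2) * ENNReal.ofReal (1 + (1 * θ) ^ 2)⁻¹ :=
        lintegral_mono (pointwise k)
    _ = ENNReal.ofReal ((bracket k ^ s * B) ^ 2) * ENNReal.ofReal Real.pi := by
        rw [lintegral_const_mul' _ _ ENNReal.ofReal_ne_top, lintegral_inv_one_add_mul_sq one_pos,
          inv_one, one_mul]
    _ = ENNReal.ofReal (B ^ 2 * Real.pi) * ENNReal.ofReal (bracket k ^ s) ^ 2 := by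
        rw [← ENNReal.ofReal_pow hk.le, ← ENNReal.ofReal_mul (by positivity),
          ← ENNReal.ofReal_mul (by positivity)]
        ring_nf

theorem bracket_rpow_neg_two_le_of_abs_sub_le {x y : ℝ} (h : |x - y| ≤ 1) :
    bracket y ^ (-2 : ℝ) ≤ 8 * bracket x ^ (-2 : ℝ) := by
  have hxy : |x| ≤ 1 + |y| := by linarith [abs_sub_abs_le_abs_sub x y]
  rw [bracket_rpow_neg_two, bracket_rpow_neg_two, ← div_eq_mul_inv,
    inv_le_comm₀ (by positivity) (by positivity), inv_div, div_le_iff₀ (by norm_num)]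
  nlinarith [sq_abs x, sq_abs y, abs_nonneg x, abs_nonneg y, sq_nonneg (|y| - 1)]

theorem exists_difference_quotient_le (K : 𝓢(ℝ, ℂ)) :
    ∃ A : ℝ, 0 ≤ A ∧ ∀ T : ℝ, 0 < T → ∀ θ ω : ℝ, |θ| ≤ T⁻¹ →
      ‖(K (T * (ω - θ)) - K (T * ω)) / (Complex.I * θ)‖ ≤
        A * (T * bracket (T * ω) ^ (-2 : ℝ)) := by
  obtain ⟨A, hA₀, hA⟩ := exists_norm_le_bracket_rpow (SchwartzMap.derivCLM ℂ ℂ K) (-2)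
  refine ⟨A * 8, by positivity, fun T hT θ ω hθ => ?_⟩
  have hω := bracket_rpow_pos (T * ω) (-2)
  rcases eq_or_ne θ 0 with rfl | hθ₀
  · simp only [Complex.ofReal_zero, mul_zero, div_zero, norm_zero]
    positivity
  have deriv_le : ∀ z ∈ Metric.closedBall (T * ω) 1,
      ‖deriv K z‖ ≤ A * (8 * bracket (T * ω) ^ (-2 : ℝ)) := fun z hz =>
    (hA z).trans <| by
      gcongr
      refine bracket_rpow_neg_two_le_of_abs_sub_le ?_
      rwa [abs_sub_comm, ← Real.dist_eq]
  have increment : T * (ω - θ) - T * ω = -(T * θ) := by ring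
  have mem : T * (ω - θ) ∈ Metric.closedBall (T * ω) 1 := by
    rw [Metric.mem_closedBall, Real.dist_eq, increment, abs_neg, abs_mul, abs_of_pos hT,
      ← mul_inv_cancel₀ hT.ne']
    gcongr
  have mean_value := (convex_closedBall (T * ω) 1).norm_image_sub_le_of_norm_deriv_le
    (fun z _ => K.differentiableAt) deriv_le (Metric.mem_closedBall_self zero_le_one) mem
  rw [increment, norm_neg, norm_mul, Real.norm_of_nonneg hT.le, Real.norm_eq_abs] at mean_value
  rw [norm_div, norm_mul, Complex.norm_I, one_mul, Complex.norm_real, Real.norm_eq_abs,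
    div_le_iff₀ (abs_pos.2 hθ₀)]
  linarith

/-! ### The Duhamel extension at a fixed spatial frequency -/

/-- The weight `⟨θ - k⟩^s ⟨θ⟩^b`. In the coordinates `θ = τ + σ ξ` and `ξ`, the weight of
`Z^{s,b}_±` is the one with `k = 2 σ ξ`. -/
noncomputable def weight (s b k θ : ℝ) : ℝ≥0∞ :=
  ENNReal.ofReal (bracket (θ - k) ^ s * bracket θ ^ b)

/-- The square of the weighted `L²` norm of a function of `θ`, which stands for the restriction
of a space-time Fourier transform to a fixed spatial frequency. -/
noncomputable def fiberSq (s b k : ℝ) (h : ℝ → ℂ) : ℝ≥0∞ := ∫⁻ θ, (weight s b k θ * ‖h θ‖ₑ) ^ 2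

/-- The high frequencies `|θ| ≥ 1 / T` of the forcing term `h`, divided by the symbol `i θ` of the
transport operator. -/
noncomputable def highPart (T : ℝ) (h : ℝ → ℂ) : ℝ → ℂ :=
  (Metric.ball 0 T⁻¹)ᶜ.indicator fun θ => h θ / (Complex.I * θ)

/-- The contribution to the frequency `ω` of the frequency `θ` of the forcing term, when its Duhamel
integral `(e^{i t θ} - 1) / (i θ)` is cut off in time at scale `T`. At `θ = 0` the junk value `0`
replaces the limit; this changes nothing since the kernel is integrated in `θ`. -/
noncomputable def lowKernel (K : 𝓢(ℝ, ℂ)) (T ω θ : ℝ) : ℂ :=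
  (T * K (T * (ω - θ)) - T * K (T * ω)) / (Complex.I * θ)

/-- The Fourier transform, at a fixed spatial frequency and as a function of `ω = τ + σ ξ`, of the
extension of the solution with initial value `a` and forcing term `h`. The kernel `K` cuts off the
free wave at time scale one, and the low frequencies of the Duhamel integral at time scale `T`. -/
noncomputable def duhamel (K : 𝓢(ℝ, ℂ)) (T : ℝ) (a : ℂ) (h : ℝ → ℂ) (ω : ℝ) : ℂ :=
  K ω * (a - (2 * Real.pi : ℂ)⁻¹ * ∫ θ, highPart T h θ) + highPart T h ω +
    (2 * Real.pi : ℂ)⁻¹ * ∫ θ in Metric.ball 0 T⁻¹, h θ * lowKernel K T ω θ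

theorem lintegral_ball_abs_sub_rpow_mul_le {p T D k : ℝ} (hp : -1 < p) (hT : 0 < T)
    (hD : T⁻¹ + |k| = 2 * D) :
    ∫⁻ θ in Metric.ball k D, ENNReal.ofReal (|θ - k| ^ p) * ENNReal.ofReal (1 + (T * θ) ^ 2)⁻¹ ≤
      ENNReal.ofReal (8 / (p + 1) * (D ^ p * T⁻¹)) := by
  have hp1 : 0 < p + 1 := by linarith
  have hT' : 0 < T⁻¹ := inv_pos.2 hT
  have hD₀ : 0 < D := by linarith [abs_nonneg k]
  have mul_le : ∀ θ ∈ Metric.ball k D, T * D ≤ 1 + |T * θ| := fun θ hθ => by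
    rw [Metric.mem_ball, dist_comm, Real.dist_eq] at hθ
    have := abs_sub_abs_le_abs_sub k θ
    calc T * D ≤ T * (T⁻¹ + |θ|) := by gcongr; linarith
      _ = 1 + |T * θ| := by rw [mul_add, mul_inv_cancel₀ hT.ne', abs_mul, abs_of_pos hT]
  have inv_le : (T * D)⁻¹ ≤ 2 := by
    have : T * (2 * D) = 1 + T * |k| := by rw [← hD, mul_add, mul_inv_cancel₀ hT.ne']
    have : 0 ≤ T * |k| := by positivity
    rw [inv_le_comm₀ (by positivity) two_pos]
    linarith
  calc _ ≤ ∫⁻ θ in Metric.ball k D,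
        ENNReal.ofReal (|θ - k| ^ p) * ENNReal.ofReal (2 / (T * D) ^ 2) := by
        refine setLIntegral_mono' measurableSet_ball fun θ hθ => ?_
        gcongr
        rw [inv_le_comm₀ (by positivity) (by positivity), inv_div, div_le_iff₀ two_pos]
        linarith [pow_le_pow_left₀ (by positivity : 0 ≤ T * D) (mul_le θ hθ) 2,
          one_add_abs_sq_le (T * θ)]
    _ = ENNReal.ofReal (4 / (p + 1) * (T * D)⁻¹ * (D ^ p * T⁻¹)) := by
        rw [lintegral_mul_const' _ _ ENNReal.ofReal_ne_top, lintegral_ball_abs_sub_rpow hp hD₀,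
          ← ENNReal.ofReal_mul (by positivity), Real.rpow_add_one hD₀.ne']
        congr 1
        field_simp
        norm_num
    _ ≤ ENNReal.ofReal (4 / (p + 1) * 2 * (D ^ p * T⁻¹)) := by gcongr
    _ = ENNReal.ofReal (8 / (p + 1) * (D ^ p * T⁻¹)) := by ring_nf

theorem lintegral_compl_ball_abs_sub_rpow_mul_le {p T D : ℝ} (hp : p ≤ 0) (hT : 0 < T)
    (hD : 0 < D) (k : ℝ) :
    ∫⁻ θ in (Metric.ball k D)ᶜ,
        ENNReal.ofReal (|θ - k| ^ p) * ENNReal.ofReal (1 + (T * θ) ^ 2)⁻¹ ≤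
      ENNReal.ofReal (Real.pi * (D ^ p * T⁻¹)) := by
  calc _ ≤ ∫⁻ θ in (Metric.ball k D)ᶜ,
        ENNReal.ofReal (D ^ p) * ENNReal.ofReal (1 + (T * θ) ^ 2)⁻¹ := by
        refine setLIntegral_mono' measurableSet_ball.compl fun θ hθ => ?_
        rw [mem_compl_iff, Metric.mem_ball, Real.dist_eq, not_lt] at hθ
        gcongr ENNReal.ofReal ?_ * _
        exact Real.rpow_le_rpow_of_nonpos hD hθ hp
    _ ≤ ∫⁻ θ, ENNReal.ofReal (D ^ p) * ENNReal.ofReal (1 + (T * θ) ^ 2)⁻¹ :=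
        setLIntegral_le_lintegral _ _
    _ = ENNReal.ofReal (Real.pi * (D ^ p * T⁻¹)) := by
        rw [lintegral_const_mul' _ _ ENNReal.ofReal_ne_top, lintegral_inv_one_add_mul_sq hT,
          ← ENNReal.ofReal_mul (by positivity)]
        ring_nf

theorem exists_lintegral_abs_sub_rpow_mul_le {p : ℝ} (hp : -1 < p) (hp₀ : p ≤ 0) :
    ∃ C : ℝ≥0, ∀ T : ℝ, 0 < T → ∀ k : ℝ,
      ∫⁻ θ, ENNReal.ofReal (|θ - k| ^ p) * ENNReal.ofReal (1 + (T * θ) ^ 2)⁻¹ ≤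
        C * ENNReal.ofReal (T⁻¹ * (T⁻¹ + |k|) ^ p) := by
  have hp1 : 0 < p + 1 := by linarith
  refine ⟨(2 ^ (-p) * (8 / (p + 1) + Real.pi)).toNNReal, fun T hT k => ?_⟩
  set D : ℝ := (T⁻¹ + |k|) / 2 with D_def
  have hD : T⁻¹ + |k| = 2 * D := (mul_div_cancel₀ _ two_ne_zero).symm
  have hD₀ : 0 < D := by positivity
  rw [← lintegral_add_compl _ (measurableSet_ball (x := k) (ε := D))]
  calc _ ≤ ENNReal.ofReal (8 / (p + 1) * (D ^ p * T⁻¹)) +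
        ENNReal.ofReal (Real.pi * (D ^ p * T⁻¹)) :=
        add_le_add (lintegral_ball_abs_sub_rpow_mul_le hp hT hD)
          (lintegral_compl_ball_abs_sub_rpow_mul_le hp₀ hT hD₀ k)
    _ = ENNReal.ofReal (2 ^ (-p) * (8 / (p + 1) + Real.pi)) *
          ENNReal.ofReal (T⁻¹ * (T⁻¹ + |k|) ^ p) := by
        rw [← ENNReal.ofReal_add (by positivity) (by positivity),
          ← ENNReal.ofReal_mul (by positivity), D_def, Real.div_rpow (by positivity) zero_le_two,
          Real.rpow_neg zero_le_two]
        ring_nf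

theorem bracket_rpow_mul_profile_sq_le {b T : ℝ} (hb₀ : 0 ≤ b) (hb₁ : b ≤ 1) (hT : 0 < T)
    (hT1 : T ≤ 1) (ω : ℝ) :
    (bracket ω ^ b * (T ^ 2 * bracket (T * ω) ^ (-2 : ℝ))) ^ 2 ≤
      T ^ (4 - 2 * b) * (1 + (T * ω) ^ 2)⁻¹ := by
  have hω := bracket_pos ω
  have hTω := bracket_pos (T * ω)
  have bracket_rpow_le : bracket ω ^ b ≤ T ^ (-b) * bracket (T * ω) := by
    calc bracket ω ^ b ≤ (T⁻¹ * bracket (T * ω)) ^ b := by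
          gcongr
          exact bracket_le_inv_mul hT hT1 ω
      _ = T ^ (-b) * bracket (T * ω) ^ b := by
          rw [Real.mul_rpow (by positivity) hTω.le, Real.inv_rpow hT.le, Real.rpow_neg hT.le]
      _ ≤ T ^ (-b) * bracket (T * ω) := by
          gcongr
          exact Real.rpow_le_self_of_one_le (one_le_bracket _) hb₁
  calc _ ≤ (T ^ (-b) * bracket (T * ω) * (T ^ 2 * bracket (T * ω) ^ (-2 : ℝ))) ^ 2 := by gcongr
    _ = (T ^ (-b) * T ^ 2) ^ 2 * (1 + (T * ω) ^ 2)⁻¹ := by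
        rw [bracket_rpow_neg_two, ← bracket_sq]
        field_simp
    _ = T ^ (4 - 2 * b) * (1 + (T * ω) ^ 2)⁻¹ := by
        rw [← Real.rpow_natCast T 2, ← Real.rpow_add hT, ← Real.rpow_mul_natCast hT.le]
        push_cast
        ring_nf

theorem exists_lintegral_weight_mul_profile_sq_le {s b : ℝ} (hs : -1 / 2 < s) (hs₀ : s ≤ 0)
    (hb₀ : 0 ≤ b) (hb₁ : b ≤ 1) :
    ∃ C : ℝ≥0, ∀ T : ℝ, 0 < T → T ≤ 1 → ∀ k : ℝ,
      ∫⁻ ω, (weight s b k ω * ENNReal.ofReal (T ^ 2 * bracket (T * ω) ^ (-2 : ℝ))) ^ 2 ≤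
        C * ENNReal.ofReal (T ^ (3 - 2 * b) * (T⁻¹ + |k|) ^ (2 * s)) := by
  obtain ⟨C, hC⟩ := exists_lintegral_abs_sub_rpow_mul_le (p := 2 * s) (by linarith) (by linarith)
  refine ⟨C, fun T hT hT1 k => ?_⟩
  calc _ ≤ ∫⁻ ω, ENNReal.ofReal (T ^ (4 - 2 * b)) *
        (ENNReal.ofReal (|ω - k| ^ (2 * s)) * ENNReal.ofReal (1 + (T * ω) ^ 2)⁻¹) := by
        refine lintegral_mono_ae ?_
        filter_upwards [bracket_rpow_le_abs_rpow_ae (p := 2 * s) (by linarith) k] with ω hω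
        have hk := bracket_rpow_pos (ω - k) s
        have := bracket_rpow_pos ω b
        have := bracket_rpow_pos (T * ω) (-2)
        rw [weight, ← ENNReal.ofReal_mul (by positivity), ← ENNReal.ofReal_pow (by positivity),
          ← ENNReal.ofReal_mul (by positivity), ← ENNReal.ofReal_mul (by positivity), mul_assoc,
          mul_pow, ← Real.rpow_mul_natCast (bracket_pos _).le, mul_comm s,
          mul_left_comm (T ^ (4 - 2 * b))]
        refine ENNReal.ofReal_le_ofReal ?_
        gcongr ?_ * ?_
        · exact_mod_cast hω
        · exact bracket_rpow_mul_profile_sq_le hb₀ hb₁ hT hT1 ω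
    _ ≤ ENNReal.ofReal (T ^ (4 - 2 * b)) *
          (C * ENNReal.ofReal (T⁻¹ * (T⁻¹ + |k|) ^ (2 * s))) := by
        rw [lintegral_const_mul' _ _ ENNReal.ofReal_ne_top]
        gcongr
        exact hC T hT k
    _ = C * ENNReal.ofReal (T ^ (3 - 2 * b) * (T⁻¹ + |k|) ^ (2 * s)) := by
        rw [mul_left_comm, ← ENNReal.ofReal_mul (by positivity), ← mul_assoc,
          ← Real.rpow_neg_one T, ← Real.rpow_add hT]
        ring_nf

theorem exists_lintegral_ball_bracket_rpow_le {q : ℝ} (hq : -1 < q) :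
    ∃ C : ℝ≥0, ∀ R : ℝ, 1 ≤ R →
      ∫⁻ θ in Metric.ball 0 R, ENNReal.ofReal (bracket θ ^ q) ≤
        C * ENNReal.ofReal (R ^ (q + 1)) := by
  have hq1 : 0 < q + 1 := by linarith
  rcases le_total q 0 with hq₀ | hq₀
  · refine ⟨(2 / (q + 1)).toNNReal, fun R hR => ?_⟩
    calc _ ≤ ∫⁻ θ in Metric.ball 0 R, ENNReal.ofReal (|θ - 0| ^ q) := by
          refine lintegral_mono_ae (ae_restrict_of_ae ?_)
          filter_upwards [bracket_rpow_le_abs_rpow_ae hq₀ 0] with θ hθ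
          rw [sub_zero] at hθ ⊢
          gcongr
      _ = ENNReal.ofReal (2 / (q + 1)) * ENNReal.ofReal (R ^ (q + 1)) := by
          rw [lintegral_ball_abs_sub_rpow hq (by linarith), ← ENNReal.ofReal_mul (by positivity)]
          ring_nf
  · refine ⟨(2 ^ (q + 1) : ℝ).toNNReal, fun R hR => ?_⟩
    calc _ ≤ ∫⁻ θ in Metric.ball (0 : ℝ) R, ENNReal.ofReal ((2 * R) ^ q) := by
          refine setLIntegral_mono' measurableSet_ball fun θ hθ => ?_
          have := bracket_pos θ
          gcongr
          rw [mem_ball_zero_iff, Real.norm_eq_abs] at hθ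
          linarith [bracket_le_one_add_abs θ]
      _ = ENNReal.ofReal (2 ^ (q + 1)) * ENNReal.ofReal (R ^ (q + 1)) := by
          rw [setLIntegral_const, Real.volume_ball, ← ENNReal.ofReal_mul (by positivity),
            ← ENNReal.ofReal_mul (by positivity), ← Real.rpow_add_one (by positivity),
            Real.mul_rpow zero_le_two (by positivity)]

theorem exists_lintegral_ball_weight_neg_sq_le {s b : ℝ} (hs : s ≤ 0) (hb : b < 1 / 2) :
    ∃ C : ℝ≥0, ∀ T : ℝ, 0 < T → T ≤ 1 → ∀ k : ℝ,
      ∫⁻ θ in Metric.ball 0 T⁻¹, weight (-s) (-b) k θ ^ 2 ≤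
        C * ENNReal.ofReal (T ^ (2 * b - 1) * (T⁻¹ + |k|) ^ (-(2 * s))) := by
  obtain ⟨C, hC⟩ := exists_lintegral_ball_bracket_rpow_le (q := -(2 * b)) (by linarith)
  refine ⟨(2 ^ (-(2 * s)) : ℝ).toNNReal * C, fun T hT hT1 k => ?_⟩
  have hT1' : 1 ≤ T⁻¹ := (one_le_inv₀ hT).2 hT1
  have pointwise : ∀ θ ∈ Metric.ball (0 : ℝ) T⁻¹, weight (-s) (-b) k θ ^ 2 ≤
      ENNReal.ofReal ((2 * (T⁻¹ + |k|)) ^ (-(2 * s))) *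
        ENNReal.ofReal (bracket θ ^ (-(2 * b))) := fun θ hθ => by
    rw [mem_ball_zero_iff, Real.norm_eq_abs] at hθ
    have := bracket_rpow_pos (θ - k) (-s)
    have hθb := bracket_rpow_pos θ
    have := hθb (-b)
    have shift_le : bracket (θ - k) ≤ 2 * (T⁻¹ + |k|) := by
      linarith [bracket_le_one_add_abs (θ - k), abs_sub θ k, abs_nonneg k]
    rw [weight, ← ENNReal.ofReal_pow (by positivity), ← ENNReal.ofReal_mul (by positivity),
      mul_pow, ← Real.rpow_mul_natCast (bracket_pos _).le,
      ← Real.rpow_mul_natCast (bracket_pos _).le]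
    refine ENNReal.ofReal_le_ofReal ?_
    rw [show -s * (2 : ℕ) = -(2 * s) by push_cast; ring,
      show -b * (2 : ℕ) = -(2 * b) by push_cast; ring]
    have := hθb (-(2 * b))
    gcongr
    · exact (bracket_pos _).le
    · linarith
  calc _ ≤ ∫⁻ θ in Metric.ball 0 T⁻¹, ENNReal.ofReal ((2 * (T⁻¹ + |k|)) ^ (-(2 * s))) *
        ENNReal.ofReal (bracket θ ^ (-(2 * b))) := setLIntegral_mono' measurableSet_ball pointwise
    _ ≤ ENNReal.ofReal ((2 * (T⁻¹ + |k|)) ^ (-(2 * s))) *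
          (C * ENNReal.ofReal (T⁻¹ ^ (-(2 * b) + 1))) := by
        rw [lintegral_const_mul' _ _ ENNReal.ofReal_ne_top]
        gcongr
        exact hC _ hT1'
    _ = _ := by
        rw [Real.mul_rpow zero_le_two (by positivity), ENNReal.ofReal_mul (by positivity),
          ENNReal.ofReal_mul (p := T ^ (2 * b - 1)) (by positivity), Real.inv_rpow hT.le,
          ← Real.rpow_neg hT.le, show -(-(2 * b) + 1) = 2 * b - 1 by ring, ENNReal.coe_mul,
          ENNReal.ofReal]
        ring

@[fun_prop]
theorem measurable_weight (s b k : ℝ) : Measurable (weight s b k) := by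
  unfold weight
  fun_prop

theorem weight_mul_weight_neg (s b k θ : ℝ) : weight s b k θ * weight (-s) (-b) k θ = 1 := by
  have := bracket_rpow_pos (θ - k) s
  have := bracket_rpow_pos θ b
  rw [weight, weight, ← ENNReal.ofReal_mul (by positivity), mul_mul_mul_comm,
    bracket_rpow_mul_rpow, bracket_rpow_mul_rpow, add_neg_cancel, add_neg_cancel, Real.rpow_zero,
    Real.rpow_zero, one_mul, ENNReal.ofReal_one]

theorem weight_mul_bracket_rpow (s b k θ r : ℝ) :
    weight s b k θ * ENNReal.ofReal (bracket θ ^ r) = weight s (b + r) k θ := by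
  have := bracket_rpow_pos (θ - k) s
  have := bracket_rpow_pos θ b
  rw [weight, weight, ← ENNReal.ofReal_mul (by positivity), mul_assoc, bracket_rpow_mul_rpow]

theorem add_sq_le_two_mul_sq_add_sq (x y : ℝ≥0∞) : (x + y) ^ 2 ≤ 2 * (x ^ 2 + y ^ 2) := by
  have := ENNReal.rpow_add_le_mul_rpow_add_rpow x y one_le_two
  norm_num at this
  exact this

theorem fiberSq_add_le (s b k : ℝ) {f : ℝ → ℂ} (hf : Measurable f) (g : ℝ → ℂ) :
    fiberSq s b k (fun θ => f θ + g θ) ≤ 2 * (fiberSq s b k f + fiberSq s b k g) := by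
  simp only [fiberSq]
  rw [← lintegral_add_left (by fun_prop), ← lintegral_const_mul' _ _ (by norm_num)]
  refine lintegral_mono fun θ => ?_
  calc (weight s b k θ * ‖f θ + g θ‖ₑ) ^ 2
      ≤ (weight s b k θ * ‖f θ‖ₑ + weight s b k θ * ‖g θ‖ₑ) ^ 2 := by
        rw [← mul_add]
        gcongr
        exact enorm_add_le _ _
    _ ≤ 2 * ((weight s b k θ * ‖f θ‖ₑ) ^ 2 + (weight s b k θ * ‖g θ‖ₑ) ^ 2) :=
        add_sq_le_two_mul_sq_add_sq _ _

theorem sq_lintegral_ball_le (s b k : ℝ) {h : ℝ → ℂ} (hh : Measurable h) (R : ℝ) :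
    (∫⁻ θ in Metric.ball 0 R, ‖h θ‖ₑ) ^ 2 ≤
      fiberSq s b k h * ∫⁻ θ in Metric.ball 0 R, weight (-s) (-b) k θ ^ 2 := by
  have factor (θ : ℝ) : ‖h θ‖ₑ = weight s b k θ * ‖h θ‖ₑ * weight (-s) (-b) k θ := by
    rw [mul_right_comm, weight_mul_weight_neg, one_mul]
  calc (∫⁻ θ in Metric.ball 0 R, ‖h θ‖ₑ) ^ 2
      = (∫⁻ θ in Metric.ball 0 R, weight s b k θ * ‖h θ‖ₑ * weight (-s) (-b) k θ) ^ 2 := by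
        simp_rw [← factor]
    _ ≤ _ := lintegral_mul_sq_le (by fun_prop) (by fun_prop)
    _ ≤ _ := by
        gcongr
        exact setLIntegral_le_lintegral _ _

theorem exists_lintegral_profile_mul_low_le {s b b' : ℝ} (hs : -1 / 2 < s) (hs₀ : s ≤ 0)
    (hb₀ : 0 ≤ b) (hb₁ : b ≤ 1) (hb' : b' < 1 / 2) :
    ∃ C : ℝ≥0, ∀ T : ℝ, 0 < T → T ≤ 1 → ∀ (k : ℝ) (h : ℝ → ℂ), Measurable h →
      (∫⁻ ω, (weight s b k ω * ENNReal.ofReal (T ^ 2 * bracket (T * ω) ^ (-2 : ℝ))) ^ 2) *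
          (∫⁻ θ in Metric.ball 0 T⁻¹, ‖h θ‖ₑ) ^ 2 ≤
        C * ENNReal.ofReal (T ^ (1 - b + b')) ^ 2 * fiberSq s b' k h := by
  obtain ⟨C₁, profile_le⟩ := exists_lintegral_weight_mul_profile_sq_le hs hs₀ hb₀ hb₁
  obtain ⟨C₂, dual_le⟩ := exists_lintegral_ball_weight_neg_sq_le hs₀ hb'
  refine ⟨C₁ * C₂, fun T hT hT1 k h hh => ?_⟩
  calc _ ≤ C₁ * ENNReal.ofReal (T ^ (3 - 2 * b) * (T⁻¹ + |k|) ^ (2 * s)) * (fiberSq s b' k h *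
        (C₂ * ENNReal.ofReal (T ^ (2 * b' - 1) * (T⁻¹ + |k|) ^ (-(2 * s))))) := by
        gcongr
        · exact profile_le T hT hT1 k
        · exact (sq_lintegral_ball_le s b' k hh T⁻¹).trans (by gcongr; exact dual_le T hT hT1 k)
    _ = C₁ * C₂ * ENNReal.ofReal (T ^ (3 - 2 * b) * (T⁻¹ + |k|) ^ (2 * s) *
          (T ^ (2 * b' - 1) * (T⁻¹ + |k|) ^ (-(2 * s)))) * fiberSq s b' k h := by
        rw [ENNReal.ofReal_mul (p := _ * _) (by positivity)]
        ring
    _ = (C₁ * C₂ : ℝ≥0) * ENNReal.ofReal (T ^ (1 - b + b')) ^ 2 * fiberSq s b' k h := by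
        rw [← ENNReal.ofReal_pow (by positivity), mul_mul_mul_comm,
          ← Real.rpow_add (by positivity : 0 < T⁻¹ + |k|), ← Real.rpow_add hT, add_neg_cancel,
          Real.rpow_zero, mul_one, ← Real.rpow_mul_natCast hT.le, ENNReal.coe_mul]
        push_cast
        ring_nf

theorem measurable_highPart_uncurry (T : ℝ) {h : ℝ × ℝ → ℂ} (hh : Measurable h) :
    Measurable fun z : ℝ × ℝ => highPart T (fun θ => h (θ, z.2)) z.1 := by
  have : (fun z : ℝ × ℝ => highPart T (fun θ => h (θ, z.2)) z.1) =
      (Prod.fst ⁻¹' (Metric.ball (0 : ℝ) T⁻¹)ᶜ).indicator fun z => h z / (Complex.I * z.1) := rfl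
  rw [this]
  exact Measurable.indicator (by fun_prop) (measurable_fst measurableSet_ball.compl)

@[fun_prop]
theorem measurable_highPart (T : ℝ) {h : ℝ → ℂ} (hh : Measurable h) :
    Measurable (highPart T h) :=
  Measurable.indicator (by fun_prop) measurableSet_ball.compl

theorem measurable_lowKernel (K : 𝓢(ℝ, ℂ)) (T : ℝ) :
    Measurable fun z : ℝ × ℝ => lowKernel K T z.1 z.2 := by
  have hK : Measurable K := K.continuous.measurable
  unfold lowKernel
  fun_prop

theorem measurable_duhamel_uncurry (K : 𝓢(ℝ, ℂ)) (T : ℝ) {a : ℝ → ℂ} (ha : Measurable a)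
    {h : ℝ × ℝ → ℂ} (hh : Measurable h) :
    Measurable fun z : ℝ × ℝ => duhamel K T (a z.2) (fun θ => h (θ, z.2)) z.1 := by
  have hK : Measurable K := K.continuous.measurable
  have high := measurable_highPart_uncurry T hh
  have integral_high : Measurable fun z : ℝ × ℝ => ∫ θ, highPart T (fun θ => h (θ, z.2)) θ := by
    refine (StronglyMeasurable.integral_prod_right' (f := fun y : (ℝ × ℝ) × ℝ =>
      highPart T (fun θ => h (θ, y.1.2)) y.2) ?_).measurable
    exact (high.comp (g := fun z : ℝ × ℝ => highPart T (fun θ => h (θ, z.2)) z.1)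
      (f := fun y : (ℝ × ℝ) × ℝ => (y.2, y.1.2)) (by fun_prop)).stronglyMeasurable
  have integral_low : Measurable fun z : ℝ × ℝ =>
      ∫ θ in Metric.ball 0 T⁻¹, h (θ, z.2) * lowKernel K T z.1 θ := by
    refine (StronglyMeasurable.integral_prod_right' (f := fun y : (ℝ × ℝ) × ℝ =>
      h (y.2, y.1.2) * lowKernel K T y.1.1 y.2) ?_).measurable
    have kernel := (measurable_lowKernel K T).comp
      (f := fun y : (ℝ × ℝ) × ℝ => (y.1.1, y.2)) (by fun_prop)
    exact (Measurable.mul (by fun_prop) kernel).stronglyMeasurable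
  unfold duhamel
  exact (((hK.comp measurable_fst).mul ((ha.comp measurable_snd).sub
    (integral_high.const_mul _))).add high).add (integral_low.const_mul _)

theorem inv_abs_le_of_inv_le {T δ θ : ℝ} (hT : 0 < T) (hT1 : T ≤ 1) (hδ : 0 ≤ δ)
    (hθ : T⁻¹ ≤ |θ|) : |θ|⁻¹ ≤ 2 * T ^ δ * bracket θ ^ (-1 + δ) := by
  have hθ1 : 1 ≤ |θ| := ((one_le_inv₀ hT).2 hT1).trans hθ
  have hb := bracket_pos θ
  have inv_le : |θ|⁻¹ ≤ 2 * bracket θ ^ (-1 : ℝ) := by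
    rw [Real.rpow_neg_one, inv_le_comm₀ (by positivity) (by positivity), mul_inv, inv_inv]
    linarith [bracket_le_one_add_abs θ]
  have one_le : 1 ≤ T ^ δ * bracket θ ^ δ := by
    rw [← Real.mul_rpow hT.le hb.le]
    refine Real.one_le_rpow ?_ hδ
    rw [← inv_le_iff_one_le_mul₀' hT]
    exact hθ.trans (abs_le_bracket θ)
  calc |θ|⁻¹ ≤ 2 * bracket θ ^ (-1 : ℝ) := inv_le
    _ ≤ 2 * bracket θ ^ (-1 : ℝ) * (T ^ δ * bracket θ ^ δ) :=
        le_mul_of_one_le_right (by positivity) one_le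
    _ = 2 * T ^ δ * bracket θ ^ (-1 + δ) := by
        rw [← bracket_rpow_mul_rpow]
        ring

theorem enorm_highPart_le {T δ : ℝ} (hT : 0 < T) (hT1 : T ≤ 1) (hδ : 0 ≤ δ) (h : ℝ → ℂ)
    (θ : ℝ) : ‖highPart T h θ‖ₑ ≤
      2 * ENNReal.ofReal (T ^ δ) * (ENNReal.ofReal (bracket θ ^ (-1 + δ)) * ‖h θ‖ₑ) := by
  by_cases hθ : θ ∈ Metric.ball 0 T⁻¹
  · rw [highPart, indicator_of_notMem (notMem_compl_iff.2 hθ), enorm_zero]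
    exact zero_le
  have hb := bracket_rpow_pos θ (-1 + δ)
  rw [highPart, indicator_of_mem hθ, div_eq_mul_inv, enorm_mul, mul_comm, ← mul_assoc,
    ← ENNReal.ofReal_ofNat 2, ← ENNReal.ofReal_mul (by positivity),
    ← ENNReal.ofReal_mul (by positivity), ← ofReal_norm, norm_inv, norm_mul, Complex.norm_I,
    one_mul, Complex.norm_real]
  gcongr
  rw [mem_ball_zero_iff, not_lt] at hθ
  exact inv_abs_le_of_inv_le hT hT1 hδ hθ

theorem lintegral_enorm_highPart_le {T δ : ℝ} (hT : 0 < T) (hT1 : T ≤ 1) (hδ : 0 ≤ δ)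
    {h : ℝ → ℂ} :
    ∫⁻ θ, ‖highPart T h θ‖ₑ ≤ 2 * ENNReal.ofReal (T ^ δ) *
      ∫⁻ θ, ENNReal.ofReal (bracket θ ^ (-1 + δ)) * ‖h θ‖ₑ := by
  rw [← lintegral_const_mul' _ _ (ENNReal.mul_ne_top ENNReal.ofNat_ne_top ENNReal.ofReal_ne_top)]
  exact lintegral_mono fun θ => enorm_highPart_le hT hT1 hδ h θ

theorem fiberSq_highPart_le (s b k : ℝ) {T δ : ℝ} (hT : 0 < T) (hT1 : T ≤ 1) (hδ : 0 ≤ δ)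
    (h : ℝ → ℂ) : fiberSq s b k (highPart T h) ≤
      4 * ENNReal.ofReal (T ^ δ) ^ 2 * fiberSq s (b - 1 + δ) k h := by
  rw [fiberSq, fiberSq, ← lintegral_const_mul' _ _
    (ENNReal.mul_ne_top ENNReal.ofNat_ne_top (ENNReal.pow_ne_top ENNReal.ofReal_ne_top))]
  refine lintegral_mono fun θ => ?_
  calc (weight s b k θ * ‖highPart T h θ‖ₑ) ^ 2
      ≤ (weight s b k θ * (2 * ENNReal.ofReal (T ^ δ) *
          (ENNReal.ofReal (bracket θ ^ (-1 + δ)) * ‖h θ‖ₑ))) ^ 2 := by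
        gcongr
        exact enorm_highPart_le hT hT1 hδ h θ
    _ = 4 * ENNReal.ofReal (T ^ δ) ^ 2 * (weight s b k θ *
          ENNReal.ofReal (bracket θ ^ (-1 + δ)) * ‖h θ‖ₑ) ^ 2 := by ring
    _ = 4 * ENNReal.ofReal (T ^ δ) ^ 2 * (weight s (b - 1 + δ) k θ * ‖h θ‖ₑ) ^ 2 := by
        rw [weight_mul_bracket_rpow, ← add_assoc, ← sub_eq_add_neg]

theorem enorm_two_pi_inv_le_one : ‖(2 * Real.pi : ℂ)⁻¹‖ₑ ≤ 1 := by
  have : (1 : ℝ) ≤ 2 * Real.pi := by linarith [Real.pi_gt_three]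
  rw [← Complex.ofReal_ofNat, ← Complex.ofReal_mul, enorm_inv (by norm_num [Real.pi_ne_zero]),
    ENNReal.inv_le_one, ← ofReal_norm, Complex.norm_real, Real.norm_of_nonneg (by positivity)]
  exact ENNReal.one_le_ofReal.2 this

theorem enorm_low_le {K : 𝓢(ℝ, ℂ)} {A T : ℝ} (hA₀ : 0 ≤ A) (hT : 0 < T) {ω : ℝ}
    (hA : ∀ θ : ℝ, |θ| ≤ T⁻¹ →
      ‖(K (T * (ω - θ)) - K (T * ω)) / (Complex.I * θ)‖ ≤ A * (T * bracket (T * ω) ^ (-2 : ℝ)))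
    {h : ℝ → ℂ} (hh : Measurable h) :
    ‖(2 * Real.pi : ℂ)⁻¹ * ∫ θ in Metric.ball 0 T⁻¹, h θ * lowKernel K T ω θ‖ₑ ≤
      ENNReal.ofReal A * ENNReal.ofReal (T ^ 2 * bracket (T * ω) ^ (-2 : ℝ)) *
        ∫⁻ θ in Metric.ball 0 T⁻¹, ‖h θ‖ₑ := by
  have kernel_le (θ : ℝ) (hθ : θ ∈ Metric.ball (0 : ℝ) T⁻¹) : ‖lowKernel K T ω θ‖ₑ ≤
      ENNReal.ofReal A * ENNReal.ofReal (T ^ 2 * bracket (T * ω) ^ (-2 : ℝ)) := by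
    rw [mem_ball_zero_iff, Real.norm_eq_abs] at hθ
    rw [lowKernel, ← mul_sub, mul_div_assoc, ← ENNReal.ofReal_mul hA₀, ← ofReal_norm, norm_mul,
      Complex.norm_real, Real.norm_of_nonneg hT.le]
    refine ENNReal.ofReal_le_ofReal ?_
    calc _ ≤ T * (A * (T * bracket (T * ω) ^ (-2 : ℝ))) := by
          gcongr
          exact hA θ hθ.le
      _ = _ := by ring
  rw [enorm_mul]
  refine (mul_le_of_le_one_left' enorm_two_pi_inv_le_one).trans ?_
  refine (enorm_integral_le_lintegral_enorm _).trans ?_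
  rw [← lintegral_const_mul _ (by fun_prop)]
  refine setLIntegral_mono' measurableSet_ball fun θ hθ => ?_
  rw [enorm_mul, mul_comm]
  gcongr
  exact kernel_le θ hθ

theorem exists_fiberSq_low_le {s b b' : ℝ} (hs : -1 / 2 < s) (hs₀ : s ≤ 0)
    (hb₀ : 0 ≤ b) (hb₁ : b ≤ 1) (hb' : b' < 1 / 2) (K : 𝓢(ℝ, ℂ)) :
    ∃ C : ℝ≥0, ∀ T : ℝ, 0 < T → T ≤ 1 → ∀ (k : ℝ) (h : ℝ → ℂ), Measurable h →
      fiberSq s b k (fun ω =>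
          (2 * Real.pi : ℂ)⁻¹ * ∫ θ in Metric.ball 0 T⁻¹, h θ * lowKernel K T ω θ) ≤
        C * ENNReal.ofReal (T ^ (1 - b + b')) ^ 2 * fiberSq s b' k h := by
  obtain ⟨A, hA₀, hA⟩ := exists_difference_quotient_le K
  obtain ⟨C, hC⟩ := exists_lintegral_profile_mul_low_le hs hs₀ hb₀ hb₁ hb'
  refine ⟨A.toNNReal ^ 2 * C, fun T hT hT1 k h hh => ?_⟩
  set P : ℝ → ℝ≥0∞ := fun ω => ENNReal.ofReal (T ^ 2 * bracket (T * ω) ^ (-2 : ℝ))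
  set L := ∫⁻ θ in Metric.ball 0 T⁻¹, ‖h θ‖ₑ
  have low_le (ω : ℝ) :
      ‖(2 * Real.pi : ℂ)⁻¹ * ∫ θ in Metric.ball 0 T⁻¹, h θ * lowKernel K T ω θ‖ₑ ≤
        ENNReal.ofReal A * P ω * L :=
    enorm_low_le hA₀ hT (fun θ hθ => hA T hT θ ω hθ) hh
  have measurable_P : Measurable P := by fun_prop
  calc _ ≤ ∫⁻ ω, (weight s b k ω * (ENNReal.ofReal A * P ω * L)) ^ 2 :=
        lintegral_mono fun ω => pow_le_pow_left' (mul_le_mul' le_rfl (low_le ω)) 2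
    _ = ∫⁻ ω, ENNReal.ofReal A ^ 2 * ((weight s b k ω * P ω) ^ 2 * L ^ 2) := by
        congr with ω
        ring
    _ = ENNReal.ofReal A ^ 2 * ((∫⁻ ω, (weight s b k ω * P ω) ^ 2) * L ^ 2) := by
        rw [lintegral_const_mul' _ _ (by finiteness), lintegral_mul_const _ (by fun_prop)]
    _ ≤ ENNReal.ofReal A ^ 2 * (C * ENNReal.ofReal (T ^ (1 - b + b')) ^ 2 * fiberSq s b' k h) :=
        mul_le_mul' le_rfl (hC T hT hT1 k h hh)
    _ = _ := by
        rw [ENNReal.coe_mul, ENNReal.coe_pow, ENNReal.ofReal]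
        ring

theorem enorm_sub_integral_highPart_le {T δ : ℝ} (hT : 0 < T) (hT1 : T ≤ 1) (hδ : 0 ≤ δ) (a : ℂ)
    (h : ℝ → ℂ) :
    ‖a - (2 * Real.pi : ℂ)⁻¹ * ∫ θ, highPart T h θ‖ₑ ≤ ‖a‖ₑ + 2 * (ENNReal.ofReal (T ^ δ) *
      ∫⁻ θ, ENNReal.ofReal (bracket θ ^ (-1 + δ)) * ‖h θ‖ₑ) := by
  refine enorm_sub_le.trans ?_
  gcongr
  rw [enorm_mul, ← mul_assoc]
  exact (mul_le_of_le_one_left' enorm_two_pi_inv_le_one).trans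
    ((enorm_integral_le_lintegral_enorm _).trans (lintegral_enorm_highPart_le hT hT1 hδ))

theorem exists_fiberSq_free_le {s : ℝ} (hs₀ : s ≤ 0) (b : ℝ) {δ : ℝ} (hδ : 0 ≤ δ) (K : 𝓢(ℝ, ℂ)) :
    ∃ C : ℝ≥0, ∀ T : ℝ, 0 < T → T ≤ 1 → ∀ (k : ℝ) (a : ℂ) (h : ℝ → ℂ),
      fiberSq s b k (fun ω => K ω * (a - (2 * Real.pi : ℂ)⁻¹ * ∫ θ, highPart T h θ)) ≤
        C * ((ENNReal.ofReal (bracket k ^ s) * ‖a‖ₑ) ^ 2 + ENNReal.ofReal (T ^ δ) ^ 2 *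
          (ENNReal.ofReal (bracket k ^ s) *
            ∫⁻ θ, ENNReal.ofReal (bracket θ ^ (-1 + δ)) * ‖h θ‖ₑ) ^ 2) := by
  obtain ⟨C, hC⟩ := exists_lintegral_weight_mul_schwartz_sq_le hs₀ b K
  refine ⟨8 * C, fun T hT hT1 k a h => ?_⟩
  have hK : Measurable K := K.continuous.measurable
  have amplitude_le := enorm_sub_integral_highPart_le hT hT1 hδ a h
  set t := ENNReal.ofReal (T ^ δ)
  set X := ENNReal.ofReal (bracket k ^ s)
  set Y := ∫⁻ θ, ENNReal.ofReal (bracket θ ^ (-1 + δ)) * ‖h θ‖ₑ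
  set A := a - (2 * Real.pi : ℂ)⁻¹ * ∫ θ, highPart T h θ
  calc fiberSq s b k (fun ω => K ω * A)
      = (∫⁻ ω, (weight s b k ω * ‖K ω‖ₑ) ^ 2) * ‖A‖ₑ ^ 2 := by
        simp only [fiberSq, enorm_mul, ← mul_assoc, mul_pow _ ‖A‖ₑ]
        exact lintegral_mul_const _ (by fun_prop)
    _ ≤ C * X ^ 2 * (‖a‖ₑ + 2 * (t * Y)) ^ 2 := by
        gcongr
        exact hC k
    _ ≤ C * X ^ 2 * (2 * (‖a‖ₑ ^ 2 + (2 * (t * Y)) ^ 2)) := by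
        gcongr
        exact add_sq_le_two_mul_sq_add_sq _ _
    _ = 2 * C * ((X * ‖a‖ₑ) ^ 2 + 4 * (t ^ 2 * (X * Y) ^ 2)) := by ring
    _ ≤ 2 * C * (4 * (X * ‖a‖ₑ) ^ 2 + 4 * (t ^ 2 * (X * Y) ^ 2)) := by
        gcongr
        exact le_mul_of_one_le_left' (by norm_num)
    _ = (8 * C : ℝ≥0) * ((X * ‖a‖ₑ) ^ 2 + t ^ 2 * (X * Y) ^ 2) := by
        push_cast
        ring

theorem exists_fiberSq_duhamel_le {s b δ : ℝ} (hs : -1 / 2 < s) (hs₀ : s ≤ 0) (hb₀ : 0 ≤ b)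
    (hb₁ : b ≤ 1) (hδ : 0 ≤ δ) (hbδ : b + δ < 3 / 2) (K : 𝓢(ℝ, ℂ)) :
    ∃ C : ℝ≥0, ∀ T : ℝ, 0 < T → T ≤ 1 → ∀ (k : ℝ) (a : ℂ) (h : ℝ → ℂ), Measurable h →
      fiberSq s b k (duhamel K T a h) ≤
        C * ((ENNReal.ofReal (bracket k ^ s) * ‖a‖ₑ) ^ 2 + ENNReal.ofReal (T ^ δ) ^ 2 *
          ((ENNReal.ofReal (bracket k ^ s) *
              ∫⁻ θ, ENNReal.ofReal (bracket θ ^ (-1 + δ)) * ‖h θ‖ₑ) ^ 2 +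
            fiberSq s (b - 1 + δ) k h)) := by
  obtain ⟨C₀, free_le⟩ := exists_fiberSq_free_le hs₀ b hδ K
  obtain ⟨C₁, low_le⟩ := exists_fiberSq_low_le hs hs₀ hb₀ hb₁ (b' := b - 1 + δ) (by linarith) K
  refine ⟨2 * (2 * (C₀ + 4) + C₁), fun T hT hT1 k a h hh => ?_⟩
  have hK : Measurable K := K.continuous.measurable
  have free := free_le T hT hT1 k a h
  have high := fiberSq_highPart_le s b k hT hT1 hδ h
  have low := low_le T hT hT1 k h hh
  rw [show 1 - b + (b - 1 + δ) = δ by ring] at low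
  set t := ENNReal.ofReal (T ^ δ)
  set U := (ENNReal.ofReal (bracket k ^ s) * ‖a‖ₑ) ^ 2
  set Y := (ENNReal.ofReal (bracket k ^ s) *
    ∫⁻ θ, ENNReal.ofReal (bracket θ ^ (-1 + δ)) * ‖h θ‖ₑ) ^ 2
  set Z := fiberSq s (b - 1 + δ) k h
  calc fiberSq s b k (duhamel K T a h)
      ≤ 2 * (2 * (C₀ * (U + t ^ 2 * Y) + 4 * t ^ 2 * Z) + C₁ * t ^ 2 * Z) := by
        refine (fiberSq_add_le s b k (by fun_prop) _).trans ?_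
        gcongr
        refine (fiberSq_add_le s b k (by fun_prop) _).trans ?_
        gcongr
    _ ≤ 2 * (2 * (C₀ * (U + t ^ 2 * Y) + 4 * t ^ 2 * Z) + C₁ * t ^ 2 * Z) +
          (2 * (8 + C₁) * (U + t ^ 2 * Y) + 4 * C₀ * (t ^ 2 * Z)) := le_self_add
    _ = (2 * (2 * (C₀ + 4) + C₁) : ℝ≥0) * (U + t ^ 2 * (Y + Z)) := by
        push_cast
        ring

/-! ### Functions representing a Fourier transform -/

section Representatives

open scoped ContDiff

theorem exists_schwartzMap_eq_ofReal {E : Type*} [NormedAddCommGroup E] [NormedSpace ℝ E]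
    {f : E → ℝ} (hf : ContDiff ℝ ∞ f) (hc : HasCompactSupport f) :
    ∃ φ : 𝓢(E, ℂ), ∀ x, φ x = f x :=
  ⟨(hc.comp_left Complex.ofReal_zero).toSchwartzMap (Complex.ofRealCLM.contDiff.comp hf),
    fun _ => rfl⟩

variable {E : Type*} [NormedAddCommGroup E] [InnerProductSpace ℝ E] [FiniteDimensional ℝ E]
  [MeasurableSpace E] [BorelSpace E]

theorem quasiMeasurePreserving_smul {r : ℝ} (hr : r ≠ 0) :
    Measure.QuasiMeasurePreserving (fun x : E => r • x) := by
  refine ⟨by fun_prop, ?_⟩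
  rw [Measure.map_addHaar_smul volume hr]
  exact Measure.smul_absolutelyContinuous

theorem IsFourierTransform.locallyIntegrable {u : 𝓢'(E, ℂ)} {G : E → ℂ}
    (h : IsFourierTransform u G) : LocallyIntegrable fun k => G ((2 * Real.pi) • k) := by
  intro x
  let ρ : ContDiffBump x := ⟨1, 2, one_pos, one_lt_two⟩
  obtain ⟨φ, hφ⟩ := exists_schwartzMap_eq_ofReal ρ.contDiff ρ.hasCompactSupport
  refine ⟨Metric.closedBall x 1, Metric.closedBall_mem_nhds x one_pos, ?_⟩
  refine (h.2 φ).1.integrableOn.congr_fun (fun k hk => ?_) measurableSet_closedBall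
  simp only [hφ, ρ.one_of_mem_closedBall hk, Complex.ofReal_one, mul_one]

theorem IsFourierTransform.ae_eq {u : 𝓢'(E, ℂ)} {G G' : E → ℂ} (h : IsFourierTransform u G)
    (h' : IsFourierTransform u G') : G =ᵐ[volume] G' := by
  have ae_eq_zero : ∀ᵐ k : E, G ((2 * Real.pi) • k) - G' ((2 * Real.pi) • k) = 0 := by
    refine ae_eq_zero_of_integral_contDiff_smul_eq_zero
      (h.locallyIntegrable.sub h'.locallyIntegrable) fun g hg hgc => ?_
    obtain ⟨φ, hφ⟩ := exists_schwartzMap_eq_ofReal hg hgc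
    obtain ⟨integrable, eq⟩ := h.2 φ
    obtain ⟨integrable', eq'⟩ := h'.2 φ
    rw [← sub_self ((𝓕 u) φ)]
    nth_rw 1 [eq]
    rw [eq', ← integral_sub integrable integrable']
    refine integral_congr_ae (.of_forall fun k => ?_)
    simp only [hφ, Complex.real_smul]
    ring
  have two_pi_ne_zero : 2 * Real.pi ≠ 0 := by positivity
  filter_upwards [(quasiMeasurePreserving_smul (inv_ne_zero two_pi_ne_zero)).ae ae_eq_zero]
    with p hp
  rw [smul_inv_smul₀ two_pi_ne_zero] at hp
  exact sub_eq_zero.1 hp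

theorem exists_isFourierTransform {G w : E → ℂ} (hG : Measurable G) (hw : w.HasTemperateGrowth)
    (hw₀ : ∀ k, w k ≠ 0) (hGw : MemLp (fun k => (w k)⁻¹ * G ((2 * Real.pi) • k)) 2) :
    ∃ u : 𝓢'(E, ℂ), IsFourierTransform u G := by
  let v : 𝓢'(E, ℂ) := TemperedDistribution.smulLeftCLM ℂ w
    (Lp.toTemperedDistribution hGw.toLp)
  have factor (φ : 𝓢(E, ℂ)) (k : E) :
      SchwartzMap.smulLeftCLM ℂ w φ k * ((w k)⁻¹ * G ((2 * Real.pi) • k)) =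
        G ((2 * Real.pi) • k) * φ k := by
    rw [SchwartzMap.smulLeftCLM_apply_apply hw, smul_eq_mul]
    field_simp [hw₀ k]
  refine ⟨𝓕⁻ v, hG, fun φ => ⟨?_, ?_⟩⟩
  · exact (((SchwartzMap.smulLeftCLM ℂ w φ).memLp 2).integrable_mul hGw).congr
      (.of_forall (factor φ))
  · rw [FourierTransform.fourier_fourierInv_eq, TemperedDistribution.smulLeftCLM_apply_apply,
      Lp.toTemperedDistribution_apply]
    refine integral_congr_ae ?_
    filter_upwards [hGw.coeFn_toLp] with k hk
    rw [hk, smul_eq_mul, factor]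

theorem IsFourierTransform.apply_eq {u : 𝓢'(E, ℂ)} {G : E → ℂ} (h : IsFourierTransform u G)
    (φ : 𝓢(E, ℂ)) : u φ = ∫ k : E, G ((2 * Real.pi) • k) * (𝓕⁻ φ) k := by
  rw [← (h.2 (𝓕⁻ φ)).2, TemperedDistribution.fourier_apply,
    FourierTransform.fourier_fourierInv_eq]

theorem hNorm_eq (s : ℝ) {f : 𝓢'(ℝ, ℂ)} {G : ℝ → ℂ} (h : IsFourierTransform f G) :
    HNorm s f = (∫⁻ ξ : ℝ, (ENNReal.ofReal (bracket ξ ^ s) * ‖G ξ‖ₑ) ^ 2) ^ (1 / 2 : ℝ) := by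
  refine le_antisymm (iInf₂_le_of_le G h le_rfl) (le_iInf₂ fun G' hG' => le_of_eq ?_)
  congr 1
  refine lintegral_congr_ae ?_
  filter_upwards [hG'.ae_eq h] with ξ hξ
  rw [hξ]

end Representatives

/-! ### The norms in characteristic coordinates -/

theorem measurePreserving_pair :
    MeasurePreserving (fun z : ℝ × ℝ => (!₂[z.1, z.2] : SpaceTime)) := by
  have eq_comp : (fun z : ℝ × ℝ => (!₂[z.1, z.2] : SpaceTime)) =
      WithLp.toLp 2 ∘ (MeasurableEquiv.finTwoArrow (α := ℝ)).symm := by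
    funext z
    ext i
    fin_cases i <;> rfl
  rw [eq_comp]
  exact (PiLp.volume_preserving_toLp (Fin 2)).comp (volume_preserving_finTwoArrow ℝ).symm

/-- The coordinates `θ = τ + σ ξ` and `ξ` on the frequency side. -/
def freqChart (σ : ℝ) (z : ℝ × ℝ) : SpaceTime := !₂[z.1 - σ * z.2, z.2]

@[simp] theorem freqChart_zero (σ : ℝ) (z : ℝ × ℝ) : freqChart σ z 0 = z.1 - σ * z.2 := rfl

@[simp] theorem freqChart_one (σ : ℝ) (z : ℝ × ℝ) : freqChart σ z 1 = z.2 := rfl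

theorem continuous_freqChart (σ : ℝ) : Continuous (freqChart σ) := by
  unfold freqChart
  fun_prop

@[fun_prop]
theorem measurable_freqChart (σ : ℝ) : Measurable (freqChart σ) :=
  (continuous_freqChart σ).measurable

theorem measurePreserving_freqChart (σ : ℝ) : MeasurePreserving (freqChart σ) := by
  have shear : MeasurePreserving (fun z : ℝ × ℝ => (z.1, z.2 - σ * z.1)) :=
    (MeasurePreserving.id volume).skew_product (g := fun ξ τ => τ - σ * ξ) (by fun_prop)
      (.of_forall fun ξ => (measurePreserving_sub_right volume (σ * ξ)).map_eq)
  exact measurePreserving_pair.comp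
    ((Measure.measurePreserving_swap.comp shear).comp Measure.measurePreserving_swap)

theorem measurableEmbedding_freqChart (σ : ℝ) : MeasurableEmbedding (freqChart σ) := by
  refine (continuous_freqChart σ).measurableEmbedding fun z w h => ?_
  have h₀ := congr($h 0)
  have h₁ : z.2 = w.2 := congr($h 1)
  simp only [freqChart_zero, h₁, sub_left_inj] at h₀
  exact Prod.ext h₀ h₁

theorem lintegral_comp_freqChart (σ : ℝ) {F : SpaceTime → ℝ≥0∞} (hF : Measurable F) :
    ∫⁻ p, F p = ∫⁻ ξ, ∫⁻ θ, F (freqChart σ (θ, ξ)) := by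
  rw [← (measurePreserving_freqChart σ).lintegral_comp hF, Measure.volume_eq_prod,
    lintegral_prod_symm (fun z => F (freqChart σ z)) (by fun_prop)]

theorem ae_ae_freqChart (σ : ℝ) {p : SpaceTime → Prop} (hp : ∀ᵐ x, p x) :
    ∀ᵐ ξ : ℝ, ∀ᵐ θ : ℝ, p (freqChart σ (θ, ξ)) :=
  Measure.ae_ae_of_ae_prod <|
    (Measure.measurePreserving_swap (μ := (volume : Measure ℝ))
      (ν := (volume : Measure ℝ))).quasiMeasurePreserving.ae
      ((measurePreserving_freqChart σ).quasiMeasurePreserving.ae hp)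

/-- The square of the `Z`-norm, in terms of the Fourier transform as a function of `θ = τ + σ ξ`
and `ξ`. -/
noncomputable def zSq (σ s b : ℝ) (h : ℝ × ℝ → ℂ) : ℝ≥0∞ :=
  ∫⁻ ξ, fiberSq s b (2 * σ * ξ) fun θ => h (θ, ξ)

/-- The square of the `Y`-norm, in terms of the Fourier transform as a function of `θ = τ + σ ξ`
and `ξ`. -/
noncomputable def ySq (s b : ℝ) (h : ℝ × ℝ → ℂ) : ℝ≥0∞ :=
  ∫⁻ ξ, (ENNReal.ofReal (bracket ξ ^ s) *
    ∫⁻ θ, ENNReal.ofReal (bracket θ ^ b) * ‖h (θ, ξ)‖ₑ) ^ 2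

theorem lintegral_weight_eq_zSq (σ s b : ℝ) {G : SpaceTime → ℂ} (hG : Measurable G) :
    ∫⁻ p : SpaceTime,
      (ENNReal.ofReal (bracket (p 0 - σ * p 1) ^ s * bracket (p 0 + σ * p 1) ^ b) * ‖G p‖ₑ) ^ 2 =
      zSq σ s b (G ∘ freqChart σ) := by
  rw [lintegral_comp_freqChart σ (by fun_prop)]
  refine lintegral_congr fun ξ => lintegral_congr fun θ => ?_
  simp only [freqChart_zero, freqChart_one, weight, Function.comp_apply]
  ring_nf

theorem zNorm_eq (σ s b : ℝ) {u : 𝓢'(SpaceTime, ℂ)} {G : SpaceTime → ℂ}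
    (h : IsFourierTransform u G) : ZNorm σ s b u = zSq σ s b (G ∘ freqChart σ) ^ (1 / 2 : ℝ) := by
  rw [← lintegral_weight_eq_zSq σ s b h.1]
  refine le_antisymm (iInf₂_le_of_le G h le_rfl) (le_iInf₂ fun G' hG' => le_of_eq ?_)
  congr 1
  refine lintegral_congr_ae ?_
  filter_upwards [hG'.ae_eq h] with p hp
  rw [hp]

theorem lintegral_weight_eq_ySq (σ s b : ℝ) (G : SpaceTime → ℂ) :
    ∫⁻ ξ : ℝ, (∫⁻ τ : ℝ,
      ENNReal.ofReal (bracket ξ ^ s * bracket (τ + σ * ξ) ^ b) * ‖G !₂[τ, ξ]‖ₑ) ^ 2 =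
      ySq s b (G ∘ freqChart σ) := by
  refine lintegral_congr fun ξ => ?_
  have hξ := bracket_rpow_pos ξ s
  rw [← lintegral_const_mul' _ _ ENNReal.ofReal_ne_top,
    ← lintegral_sub_right_eq_self (μ := volume) _ (σ * ξ)]
  congr 2 with θ
  rw [sub_add_cancel, ENNReal.ofReal_mul hξ.le, mul_assoc]
  rfl

theorem yNorm_eq (σ s b : ℝ) {u : 𝓢'(SpaceTime, ℂ)} {G : SpaceTime → ℂ}
    (h : IsFourierTransform u G) : YNorm σ s b u = ySq s b (G ∘ freqChart σ) ^ (1 / 2 : ℝ) := by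
  simp only [YNorm, lintegral_weight_eq_ySq]
  refine le_antisymm (iInf₂_le_of_le G h le_rfl) (le_iInf₂ fun G' hG' => le_of_eq ?_)
  congr 1
  refine lintegral_congr_ae ?_
  filter_upwards [ae_ae_freqChart σ (hG'.ae_eq h)] with ξ hξ
  congr 2
  refine lintegral_congr_ae ?_
  filter_upwards [hξ] with θ hθ
  simp only [Function.comp_apply, hθ]

theorem one_le_weight_mul {s b : ℝ} (hs : -1 ≤ s) (hb : 0 ≤ b) (σ : ℝ) (p : SpaceTime) :
    1 ≤ bracket (p 0 - σ * p 1) ^ s * bracket (p 0 + σ * p 1) ^ b *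
      ((2 + |σ|) * (1 + ‖p‖ ^ 2)) := by
  have hp := bracket_pos (p 0 - σ * p 1)
  have hpb := bracket_rpow_pos (p 0 + σ * p 1) b
  have bracket_le : bracket (p 0 - σ * p 1) ≤ (2 + |σ|) * (1 + ‖p‖ ^ 2) := by
    have fst_le : |p 0| ≤ ‖p‖ := PiLp.norm_apply_le p 0
    have snd_le : |σ * p 1| ≤ |σ| * ‖p‖ := by
      rw [abs_mul]
      gcongr
      exact PiLp.norm_apply_le p 1
    have norm_le : ‖p‖ ≤ 1 + ‖p‖ ^ 2 := by nlinarith [sq_nonneg (‖p‖ - 1)]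
    nlinarith [bracket_le_one_add_abs (p 0 - σ * p 1), abs_sub (p 0) (σ * p 1), abs_nonneg σ,
      sq_nonneg ‖p‖, mul_le_mul_of_nonneg_left norm_le (abs_nonneg σ)]
  have inv_le : (bracket (p 0 - σ * p 1))⁻¹ ≤ bracket (p 0 - σ * p 1) ^ s := by
    rw [← Real.rpow_neg_one]
    exact Real.rpow_le_rpow_of_exponent_le (one_le_bracket _) hs
  calc (1 : ℝ) = (bracket (p 0 - σ * p 1))⁻¹ * 1 * bracket (p 0 - σ * p 1) := by field_simp
    _ ≤ _ := by
        gcongr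
        exact Real.one_le_rpow (one_le_bracket _) hb

theorem exists_isFourierTransform_of_zSq {σ s b : ℝ} (hs : -1 ≤ s) (hb : 0 ≤ b)
    {G : SpaceTime → ℂ} (hG : Measurable G) (hfin : zSq σ s b (G ∘ freqChart σ) ≠ ⊤) :
    ∃ u : 𝓢'(SpaceTime, ℂ), IsFourierTransform u G := by
  set c : ℝ := 2 * Real.pi
  have hc : c ≠ 0 := by positivity
  set w : SpaceTime → ℂ := fun k => ((1 + ‖c • k‖ ^ 2 : ℝ) : ℂ)
  have hw : w.HasTemperateGrowth := by
    simp only [w, norm_smul, mul_pow]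
    fun_prop
  have hw₀ (k) : w k ≠ 0 := Complex.ofReal_ne_zero.2 (by positivity)
  set W : SpaceTime → ℝ := fun p => bracket (p 0 - σ * p 1) ^ s * bracket (p 0 + σ * p 1) ^ b
  have hW (p) : 0 < W p := mul_pos (bracket_rpow_pos _ s) (bracket_rpow_pos _ b)
  have memLp : MemLp (fun p => W p • G p) 2 := by
    refine ⟨by fun_prop, ?_⟩
    rw [eLpNorm_lt_top_iff_lintegral_rpow_enorm_lt_top two_ne_zero ENNReal.ofNat_ne_top,
      ENNReal.toReal_ofNat]
    rw [← lintegral_weight_eq_zSq σ s b hG] at hfin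
    convert hfin.lt_top using 3 with p
    rw [enorm_smul, Real.enorm_of_nonneg (hW p).le, ENNReal.rpow_two]
  have memLp_comp : MemLp (fun k => (2 + |σ|) • W (c • k) • G (c • k)) 2 := by
    refine MemLp.const_smul (f := fun k => W (c • k) • G (c • k)) ?_ (2 + |σ|)
    refine MemLp.comp_of_map (f := fun k => c • k) (g := fun p => W p • G p) ?_ (by fun_prop)
    rw [Measure.map_addHaar_smul volume hc]
    exact memLp.smul_measure ENNReal.ofReal_ne_top
  refine exists_isFourierTransform hG hw hw₀ (memLp_comp.mono ?_ (.of_forall fun k => ?_))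
  · fun_prop
  · have := one_le_weight_mul hs hb σ (c • k)
    have norm_w : ‖w k‖ = 1 + ‖c • k‖ ^ 2 := Complex.norm_of_nonneg (by positivity)
    calc ‖(w k)⁻¹ * G (c • k)‖ = (1 + ‖c • k‖ ^ 2)⁻¹ * ‖G (c • k)‖ := by
          rw [norm_mul, norm_inv, norm_w]
      _ ≤ (2 + |σ|) * W (c • k) * ‖G (c • k)‖ := by
          gcongr
          rw [inv_le_iff_one_le_mul₀ (by positivity)]
          linarith
      _ = ‖(2 + |σ|) • W (c • k) • G (c • k)‖ := by
          rw [norm_smul, norm_smul, Real.norm_of_nonneg (by positivity),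
            Real.norm_of_nonneg (hW _).le, mul_assoc]

theorem measurable_lintegral_fiber (r : ℝ) {h : ℝ × ℝ → ℂ} (hh : Measurable h) :
    Measurable fun ξ : ℝ => ∫⁻ θ, ENNReal.ofReal (bracket θ ^ r) * ‖h (θ, ξ)‖ₑ :=
  Measurable.lintegral_prod_left' (μ := volume)
    (f := fun z : ℝ × ℝ => ENNReal.ofReal (bracket z.1 ^ r) * ‖h z‖ₑ) (by fun_prop)

theorem exists_duhamel_zSq_le {s b δ : ℝ} (hs : -1 / 2 < s) (hs₀ : s ≤ 0) (hb₀ : 0 ≤ b)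
    (hb₁ : b ≤ 1) (hδ : 0 ≤ δ) (hbδ : b + δ < 3 / 2) (K : 𝓢(ℝ, ℂ)) :
    ∃ C : ℝ≥0, ∀ σ : ℝ, 1 / 2 ≤ |σ| → ∀ T : ℝ, 0 < T → T ≤ 1 →
      ∀ (a : ℝ → ℂ) (h : ℝ × ℝ → ℂ), Measurable a → Measurable h →
      zSq σ s b (fun z => duhamel K T (a z.2) (fun θ => h (θ, z.2)) z.1) ≤
        C * ((∫⁻ ξ, (ENNReal.ofReal (bracket ξ ^ s) * ‖a ξ‖ₑ) ^ 2) +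
          ENNReal.ofReal (T ^ δ) ^ 2 * (ySq s (-1 + δ) h + zSq σ s (b - 1 + δ) h)) := by
  obtain ⟨C, hC⟩ := exists_fiberSq_duhamel_le hs hs₀ hb₀ hb₁ hδ hbδ K
  refine ⟨C, fun σ hσ T hT hT1 a h ha hh => ?_⟩
  have bracket_le (ξ : ℝ) : bracket (2 * σ * ξ) ^ s ≤ bracket ξ ^ s := by
    refine Real.rpow_le_rpow_of_nonpos (bracket_pos ξ) (bracket_le_bracket ?_) hs₀
    rw [abs_mul, abs_mul, abs_two]
    exact le_mul_of_one_le_left (abs_nonneg ξ) (by linarith)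
  set X : ℝ → ℝ≥0∞ := fun ξ => (ENNReal.ofReal (bracket ξ ^ s) * ‖a ξ‖ₑ) ^ 2
  set Y : ℝ → ℝ≥0∞ := fun ξ => (ENNReal.ofReal (bracket ξ ^ s) *
    ∫⁻ θ, ENNReal.ofReal (bracket θ ^ (-1 + δ)) * ‖h (θ, ξ)‖ₑ) ^ 2
  set Z : ℝ → ℝ≥0∞ := fun ξ => fiberSq s (b - 1 + δ) (2 * σ * ξ) fun θ => h (θ, ξ)
  have measurable_X : Measurable X := by fun_prop
  have measurable_Y : Measurable Y := by
    have := measurable_lintegral_fiber (-1 + δ) hh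
    fun_prop
  have measurable_Z : Measurable Z := by
    refine Measurable.lintegral_prod_right' (f := fun y : ℝ × ℝ =>
      (weight s (b - 1 + δ) (2 * σ * y.1) y.2 * ‖h (y.2, y.1)‖ₑ) ^ 2) ?_
    unfold weight
    fun_prop
  calc _ ≤ ∫⁻ ξ, C * (X ξ + ENNReal.ofReal (T ^ δ) ^ 2 * (Y ξ + Z ξ)) := by
        refine lintegral_mono fun ξ => (hC T hT hT1 _ (a ξ) (fun θ => h (θ, ξ))
          (by fun_prop)).trans ?_
        have := ENNReal.ofReal_le_ofReal (bracket_le ξ)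
        simp only [X, Y, Z]
        gcongr
    _ = _ := by
        rw [lintegral_const_mul _ (by fun_prop), lintegral_add_left measurable_X,
          lintegral_const_mul _ (by fun_prop), lintegral_add_left measurable_Y]
        rfl

/-! ### Products, averages and dilations of Schwartz functions -/

section SchwartzFunctions

open scoped ContDiff

theorem norm_iteratedFDeriv_comp_continuousLinearMap_le {E F : Type*} [NormedAddCommGroup E]
    [NormedSpace ℝ E] [NormedAddCommGroup F] [NormedSpace ℝ F] {f : ℝ → F} (hf : ContDiff ℝ ∞ f)
    (L : E →L[ℝ] ℝ) (n : ℕ) (x : E) :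
    ‖iteratedFDeriv ℝ n (fun y => f (L y)) x‖ ≤ ‖L‖ ^ n * ‖iteratedFDeriv ℝ n f (L x)‖ := by
  have comp_right := L.iteratedFDeriv_comp_right hf x (i := n) (mod_cast le_top)
  rw [Function.comp_def] at comp_right
  rw [comp_right]
  refine (ContinuousMultilinearMap.norm_compContinuousLinearMap_le _ _).trans_eq ?_
  rw [Finset.prod_const, Finset.card_univ, Fintype.card_fin, mul_comm]

theorem norm_pow_mul_norm_iteratedFDeriv_mul_comp_le {E : Type*} [NormedAddCommGroup E]
    [NormedSpace ℝ E] {P Q : E →L[ℝ] ℝ} {C : ℝ} (hC : 0 ≤ C)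
    (hPQ : ∀ p, ‖p‖ ≤ C * ((1 + ‖P p‖) * (1 + ‖Q p‖))) (k n : ℕ) (η χ : 𝓢(ℝ, ℂ)) (p : E) :
    ‖p‖ ^ k * ‖iteratedFDeriv ℝ n (fun y => η (P y) * χ (Q y)) p‖ ≤
      (∑ i ∈ Finset.range (n + 1), C ^ k * (n.choose i *
        (‖P‖ ^ i * (2 ^ k * (Finset.Iic (k, n)).sup (schwartzSeminormFamily ℂ ℝ ℂ) η)) *
        (‖Q‖ ^ (n - i) * 2 ^ k))) *
        (Finset.Iic (k, n)).sup (schwartzSeminormFamily ℂ ℝ ℂ) χ := by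
  have leibniz := norm_iteratedFDeriv_mul_le ((η.smooth ⊤).comp P.contDiff)
    ((χ.smooth ⊤).comp Q.contDiff) p (n := n) (mod_cast le_top)
  refine (mul_le_mul_of_nonneg_left leibniz (by positivity)).trans ?_
  rw [Finset.mul_sum, Finset.sum_mul]
  refine Finset.sum_le_sum fun i hi => ?_
  have seminorm_le (m : ℕ) (hm : m ≤ n) (φ : 𝓢(ℝ, ℂ)) (x : ℝ) :
      (1 + ‖x‖) ^ k * ‖iteratedFDeriv ℝ m φ x‖ ≤
        2 ^ k * (Finset.Iic (k, n)).sup (schwartzSeminormFamily ℂ ℝ ℂ) φ :=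
    SchwartzMap.one_add_le_sup_seminorm_apply (m := (k, n)) le_rfl hm φ x
  have hin : i ≤ n := Nat.lt_succ_iff.1 (Finset.mem_range.1 hi)
  have norm_pow_le : ‖p‖ ^ k ≤ C ^ k * ((1 + ‖P p‖) ^ k * (1 + ‖Q p‖) ^ k) := by
    rw [← mul_pow, ← mul_pow]
    gcongr
    exact hPQ p
  calc ‖p‖ ^ k * (n.choose i * ‖iteratedFDeriv ℝ i (fun y => η (P y)) p‖ *
        ‖iteratedFDeriv ℝ (n - i) (fun y => χ (Q y)) p‖)
      ≤ (C ^ k * ((1 + ‖P p‖) ^ k * (1 + ‖Q p‖) ^ k)) * (n.choose i *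
        (‖P‖ ^ i * ‖iteratedFDeriv ℝ i η (P p)‖) *
        (‖Q‖ ^ (n - i) * ‖iteratedFDeriv ℝ (n - i) χ (Q p)‖)) := by
        gcongr
        · exact norm_iteratedFDeriv_comp_continuousLinearMap_le (η.smooth ⊤) P i p
        · exact norm_iteratedFDeriv_comp_continuousLinearMap_le (χ.smooth ⊤) Q (n - i) p
    _ = C ^ k * (n.choose i *
        (‖P‖ ^ i * ((1 + ‖P p‖) ^ k * ‖iteratedFDeriv ℝ i η (P p)‖)) *
        (‖Q‖ ^ (n - i) * ((1 + ‖Q p‖) ^ k * ‖iteratedFDeriv ℝ (n - i) χ (Q p)‖))) := by ring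
    _ ≤ C ^ k * (n.choose i *
        (‖P‖ ^ i * (2 ^ k * (Finset.Iic (k, n)).sup (schwartzSeminormFamily ℂ ℝ ℂ) η)) *
        (‖Q‖ ^ (n - i) *
          (2 ^ k * (Finset.Iic (k, n)).sup (schwartzSeminormFamily ℂ ℝ ℂ) χ))) := by
        gcongr C ^ k * (n.choose i * (‖P‖ ^ i * ?_) * (‖Q‖ ^ (n - i) * ?_))
        · exact seminorm_le i hin η (P p)
        · exact seminorm_le (n - i) (Nat.sub_le n i) χ (Q p)
    _ = _ := by ring

/-- The functional `(t, x) ↦ x - σ t`, which is constant along the characteristics. -/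
noncomputable def transverse (σ : ℝ) : SpaceTime →L[ℝ] ℝ :=
  EuclideanSpace.proj (1 : Fin 2) - σ • EuclideanSpace.proj (0 : Fin 2)

@[simp] theorem transverse_apply (σ : ℝ) (p : SpaceTime) : transverse σ p = p 1 - σ * p 0 := rfl

theorem norm_spaceTime_le (p : SpaceTime) : ‖p‖ ≤ |p 0| + |p 1| := by
  rw [EuclideanSpace.norm_eq, Fin.sum_univ_two, Real.norm_eq_abs, Real.norm_eq_abs]
  refine Real.sqrt_le_iff.2 ⟨by positivity, ?_⟩
  nlinarith [abs_nonneg (p 0), abs_nonneg (p 1)]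

theorem norm_le_of_transverse (σ : ℝ) (p : SpaceTime) :
    ‖p‖ ≤ (1 + |σ|) * ((1 + |p 0|) * (1 + |transverse σ p|)) := by
  have snd_le : |p 1| ≤ |transverse σ p| + |σ| * |p 0| := by
    rw [transverse_apply, ← abs_mul]
    linarith [abs_sub_abs_le_abs_sub (p 1) (σ * p 0)]
  have hx := abs_nonneg (transverse σ p)
  have hσ := abs_nonneg σ
  have ht := abs_nonneg (p 0)
  nlinarith [norm_spaceTime_le p, mul_nonneg ht hx, mul_nonneg hσ hx,
    mul_nonneg hσ (mul_nonneg ht hx)]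

/-- The Schwartz function `(t, x) ↦ η(t) χ(x - σ t)`. -/
noncomputable def shearTensor (σ : ℝ) (η : 𝓢(ℝ, ℂ)) : 𝓢(ℝ, ℂ) →L[ℂ] 𝓢(SpaceTime, ℂ) :=
  SchwartzMap.mkCLM (fun χ p => η (p 0) * χ (transverse σ p))
    (fun _ _ _ => mul_add _ _ _) (fun _ _ _ => mul_left_comm _ _ _)
    (fun χ => ((η.smooth ⊤).comp (EuclideanSpace.proj (𝕜 := ℝ) (0 : Fin 2)).contDiff).mul
      ((χ.smooth ⊤).comp (transverse σ).contDiff))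
    (fun m => ⟨Finset.Iic m, _, by positivity, fun χ p =>
      norm_pow_mul_norm_iteratedFDeriv_mul_comp_le (P := EuclideanSpace.proj (0 : Fin 2))
        (by positivity) (norm_le_of_transverse σ) m.1 m.2 η χ p⟩)

@[simp]
theorem shearTensor_apply (σ : ℝ) (η χ : 𝓢(ℝ, ℂ)) (p : SpaceTime) :
    shearTensor σ η χ p = η (p 0) * χ (p 1 - σ * p 0) := rfl

theorem tsupport_shearTensor_subset {T : ℝ} (σ : ℝ) {η : 𝓢(ℝ, ℂ)} (hη : tsupport η ⊆ Ioo (-T) T)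
    (χ : 𝓢(ℝ, ℂ)) : tsupport (shearTensor σ η χ) ⊆ strip T := by
  have closed : IsClosed ((fun p : SpaceTime => p 0) ⁻¹' tsupport η) :=
    (isClosed_tsupport η).preimage (by fun_prop)
  have subset : tsupport (shearTensor σ η χ) ⊆ (fun p : SpaceTime => p 0) ⁻¹' tsupport η :=
    closure_minimal (fun p hp => subset_tsupport η (left_ne_zero_of_mul hp)) closed
  exact subset.trans fun p hp => hη hp

theorem hasTemperateGrowth_fourier {a : ℝ → ℂ} (ha : AEStronglyMeasurable a)
    (h : ∀ n : ℕ, Integrable fun x => ‖x‖ ^ n * ‖a x‖) : (𝓕 a).HasTemperateGrowth := by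
  refine ⟨Real.contDiff_fourier fun n _ => h n, fun n =>
    ⟨0, ∫ v, ‖VectorFourier.fourierPowSMulRight (innerSL ℝ) a v n‖, fun x => ?_⟩⟩
  rw [Real.iteratedFDeriv_fourier (N := ⊤) (fun n _ => h n) ha (by exact le_top), pow_zero,
    mul_one]
  exact VectorFourier.norm_fourierIntegral_le_integral_norm _ _ _ _ _

theorem hasTemperateGrowth_comp_mul_left (g : 𝓢(ℝ, ℂ)) (δ : ℝ) :
    (fun k : ℝ => g (δ * k)).HasTemperateGrowth :=
  g.hasTemperateGrowth.comp (δ • ContinuousLinearMap.id ℝ ℝ).hasTemperateGrowth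

theorem exists_norm_iteratedFDeriv_dilation_sub_one_le {g : 𝓢(ℝ, ℂ)} (hg : g 0 = 1) (i : ℕ) :
    ∃ A : ℝ≥0, ∀ δ : ℝ, |δ| ≤ 1 → ∀ x : ℝ,
      ‖iteratedFDeriv ℝ i (fun k => g (δ * k) - 1) x‖ ≤ A * |δ| * (1 + ‖x‖) := by
  rcases i with _ | i
  · refine ⟨(SchwartzMap.seminorm ℝ 0 1 g).toNNReal, fun δ _ x => ?_⟩
    rw [Real.coe_toNNReal _ (apply_nonneg _ _), norm_iteratedFDeriv_zero]
    calc ‖g (δ * x) - 1‖ ≤ SchwartzMap.seminorm ℝ 0 1 g * ‖δ * x - 0‖ := by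
          rw [← hg]
          refine Convex.norm_image_sub_le_of_norm_deriv_le (fun z _ => g.differentiableAt)
            (fun z _ => ?_) convex_univ trivial trivial
          simpa only [pow_zero, one_mul, iteratedDeriv_one] using SchwartzMap.le_seminorm' ℝ 0 1 g z
      _ = SchwartzMap.seminorm ℝ 0 1 g * |δ| * ‖x‖ := by
          rw [sub_zero, norm_mul, Real.norm_eq_abs, mul_assoc]
      _ ≤ SchwartzMap.seminorm ℝ 0 1 g * |δ| * (1 + ‖x‖) := by
          gcongr
          exact le_add_of_nonneg_left zero_le_one
  · refine ⟨(SchwartzMap.seminorm ℝ 0 (i + 1) g).toNNReal, fun δ hδ x => ?_⟩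
    have deriv_eq : deriv (fun k => g (δ * k) - 1) = deriv fun k => g (δ * k) :=
      funext fun k => deriv_sub_const _
    have iteratedDeriv_eq : iteratedDeriv (i + 1) (fun k => g (δ * k) - 1) x =
        δ ^ (i + 1) • iteratedDeriv (i + 1) g (δ * x) := by
      rw [iteratedDeriv_succ', deriv_eq, ← iteratedDeriv_succ',
        iteratedDeriv_comp_const_smul (g.smooth (i + 1 : ℕ))]
    have seminorm_le := SchwartzMap.le_seminorm' ℝ 0 (i + 1) g (δ * x)
    rw [pow_zero, one_mul] at seminorm_le
    rw [Real.coe_toNNReal _ (apply_nonneg _ _), norm_iteratedFDeriv_eq_norm_iteratedDeriv,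
      iteratedDeriv_eq, norm_smul, norm_pow, Real.norm_eq_abs]
    calc |δ| ^ (i + 1) * ‖iteratedDeriv (i + 1) g (δ * x)‖
        ≤ |δ| * SchwartzMap.seminorm ℝ 0 (i + 1) g := by
          gcongr
          exact pow_le_of_le_one (abs_nonneg δ) hδ i.succ_ne_zero
      _ ≤ SchwartzMap.seminorm ℝ 0 (i + 1) g * |δ| * (1 + ‖x‖) := by
          rw [mul_comm]
          exact le_mul_of_one_le_right (by positivity) (le_add_of_nonneg_right (norm_nonneg x))

theorem exists_seminorm_smulLeftCLM_dilation_sub_le {g : 𝓢(ℝ, ℂ)} (hg : g 0 = 1) (φ : 𝓢(ℝ, ℂ))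
    (k n : ℕ) : ∃ B : ℝ≥0, ∀ δ : ℝ, |δ| ≤ 1 →
      SchwartzMap.seminorm ℂ k n (SchwartzMap.smulLeftCLM ℂ (fun x => g (δ * x)) φ - φ) ≤
        B * |δ| := by
  choose A hA using exists_norm_iteratedFDeriv_dilation_sub_one_le hg
  let S : ℝ := 2 ^ (k + 1) * (Finset.Iic (k + 1, n)).sup (schwartzSeminormFamily ℂ ℝ ℂ) φ
  refine ⟨∑ i ∈ Finset.range (n + 1), n.choose i * A i * S.toNNReal, fun δ hδ =>
    SchwartzMap.seminorm_le_bound ℂ k n _ (by positivity) fun x => ?_⟩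
  have coe_eq : (⇑(SchwartzMap.smulLeftCLM ℂ (fun k => g (δ * k)) φ - φ) : ℝ → ℂ) =
      fun x => (g (δ * x) - 1) * φ x := by
    ext x
    rw [sub_apply, SchwartzMap.smulLeftCLM_apply_apply
      (hasTemperateGrowth_comp_mul_left g δ), smul_eq_mul, sub_mul, one_mul]
  have smooth : ContDiff ℝ ∞ fun x : ℝ => g (δ * x) - 1 :=
    ((g.smooth ⊤).comp (contDiff_const.mul contDiff_id)).sub contDiff_const
  have leibniz := norm_iteratedFDeriv_mul_le smooth (φ.smooth ⊤) x (n := n) (mod_cast le_top)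
  rw [coe_eq]
  refine (mul_le_mul_of_nonneg_left leibniz (by positivity)).trans ?_
  rw [Finset.mul_sum, NNReal.coe_sum, Finset.sum_mul]
  refine Finset.sum_le_sum fun i _ => ?_
  calc ‖x‖ ^ k * (n.choose i * ‖iteratedFDeriv ℝ i (fun x => g (δ * x) - 1) x‖ *
        ‖iteratedFDeriv ℝ (n - i) φ x‖)
      ≤ (1 + ‖x‖) ^ k * (n.choose i * (A i * |δ| * (1 + ‖x‖)) *
        ‖iteratedFDeriv ℝ (n - i) φ x‖) := by
        gcongr
        · exact le_add_of_nonneg_left zero_le_one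
        · exact hA i δ hδ x
    _ = n.choose i * A i * ((1 + ‖x‖) ^ (k + 1) * ‖iteratedFDeriv ℝ (n - i) φ x‖) * |δ| := by
        ring
    _ ≤ n.choose i * A i * S * |δ| := by
        gcongr
        exact SchwartzMap.one_add_le_sup_seminorm_apply (m := (k + 1, n)) le_rfl
          (Nat.sub_le n i) φ x
    _ = _ := by
        push_cast
        rw [Real.coe_toNNReal _ (by positivity)]

theorem tendsto_smulLeftCLM_dilation {g : 𝓢(ℝ, ℂ)} (hg : g 0 = 1) (φ : 𝓢(ℝ, ℂ)) :
    Filter.Tendsto (fun δ : ℝ => SchwartzMap.smulLeftCLM ℂ (fun k => g (δ * k)) φ)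
      (nhds 0) (nhds φ) := by
  rw [(schwartz_withSeminorms ℂ ℝ ℂ).tendsto_nhds]
  rintro ⟨k, n⟩ ε hε
  obtain ⟨B, hB⟩ := exists_seminorm_smulLeftCLM_dilation_sub_le hg φ k n
  have tendsto_abs : Filter.Tendsto (fun δ : ℝ => |δ|) (nhds 0) (nhds 0) := by
    simpa only [abs_zero] using (continuous_abs (G := ℝ)).tendsto 0
  have tendsto_bound : Filter.Tendsto (fun δ : ℝ => B * |δ|) (nhds 0) (nhds 0) := by
    simpa only [mul_zero] using tendsto_abs.const_mul (B : ℝ)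
  filter_upwards [tendsto_bound.eventually_lt_const hε,
    tendsto_abs.eventually_le_const zero_lt_one] with δ bound_lt hδ
  exact (hB δ hδ).trans_lt bound_lt

end SchwartzFunctions

theorem exists_schwartz_comp_mul_left (φ : 𝓢(ℝ, ℂ)) {c : ℝ} (hc : c ≠ 0) :
    ∃ κ : 𝓢(ℝ, ℂ), ∀ x, κ x = φ (c * x) :=
  ⟨SchwartzMap.compCLMOfContinuousLinearEquiv ℂ
    (ContinuousLinearEquiv.unitsEquivAut ℝ (Units.mk0 c hc)) φ, fun x => by simp [mul_comm]⟩

section Averages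

variable {E : Type*} [NormedAddCommGroup E] [InnerProductSpace ℝ E] [FiniteDimensional ℝ E]
  [MeasurableSpace E] [BorelSpace E]

theorem fourier_schwartz_apply (Φ : 𝓢(E, ℂ)) (k : E) :
    (𝓕 Φ) k = ∫ p, Complex.exp (↑(-2 * Real.pi * inner ℝ p k) * Complex.I) * Φ p := by
  rw [SchwartzMap.fourier_coe, Real.fourier_eq']
  rfl

theorem fourierInv_schwartz_apply (Φ : 𝓢(E, ℂ)) (k : E) :
    (𝓕⁻ Φ) k = ∫ p, Complex.exp (↑(2 * Real.pi * inner ℝ p k) * Complex.I) * Φ p := by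
  rw [SchwartzMap.fourierInv_coe, Real.fourierInv_eq']
  rfl

theorem integrable_norm_pow_mul_norm_indicator_Ioc (R : ℝ) (n : ℕ) :
    Integrable fun x => ‖x‖ ^ n * ‖(Ioc 0 R).indicator (1 : ℝ → ℂ) x‖ := by
  have eq_indicator : (fun x => ‖x‖ ^ n * ‖(Ioc 0 R).indicator (1 : ℝ → ℂ) x‖) =
      (Ioc 0 R).indicator fun x => ‖x‖ ^ n := by
    ext x
    by_cases hx : x ∈ Ioc 0 R <;> simp [hx]
  rw [eq_indicator, integrable_indicator_iff measurableSet_Ioc]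
  exact (Continuous.integrableOn_Icc (by fun_prop)).mono_set Ioc_subset_Icc_self

-- On the frequency side, averaging over translates multiplies by a function of temperate growth.
theorem exists_schwartz_average (Φ : 𝓢(E, ℂ)) (v : E) (R : ℝ) :
    ∃ A : 𝓢(E, ℂ), ∀ p, A p = ∫ r in Ioc 0 R, Φ (p - r • v) := by
  let a : ℝ → ℂ := (Ioc 0 R).indicator 1
  have integrable_a : Integrable a :=
    (integrable_indicator_iff measurableSet_Ioc).2 (integrableOn_const (by simp))
  have temperate : (fun k : E => 𝓕 a (inner ℝ k v)).HasTemperateGrowth :=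
    (hasTemperateGrowth_fourier integrable_a.aestronglyMeasurable
      (integrable_norm_pow_mul_norm_indicator_Ioc R)).comp
      (Function.hasTemperateGrowth_inner_left v)
  have integrand_eq (p k : E) : Complex.exp (↑(2 * Real.pi * inner ℝ k p) * Complex.I) *
      SchwartzMap.smulLeftCLM ℂ (fun k => 𝓕 a (inner ℝ k v)) (𝓕 Φ) k =
      ∫ r, Complex.exp (↑(2 * Real.pi * inner ℝ k (p - r • v)) * Complex.I) * (a r * (𝓕 Φ) k) := by
    rw [SchwartzMap.smulLeftCLM_apply_apply temperate, Real.fourier_eq', smul_eq_mul,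
      ← integral_mul_const, ← integral_const_mul]
    refine integral_congr_ae (.of_forall fun r => ?_)
    simp only [smul_eq_mul, inner_sub_right, inner_smul_right, RCLike.inner_apply, conj_trivial]
    rw [← mul_assoc, ← mul_assoc, ← mul_assoc (Complex.exp _) (a r), ← Complex.exp_add]
    congr 3
    push_cast
    ring
  refine ⟨𝓕⁻ (SchwartzMap.smulLeftCLM ℂ (fun k => 𝓕 a (inner ℝ k v)) (𝓕 Φ)), fun p => ?_⟩
  have integrable_prod : Integrable (fun z : E × ℝ =>
      Complex.exp (↑(2 * Real.pi * inner ℝ z.1 (p - z.2 • v)) * Complex.I) *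
        (a z.2 * (𝓕 Φ) z.1)) ((volume : Measure E).prod volume) := by
    have := ((𝓕 Φ).integrable (μ := volume)).mul_prod integrable_a
    simp only [mul_comm _ (a _)] at this
    refine this.bdd_mul (c := 1) (Continuous.aestronglyMeasurable (by fun_prop))
      (.of_forall fun z => ?_)
    rw [Complex.norm_exp_ofReal_mul_I]
  rw [fourierInv_schwartz_apply, ← integral_indicator measurableSet_Ioc]
  simp_rw [integrand_eq]
  rw [integral_integral_swap integrable_prod]
  refine integral_congr_ae (.of_forall fun r => ?_)
  by_cases hr : r ∈ Ioc 0 R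
  · simp only [a, indicator_of_mem hr, Pi.one_apply, one_mul]
    rw [← fourierInv_schwartz_apply, FourierTransform.fourierInv_fourier_eq]
  · simp only [a, indicator_of_notMem hr, zero_mul, mul_zero, integral_zero]

theorem exists_cutoff {T : ℝ} (hT : 0 < T) :
    ∃ ρ : 𝓢(ℝ, ℂ), (∀ t, |t| ≤ T → ρ t = 1) ∧ ∀ t, 2 * T ≤ |t| → ρ t = 0 := by
  let φ : ContDiffBump (0 : ℝ) := ⟨T, 2 * T, hT, by linarith⟩
  obtain ⟨ρ, hρ⟩ := exists_schwartzMap_eq_ofReal φ.contDiff φ.hasCompactSupport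
  refine ⟨ρ, fun t ht => ?_, fun t ht => ?_⟩
  · rw [hρ, φ.one_of_mem_closedBall (by simpa [φ] using ht), Complex.ofReal_one]
  · rw [hρ, φ.zero_of_le_dist (by simpa [φ] using ht), Complex.ofReal_zero]

end Averages

/-! ### Integration along the characteristics -/

theorem inner_spaceTime (p q : SpaceTime) : inner ℝ p q = p 0 * q 0 + p 1 * q 1 := by
  simp only [PiLp.inner_apply, Fin.sum_univ_two, RCLike.inner_apply, conj_trivial, mul_comm]

/-- The coordinates `t` and `x - σ t` on space-time. -/
def spaceChart (σ : ℝ) (z : ℝ × ℝ) : SpaceTime := !₂[z.1, z.2 + σ * z.1]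

@[simp] theorem spaceChart_zero (σ : ℝ) (z : ℝ × ℝ) : spaceChart σ z 0 = z.1 := rfl

@[simp] theorem spaceChart_one (σ : ℝ) (z : ℝ × ℝ) : spaceChart σ z 1 = z.2 + σ * z.1 := rfl

@[fun_prop]
theorem continuous_spaceChart (σ : ℝ) : Continuous (spaceChart σ) := by
  unfold spaceChart
  fun_prop

theorem measurePreserving_spaceChart (σ : ℝ) : MeasurePreserving (spaceChart σ) := by
  have shear : MeasurePreserving (fun z : ℝ × ℝ => (z.1, z.2 + σ * z.1)) :=
    (MeasurePreserving.id volume).skew_product (g := fun t x => x + σ * t) (by fun_prop)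
      (.of_forall fun t => (measurePreserving_add_right volume (σ * t)).map_eq)
  exact measurePreserving_pair.comp shear

theorem measurableEmbedding_spaceChart (σ : ℝ) : MeasurableEmbedding (spaceChart σ) := by
  refine (continuous_spaceChart σ).measurableEmbedding fun z w h => ?_
  have h₀ : z.1 = w.1 := congr($h 0)
  have h₁ := congr($h 1)
  simp only [spaceChart_one, h₀, add_left_inj] at h₁
  exact Prod.ext h₀ h₁

theorem integrable_comp_spaceChart (σ : ℝ) {F : SpaceTime → ℂ} (hF : Integrable F) :
    Integrable fun z => F (spaceChart σ z) :=
  ((measurePreserving_spaceChart σ).integrable_comp_emb (measurableEmbedding_spaceChart σ)).2 hF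

theorem integral_comp_spaceChart (σ : ℝ) (F : SpaceTime → ℂ) :
    ∫ z, F (spaceChart σ z) = ∫ p, F p :=
  (measurePreserving_spaceChart σ).integral_comp (measurableEmbedding_spaceChart σ) F

theorem exists_norm_le_inv_one_add_sq (Φ : 𝓢(SpaceTime, ℂ)) :
    ∃ C : ℝ, ∀ p, ‖Φ p‖ ≤ C * (1 + p 0 ^ 2)⁻¹ := by
  refine ⟨SchwartzMap.seminorm ℝ 0 0 Φ + SchwartzMap.seminorm ℝ 2 0 Φ, fun p => ?_⟩
  have sq_le : p 0 ^ 2 ≤ ‖p‖ ^ 2 := by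
    rw [← sq_abs]
    gcongr
    exact PiLp.norm_apply_le p 0
  rw [← div_eq_mul_inv, le_div_iff₀ (by positivity)]
  calc ‖Φ p‖ * (1 + p 0 ^ 2) ≤ ‖Φ p‖ * (1 + ‖p‖ ^ 2) := by gcongr
    _ = ‖Φ p‖ + ‖p‖ ^ 2 * ‖Φ p‖ := by ring
    _ ≤ _ := add_le_add (SchwartzMap.norm_le_seminorm ℝ Φ p)
        (SchwartzMap.norm_pow_mul_le_seminorm ℝ Φ 2 p)

/-- The parametrization of the line `τ + σ ξ = 0`, which is dual to the characteristics. -/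
noncomputable def characteristicLine (σ : ℝ) : ℝ →L[ℝ] SpaceTime :=
  ContinuousLinearMap.toSpanSingleton ℝ !₂[-σ, 1]

@[simp]
theorem characteristicLine_zero (σ k : ℝ) : characteristicLine σ k 0 = -(σ * k) := by
  simp [characteristicLine, mul_comm]

@[simp]
theorem characteristicLine_one (σ k : ℝ) : characteristicLine σ k 1 = k := by
  simp [characteristicLine]

/-- The restriction of a Schwartz function to the line `τ + σ ξ = 0`. -/
noncomputable def restrictLine (σ : ℝ) : 𝓢(SpaceTime, ℂ) →L[ℂ] 𝓢(ℝ, ℂ) :=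
  SchwartzMap.compCLM ℂ (characteristicLine σ).hasTemperateGrowth
    ⟨1, 1, fun k => by
      have norm_le : ‖characteristicLine σ k 1‖ ≤ ‖characteristicLine σ k‖ :=
        PiLp.norm_apply_le _ 1
      rw [characteristicLine_one] at norm_le
      linarith⟩

@[simp]
theorem restrictLine_apply (σ : ℝ) (Φ : 𝓢(SpaceTime, ℂ)) (k : ℝ) :
    restrictLine σ Φ k = Φ (characteristicLine σ k) := rfl

/-- The integrals of a Schwartz function along the characteristics, as a function of the
coordinate `x - σ t`. Defining it on the frequency side makes it a Schwartz function. -/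
noncomputable def lineIntegral (σ : ℝ) (Φ : 𝓢(SpaceTime, ℂ)) : 𝓢(ℝ, ℂ) :=
  𝓕⁻ (restrictLine σ (𝓕 Φ))

theorem continuous_integral_spaceChart (σ : ℝ) (Φ : 𝓢(SpaceTime, ℂ)) :
    Continuous fun y => ∫ t, Φ (spaceChart σ (t, y)) := by
  obtain ⟨C, hC⟩ := exists_norm_le_inv_one_add_sq Φ
  exact continuous_of_dominated (bound := fun t => C * (1 + t ^ 2)⁻¹)
    (fun y => Continuous.aestronglyMeasurable (by fun_prop))
    (fun y => .of_forall fun t => hC (spaceChart σ (t, y)))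
    (integrable_inv_one_add_sq.const_mul C) (.of_forall fun t => by fun_prop)

theorem fourier_integral_spaceChart (σ : ℝ) (Φ : 𝓢(SpaceTime, ℂ)) :
    𝓕 (fun y => ∫ t, Φ (spaceChart σ (t, y))) = restrictLine σ (𝓕 Φ) := by
  ext k
  have integrable : Integrable fun p : SpaceTime =>
      Complex.exp (↑(-2 * Real.pi * inner ℝ p (characteristicLine σ k)) * Complex.I) * Φ p := by
    refine Φ.integrable.bdd_mul (c := 1) (Continuous.aestronglyMeasurable (by fun_prop))
      (.of_forall fun p => ?_)
    rw [Complex.norm_exp_ofReal_mul_I]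
  rw [restrictLine_apply, fourier_schwartz_apply, Real.fourier_eq', ← integral_comp_spaceChart σ,
    Measure.volume_eq_prod, integral_prod_symm _ (integrable_comp_spaceChart σ integrable)]
  refine integral_congr_ae (.of_forall fun y => ?_)
  simp only [smul_eq_mul]
  rw [← integral_const_mul]
  refine integral_congr_ae (.of_forall fun t => ?_)
  simp only [inner_spaceTime, spaceChart_zero, spaceChart_one, characteristicLine_zero,
    characteristicLine_one, RCLike.inner_apply, conj_trivial]
  congr 4
  ring

theorem lineIntegral_apply (σ : ℝ) (Φ : 𝓢(SpaceTime, ℂ)) (y : ℝ) :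
    lineIntegral σ Φ y = ∫ t, Φ (spaceChart σ (t, y)) := by
  have integrable : Integrable fun y => ∫ t, Φ (spaceChart σ (t, y)) :=
    (integrable_comp_spaceChart σ Φ.integrable).integral_prod_right
  have inversion := (continuous_integral_spaceChart σ Φ).fourierInv_fourier_eq integrable
    (by rw [fourier_integral_spaceChart]; exact SchwartzMap.integrable _)
  rw [lineIntegral, SchwartzMap.fourierInv_coe, ← fourier_integral_spaceChart, inversion]

/-- The direction of the characteristics. -/
def direction (σ : ℝ) : SpaceTime := !₂[1, σ]

@[simp] theorem direction_zero (σ : ℝ) : direction σ 0 = 1 := rfl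

@[simp] theorem direction_one (σ : ℝ) : direction σ 1 = σ := rfl

theorem add_smul_direction_eq_spaceChart (σ : ℝ) (q : SpaceTime) (u : ℝ) :
    q + u • direction σ = spaceChart σ (u + q 0, q 1 - σ * q 0) := by
  ext i
  fin_cases i
  · simp [add_comm]
  · simp only [Fin.mk_one, PiLp.add_apply, PiLp.smul_apply, direction_one, smul_eq_mul,
      spaceChart_one]
    ring

theorem integral_along_direction (σ : ℝ) (Φ : 𝓢(SpaceTime, ℂ)) (q : SpaceTime) :
    ∫ u : ℝ, Φ (q + u • direction σ) = lineIntegral σ Φ (q 1 - σ * q 0) := by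
  simp_rw [lineIntegral_apply, add_smul_direction_eq_spaceChart]
  exact integral_add_right_eq_self (fun t => Φ (spaceChart σ (t, q 1 - σ * q 0))) (q 0)

theorem integral_shearTensor_along_direction (σ : ℝ) (η χ : 𝓢(ℝ, ℂ)) (q : SpaceTime) :
    ∫ u : ℝ, shearTensor σ η χ (q + u • direction σ) = (∫ t, η t) * χ (q 1 - σ * q 0) := by
  simp only [add_smul_direction_eq_spaceChart, shearTensor_apply, spaceChart_zero, spaceChart_one,
    add_sub_cancel_right]
  rw [integral_mul_const, integral_add_right_eq_self (fun t => η t) (q 0)]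

theorem abs_lt_of_ne_zero {T : ℝ} {Φ : SpaceTime → ℂ} (hΦ : tsupport Φ ⊆ strip T) {p : SpaceTime}
    (hp : Φ p ≠ 0) : |p 0| < T :=
  abs_lt.2 (hΦ (subset_tsupport Φ hp))

theorem integrable_along_direction {T : ℝ} {Φ : SpaceTime → ℂ} (hc : Continuous Φ)
    (hΦ : tsupport Φ ⊆ strip T) (σ : ℝ) (q : SpaceTime) :
    Integrable fun u : ℝ => Φ (q + u • direction σ) := by
  refine Continuous.integrable_of_hasCompactSupport (by fun_prop) ?_
  refine HasCompactSupport.intro (isCompact_Icc (a := -T - q 0) (b := T - q 0)) fun u hu => ?_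
  by_contra ne_zero
  have abs_lt_T := abs_lt_of_ne_zero hΦ ne_zero
  simp only [PiLp.add_apply, PiLp.smul_apply, direction_zero, smul_eq_mul, mul_one,
    abs_lt] at abs_lt_T
  exact hu ⟨by linarith, by linarith⟩

/-- The integral over the past half of the characteristic through a point. -/
noncomputable def pastIntegral (σ : ℝ) (Φ : SpaceTime → ℂ) (q : SpaceTime) : ℂ :=
  ∫ u in Iic (0 : ℝ), Φ (q + u • direction σ)

theorem pastIntegral_add_smul (σ : ℝ) (Φ : SpaceTime → ℂ) (q : SpaceTime) (t : ℝ) :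
    pastIntegral σ Φ (q + t • direction σ) = ∫ u in Iic t, Φ (q + u • direction σ) := by
  have shift := (measurePreserving_add_right (volume : Measure ℝ) t).setIntegral_preimage_emb
    (measurableEmbedding_addRight t) (fun u => Φ (q + u • direction σ)) (Iic t)
  rw [← shift, preimage_add_const_Iic, sub_self]
  refine integral_congr_ae (.of_forall fun u => congrArg Φ ?_)
  module

theorem hasDerivAt_pastIntegral {σ : ℝ} {Φ : SpaceTime → ℂ} (hc : Continuous Φ) {q : SpaceTime}
    (hΦ : Integrable fun u : ℝ => Φ (q + u • direction σ)) :
    HasDerivAt (fun t : ℝ => pastIntegral σ Φ (q + t • direction σ)) (Φ q) 0 := by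
  have eq_add (t : ℝ) : pastIntegral σ Φ (q + t • direction σ) =
      pastIntegral σ Φ q + ∫ u in (0 : ℝ)..t, Φ (q + u • direction σ) := by
    rw [pastIntegral_add_smul, pastIntegral,
      ← intervalIntegral.integral_Iic_sub_Iic hΦ.integrableOn hΦ.integrableOn, add_sub_cancel]
  have fundamental := intervalIntegral.integral_hasDerivAt_right (a := (0 : ℝ)) (b := 0)
    (f := fun u => Φ (q + u • direction σ)) hΦ.intervalIntegrable
    (Continuous.stronglyMeasurableAtFilter (by fun_prop) _ _)
    (Continuous.continuousAt (by fun_prop))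
  simp_rw [eq_add]
  simpa only [zero_smul, add_zero] using fundamental.const_add (pastIntegral σ Φ q)

theorem exists_nonpos_of_pastIntegral_ne_zero {σ : ℝ} {Φ : SpaceTime → ℂ} {q : SpaceTime}
    (hq : pastIntegral σ Φ q ≠ 0) : ∃ u ∈ Iic (0 : ℝ), Φ (q + u • direction σ) ≠ 0 :=
  exists_ne_zero_of_setIntegral_ne_zero hq

theorem exists_pos_of_pastIntegral_ne_zero {σ : ℝ} {Φ : SpaceTime → ℂ} {q : SpaceTime}
    (hΦ : Integrable fun u : ℝ => Φ (q + u • direction σ))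
    (h₀ : ∫ u : ℝ, Φ (q + u • direction σ) = 0) (hq : pastIntegral σ Φ q ≠ 0) :
    ∃ u ∈ Ioi (0 : ℝ), Φ (q + u • direction σ) ≠ 0 := by
  have add_eq := intervalIntegral.integral_Iic_add_Ioi (b := (0 : ℝ)) hΦ.integrableOn
    hΦ.integrableOn
  rw [h₀] at add_eq
  exact exists_ne_zero_of_setIntegral_ne_zero fun future_eq_zero => hq (by
    rwa [future_eq_zero, add_zero] at add_eq)

theorem abs_lt_of_pastIntegral_ne_zero {σ T : ℝ} {Φ : SpaceTime → ℂ} {q : SpaceTime}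
    (hsupp : tsupport Φ ⊆ strip T) (hΦ : Integrable fun u : ℝ => Φ (q + u • direction σ))
    (h₀ : ∫ u : ℝ, Φ (q + u • direction σ) = 0) (hq : pastIntegral σ Φ q ≠ 0) : |q 0| < T := by
  obtain ⟨u, hu, hΦu⟩ := exists_nonpos_of_pastIntegral_ne_zero hq
  obtain ⟨v, hv, hΦv⟩ := exists_pos_of_pastIntegral_ne_zero hΦ h₀ hq
  have past := abs_lt_of_ne_zero hsupp hΦu
  have future := abs_lt_of_ne_zero hsupp hΦv
  simp only [PiLp.add_apply, PiLp.smul_apply, direction_zero, smul_eq_mul, mul_one,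
    abs_lt] at past future
  exact abs_lt.2 ⟨by linarith [mem_Iic.1 hu], by linarith [mem_Ioi.1 hv]⟩

open scoped Pointwise in
theorem exists_add_smul_mem_of_mem_tsupport {E F : Type*} [NormedAddCommGroup E] [NormedSpace ℝ E]
    [Zero F] {S : Set E} (hS : IsClosed S) {Ψ : E → F} {v : E} {a b : ℝ}
    (h : ∀ q, Ψ q ≠ 0 → ∃ u ∈ Icc a b, q + u • v ∈ S) {q : E} (hq : q ∈ tsupport Ψ) :
    ∃ u ∈ Icc a b, q + u • v ∈ S := by
  have compact : IsCompact ((fun u : ℝ => -(u • v)) '' Icc a b) :=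
    isCompact_Icc.image (by fun_prop)
  have subset : tsupport Ψ ⊆ S + (fun u : ℝ => -(u • v)) '' Icc a b := by
    refine closure_minimal (fun p hp => ?_) (hS.add_right_of_isCompact compact)
    obtain ⟨u, hu, hup⟩ := h p hp
    exact ⟨_, hup, _, mem_image_of_mem _ hu, by simp⟩
  obtain ⟨p, hp, -, ⟨u, hu, rfl⟩, rfl⟩ := subset hq
  exact ⟨u, hu, by simpa using hp⟩

theorem tsupport_pastIntegral_subset {σ T : ℝ} {Φ : SpaceTime → ℂ} (hc : Continuous Φ)
    (hΦ : tsupport Φ ⊆ strip T) (h₀ : ∀ q, ∫ u : ℝ, Φ (q + u • direction σ) = 0) :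
    tsupport (pastIntegral σ Φ) ⊆ strip T := by
  have integrable := integrable_along_direction hc hΦ σ
  have abs_lt_T {q} (hq : pastIntegral σ Φ q ≠ 0) :=
    abs_lt.1 (abs_lt_of_pastIntegral_ne_zero hΦ (integrable q) (h₀ q) hq)
  have translate_lt {q : SpaceTime} {u : ℝ} (hq : Φ (q + u • direction σ) ≠ 0) :
      -T < q 0 + u ∧ q 0 + u < T := by
    simpa [abs_lt] using abs_lt_of_ne_zero hΦ hq
  intro q hq
  obtain ⟨u, hu, past⟩ := exists_add_smul_mem_of_mem_tsupport (isClosed_tsupport Φ)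
    (v := direction σ) (a := -(2 * T)) (b := 0) (fun p hp => by
      obtain ⟨u, hu, hΦu⟩ := exists_nonpos_of_pastIntegral_ne_zero hp
      have := abs_lt_T hp
      have := translate_lt hΦu
      exact ⟨u, ⟨by linarith, hu⟩, subset_tsupport Φ hΦu⟩) hq
  obtain ⟨v, hv, future⟩ := exists_add_smul_mem_of_mem_tsupport (isClosed_tsupport Φ)
    (v := direction σ) (a := 0) (b := 2 * T) (fun p hp => by
      obtain ⟨u, hu, hΦu⟩ := exists_pos_of_pastIntegral_ne_zero (integrable p) (h₀ p) hp
      have := abs_lt_T hp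
      have := translate_lt hΦu
      exact ⟨u, ⟨(mem_Ioi.1 hu).le, by linarith⟩, subset_tsupport Φ hΦu⟩) hq
  have past_mem : (q + u • direction σ) 0 ∈ Ioo (-T) T := hΦ past
  have future_mem : (q + v • direction σ) 0 ∈ Ioo (-T) T := hΦ future
  simp only [PiLp.add_apply, PiLp.smul_apply, direction_zero, smul_eq_mul, mul_one]
    at past_mem future_mem
  exact ⟨by linarith [past_mem.1, hu.2], by linarith [future_mem.2, hv.1]⟩

theorem exists_schwartz_eq_pastIntegral {σ T : ℝ} (hT : 0 < T) {Φ : 𝓢(SpaceTime, ℂ)}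
    (hΦ : tsupport Φ ⊆ strip T) (h₀ : ∀ q, ∫ u : ℝ, Φ (q + u • direction σ) = 0) :
    ∃ Ψ : 𝓢(SpaceTime, ℂ), ⇑Ψ = pastIntegral σ Φ := by
  obtain ⟨A, hA⟩ := exists_schwartz_average Φ (direction σ) (3 * T)
  obtain ⟨ρ, eq_one, eq_zero⟩ := exists_cutoff hT
  have average_eq {q : SpaceTime} (hq : q 0 ≤ 2 * T) : A q = pastIntegral σ Φ q := by
    have reflect := integral_comp_neg_Ioi (0 : ℝ) (fun u => Φ (q + u • direction σ))
    simp only [neg_smul, neg_zero, ← sub_eq_add_neg] at reflect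
    rw [hA, pastIntegral, ← reflect]
    refine (setIntegral_eq_of_subset_of_forall_sdiff_eq_zero measurableSet_Ioi
      Ioc_subset_Ioi_self fun r hr => ?_).symm
    by_contra ne_zero
    have abs_lt_T := abs_lt.1 (abs_lt_of_ne_zero hΦ ne_zero)
    simp only [PiLp.sub_apply, PiLp.smul_apply, direction_zero, smul_eq_mul, mul_one] at abs_lt_T
    exact hr.2 ⟨hr.1, by linarith⟩
  have temperate : (fun p : SpaceTime => ρ (p 0)).HasTemperateGrowth :=
    ρ.hasTemperateGrowth.comp (EuclideanSpace.proj (𝕜 := ℝ) (0 : Fin 2)).hasTemperateGrowth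
  refine ⟨SchwartzMap.smulLeftCLM ℂ (fun p : SpaceTime => ρ (p 0)) A, funext fun q => ?_⟩
  rw [SchwartzMap.smulLeftCLM_apply_apply temperate, smul_eq_mul]
  by_cases hq : pastIntegral σ Φ q = 0
  · rcases le_or_gt (q 0) (2 * T) with le | gt
    · rw [average_eq le, hq, mul_zero]
    · rw [eq_zero _ (gt.le.trans (le_abs_self _)), hq, zero_mul]
  · have abs_lt_T := abs_lt_of_pastIntegral_ne_zero hΦ
      (integrable_along_direction Φ.continuous hΦ σ q) (h₀ q) hq
    rw [eq_one _ abs_lt_T.le, one_mul, average_eq (by linarith [le_abs_self (q 0)])]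

theorem exists_antiderivative {σ T : ℝ} (hT : 0 < T) {Φ : 𝓢(SpaceTime, ℂ)}
    (hΦ : tsupport Φ ⊆ strip T) (h₀ : ∀ q, ∫ u : ℝ, Φ (q + u • direction σ) = 0) :
    ∃ Ψ : 𝓢(SpaceTime, ℂ), tsupport Ψ ⊆ strip T ∧ ∂_{direction σ} Ψ = Φ := by
  obtain ⟨Ψ, hΨ⟩ := exists_schwartz_eq_pastIntegral hT hΦ h₀
  refine ⟨Ψ, hΨ ▸ tsupport_pastIntegral_subset Φ.continuous hΦ h₀, ?_⟩
  ext p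
  rw [SchwartzMap.lineDerivOp_apply, lineDeriv, hΨ]
  exact (hasDerivAt_pastIntegral Φ.continuous
    (integrable_along_direction Φ.continuous hΦ σ p)).deriv

/-! ### Uniqueness for the transport equation -/

/-- The `L¹`-normalized dilation `t ↦ δ⁻¹ η(δ⁻¹ t)`, with value `0` for `δ = 0`. -/
noncomputable def dilation (η : 𝓢(ℝ, ℂ)) (δ : ℝ) : 𝓢(ℝ, ℂ) :=
  if h : δ = 0 then 0
  else (δ⁻¹ : ℂ) • SchwartzMap.compCLMOfContinuousLinearEquiv ℂ
    (ContinuousLinearEquiv.unitsEquivAut ℝ (Units.mk0 δ⁻¹ (inv_ne_zero h))) η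

theorem dilation_apply (η : 𝓢(ℝ, ℂ)) {δ : ℝ} (hδ : δ ≠ 0) (t : ℝ) :
    dilation η δ t = (δ⁻¹ : ℝ) • η (δ⁻¹ * t) := by
  simp [dilation, hδ, mul_comm]

theorem fourier_dilation (η : 𝓢(ℝ, ℂ)) {δ : ℝ} (hδ : 0 < δ) (k : ℝ) :
    (𝓕 (dilation η δ)) k = (𝓕 η) (δ * k) := by
  have change_variables := Measure.integral_comp_mul_left (fun t : ℝ =>
    Complex.exp (↑(-2 * Real.pi * inner ℝ t (δ * k)) * Complex.I) * η t) δ⁻¹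
  rw [inv_inv, abs_of_pos hδ, ← inv_smul_eq_iff₀ hδ.ne', ← integral_smul] at change_variables
  rw [fourier_schwartz_apply, fourier_schwartz_apply, ← change_variables]
  refine integral_congr_ae (.of_forall fun t => ?_)
  have inner_eq : inner ℝ (δ⁻¹ * t) (δ * k) = inner ℝ t k := by
    simp only [RCLike.inner_apply, conj_trivial]
    field_simp
  simp only [dilation_apply η hδ.ne', inner_eq, mul_smul_comm]

theorem integral_norm_dilation (η : 𝓢(ℝ, ℂ)) {δ : ℝ} (hδ : 0 < δ) :
    ∫ t, ‖dilation η δ t‖ = ∫ t, ‖η t‖ := by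
  simp only [dilation_apply η hδ.ne', norm_smul, norm_inv, Real.norm_of_nonneg hδ.le]
  rw [integral_const_mul, Measure.integral_comp_mul_left (fun t => ‖η t‖), inv_inv,
    abs_of_pos hδ, smul_eq_mul, inv_mul_cancel_left₀ hδ.ne']

theorem tsupport_dilation_subset {η : 𝓢(ℝ, ℂ)} (hη : ∀ t, 1 < |t| → η t = 0) {δ : ℝ}
    (hδ : 0 < δ) : tsupport (dilation η δ) ⊆ Icc (-δ) δ := by
  refine closure_minimal (fun t ht => abs_le.1 ?_) isClosed_Icc
  by_contra! lt
  rw [Function.mem_support, dilation_apply η hδ.ne', hη, smul_zero] at ht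
  · exact ht rfl
  · rwa [abs_mul, abs_of_pos (inv_pos.2 hδ), ← div_eq_inv_mul, one_lt_div hδ]

/-- An approximate identity `m` on `ℝ`, consisting of Schwartz functions whose Fourier transforms
are the dilates of a single profile `g`. -/
structure IsMollifier (g : 𝓢(ℝ, ℂ)) (m : ℝ → 𝓢(ℝ, ℂ)) : Prop where
  apply_zero : g 0 = 1
  fourier_apply {δ : ℝ} (hδ : 0 < δ) (k : ℝ) : (𝓕 (m δ)) k = g (δ * k)
  tsupport_subset {δ : ℝ} (hδ : 0 < δ) : tsupport (m δ) ⊆ Icc (-δ) δ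
  integral_norm_eq_one {δ : ℝ} (hδ : 0 < δ) : ∫ t, ‖m δ t‖ = 1

theorem fourier_apply_zero (η : 𝓢(ℝ, ℂ)) : (𝓕 η) 0 = ∫ t, η t := by
  simp [fourier_schwartz_apply]

theorem exists_isMollifier : ∃ g m, IsMollifier g m := by
  let φ : ContDiffBump (0 : ℝ) := ⟨1 / 2, 1, by norm_num, by norm_num⟩
  obtain ⟨η, hη⟩ := exists_schwartzMap_eq_ofReal (φ.contDiff_normed (μ := volume))
    φ.hasCompactSupport_normed
  have eq_zero (t : ℝ) (ht : 1 < |t|) : η t = 0 := by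
    have notMem : t ∉ Function.support (φ.normed volume) := by
      rw [φ.support_normed_eq]
      simpa [φ] using ht.le
    rw [hη, Function.notMem_support.1 notMem, Complex.ofReal_zero]
  refine ⟨𝓕 η, dilation η, ?_, fun hδ => fourier_dilation η hδ,
    fun hδ => tsupport_dilation_subset eq_zero hδ, fun hδ => ?_⟩
  · simp only [fourier_apply_zero, hη, integral_complex_ofReal, φ.integral_normed,
      Complex.ofReal_one]
  · simp only [integral_norm_dilation η hδ, hη, Complex.norm_real,
      Real.norm_of_nonneg (φ.nonneg_normed _), φ.integral_normed]

theorem IsMollifier.integral_eq_one {g : 𝓢(ℝ, ℂ)} {m : ℝ → 𝓢(ℝ, ℂ)} (hm : IsMollifier g m)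
    {δ : ℝ} (hδ : 0 < δ) : ∫ t, m δ t = 1 := by
  rw [← fourier_apply_zero, hm.fourier_apply hδ, mul_zero, hm.apply_zero]

theorem IsMollifier.tsupport_subset_Ioo {g : 𝓢(ℝ, ℂ)} {m : ℝ → 𝓢(ℝ, ℂ)} (hm : IsMollifier g m)
    {δ T : ℝ} (hδ : 0 < δ) (hδT : δ < T) : tsupport (m δ) ⊆ Ioo (-T) T :=
  (hm.tsupport_subset hδ).trans (Icc_subset_Ioo (neg_lt_neg hδT) hδT)

theorem fourier_tensor (η χ : 𝓢(ℝ, ℂ)) (k : SpaceTime) :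
    (𝓕 (shearTensor 0 η χ)) k = (𝓕 η) (k 0) * (𝓕 χ) (k 1) := by
  rw [fourier_schwartz_apply, fourier_schwartz_apply, fourier_schwartz_apply,
    ← integral_comp_spaceChart 0, ← integral_prod_mul]
  refine integral_congr_ae (.of_forall fun z => ?_)
  have exp_eq : Complex.exp (↑(-2 * Real.pi * (z.1 * k 0 + z.2 * k 1)) * Complex.I) =
      Complex.exp (↑(-2 * Real.pi * (k 0 * z.1)) * Complex.I) *
        Complex.exp (↑(-2 * Real.pi * (k 1 * z.2)) * Complex.I) := by
    rw [← Complex.exp_add]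
    congr 1
    push_cast
    ring
  simp only [inner_spaceTime, shearTensor_apply, spaceChart_zero, spaceChart_one,
    RCLike.inner_apply, conj_trivial, zero_mul, add_zero, sub_zero, exp_eq]
  ring

theorem fourierInv_tensor (η χ : 𝓢(ℝ, ℂ)) (k : SpaceTime) :
    (𝓕⁻ (shearTensor 0 η χ)) k = (𝓕⁻ η) (k 0) * (𝓕⁻ χ) (k 1) := by
  simp only [SchwartzMap.fourierInv_coe, Real.fourierInv_eq_fourier_neg]
  rw [← SchwartzMap.fourier_coe, fourier_tensor]
  rfl

theorem apply_eq_apply_shearTensor_lineIntegral {σ T : ℝ} (hT : 0 < T) {w : 𝓢'(SpaceTime, ℂ)}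
    (hw : ∀ Ψ : 𝓢(SpaceTime, ℂ), tsupport Ψ ⊆ strip T → w (∂_{direction σ} Ψ) = 0)
    {η : 𝓢(ℝ, ℂ)} (hη : tsupport η ⊆ Ioo (-T) T) (hη₁ : ∫ t, η t = 1) {Φ : 𝓢(SpaceTime, ℂ)}
    (hΦ : tsupport Φ ⊆ strip T) : w Φ = w (shearTensor σ η (lineIntegral σ Φ)) := by
  set Θ := shearTensor σ η (lineIntegral σ Φ)
  have hΘ : tsupport Θ ⊆ strip T := tsupport_shearTensor_subset σ hη _
  have integral_eq_zero (q : SpaceTime) : ∫ u : ℝ, (Φ - Θ) (q + u • direction σ) = 0 := by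
    simp only [sub_apply]
    rw [integral_sub (integrable_along_direction Φ.continuous hΦ σ q)
      (integrable_along_direction Θ.continuous hΘ σ q), integral_along_direction,
      integral_shearTensor_along_direction, hη₁, one_mul, sub_self]
  obtain ⟨Ψ, hΨ, deriv_eq⟩ := exists_antiderivative hT
    ((tsupport_sub _ _).trans (union_subset hΦ hΘ)) integral_eq_zero
  rw [← sub_eq_zero, ← map_sub, ← deriv_eq]
  exact hw Ψ hΨ

theorem lineIntegral_shearTensor_zero {g : 𝓢(ℝ, ℂ)} {m : ℝ → 𝓢(ℝ, ℂ)} (hm : IsMollifier g m)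
    {δ : ℝ} (hδ : 0 < δ) (σ : ℝ) (χ : 𝓢(ℝ, ℂ)) :
    lineIntegral σ (shearTensor 0 (m δ) χ) =
      𝓕⁻ (SchwartzMap.smulLeftCLM ℂ (fun k => g (δ * -σ * k)) (𝓕 χ)) := by
  rw [lineIntegral]
  congr 1
  ext k
  rw [SchwartzMap.smulLeftCLM_apply_apply (hasTemperateGrowth_comp_mul_left g _),
    restrictLine_apply, fourier_tensor, hm.fourier_apply hδ, characteristicLine_zero,
    characteristicLine_one, smul_eq_mul]
  ring_nf

theorem isVanishingOn_of_transport {σ T : ℝ} (hT : 0 < T) {w : 𝓢'(SpaceTime, ℂ)}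
    (hw : ∀ Ψ : 𝓢(SpaceTime, ℂ), tsupport Ψ ⊆ strip T → w (∂_{direction σ} Ψ) = 0)
    {g : 𝓢(ℝ, ℂ)} {m : ℝ → 𝓢(ℝ, ℂ)} (hm : IsMollifier g m)
    (h₀ : ∀ χ : 𝓢(ℝ, ℂ), Filter.Tendsto (fun δ => w (shearTensor 0 (m δ) χ))
      (nhdsWithin 0 (Ioi 0)) (nhds 0)) :
    Distribution.IsVanishingOn w (strip T) := by
  obtain ⟨δ₀, hδ₀, hδ₀T⟩ := exists_between hT
  set η := m δ₀
  have reduce {Φ : 𝓢(SpaceTime, ℂ)} (hΦ : tsupport Φ ⊆ strip T) :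
      w Φ = w (shearTensor σ η (lineIntegral σ Φ)) :=
    apply_eq_apply_shearTensor_lineIntegral hT hw (hm.tsupport_subset_Ioo hδ₀ hδ₀T)
      (hm.integral_eq_one hδ₀) hΦ
  have apply_eq_zero (χ : 𝓢(ℝ, ℂ)) : w (shearTensor σ η χ) = 0 := by
    have continuous : Continuous fun φ : 𝓢(ℝ, ℂ) => w (shearTensor σ η (𝓕⁻ φ)) :=
      (map_continuous w).comp ((shearTensor σ η).continuous.comp
        (FourierTransform.fourierInvCLM ℂ 𝓢(ℝ, ℂ)).continuous)
    have tendsto_zero : Filter.Tendsto (fun δ : ℝ => δ * -σ) (nhdsWithin 0 (Ioi 0)) (nhds 0) := by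
      refine Filter.Tendsto.mono_left ?_ nhdsWithin_le_nhds
      simpa only [zero_mul] using (continuous_mul_const (-σ)).tendsto 0
    have tendsto := (continuous.tendsto (𝓕 χ)).comp
      ((tendsto_smulLeftCLM_dilation hm.apply_zero (𝓕 χ)).comp tendsto_zero)
    rw [FourierTransform.fourierInv_fourier_eq] at tendsto
    refine tendsto_nhds_unique (tendsto.congr' ?_) (h₀ χ)
    filter_upwards [Ioo_mem_nhdsGT hT] with δ hδ
    rw [reduce (tsupport_shearTensor_subset 0 (hm.tsupport_subset_Ioo hδ.1 hδ.2) χ),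
      lineIntegral_shearTensor_zero hm hδ.1]
    rfl
  intro Φ hΦ
  rw [reduce hΦ, apply_eq_zero]

/-! ### Pairing the extension with test functions supported in the strip -/

/-- The inverse Fourier transform of a test function, without the normalizing constant and in the
coordinates `θ = τ + σ ξ` and `ξ`. -/
noncomputable def symbol (σ : ℝ) (Φ : 𝓢(SpaceTime, ℂ)) (z : ℝ × ℝ) : ℂ :=
  (𝓕⁻ Φ) ((2 * Real.pi)⁻¹ • freqChart σ z)

@[fun_prop]
theorem continuous_symbol (σ : ℝ) (Φ : 𝓢(SpaceTime, ℂ)) : Continuous (symbol σ Φ) :=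
  (𝓕⁻ Φ).continuous.comp ((continuous_freqChart σ).const_smul (2 * Real.pi)⁻¹)

theorem symbol_eq_integral (σ : ℝ) (Φ : 𝓢(SpaceTime, ℂ)) (z : ℝ × ℝ) :
    symbol σ Φ z =
      ∫ p : SpaceTime, Complex.exp (↑(p 0 * (z.1 - σ * z.2) + p 1 * z.2) * Complex.I) * Φ p := by
  rw [symbol, fourierInv_schwartz_apply]
  simp only [inner_smul_right, inner_spaceTime, freqChart_zero, freqChart_one,
    mul_inv_cancel_left₀ Real.two_pi_pos.ne']

theorem exists_norm_symbol_le (σ : ℝ) (Φ : 𝓢(SpaceTime, ℂ)) :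
    ∃ M : ℝ, 0 ≤ M ∧ ∀ z, ‖symbol σ Φ z‖ ≤ M * bracket z.1 ^ (-2 : ℝ) := by
  let c : ℝ := 2 * Real.pi * (1 + |σ|) + 1
  let N : ℝ := 2 ^ 2 * (Finset.Iic (2, 0)).sup (fun m => SchwartzMap.seminorm ℂ m.1 m.2) (𝓕⁻ Φ)
  refine ⟨N * c ^ 2, by positivity, fun z => ?_⟩
  obtain ⟨q, hq⟩ : ∃ q, (2 * Real.pi)⁻¹ • freqChart σ z = q := ⟨_, rfl⟩
  have decay : (1 + ‖q‖) ^ 2 * ‖(𝓕⁻ Φ) q‖ ≤ N := by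
    simpa only [norm_iteratedFDeriv_zero] using SchwartzMap.one_add_le_sup_seminorm_apply (𝕜 := ℂ)
      (m := (2, 0)) (k := 2) (n := 0) le_rfl le_rfl (𝓕⁻ Φ) q
  have fst_eq : z.1 = 2 * Real.pi * (q 0 + σ * q 1) := by
    simp only [← hq, PiLp.smul_apply, freqChart_zero, freqChart_one, smul_eq_mul]
    field_simp
    ring
  have bracket_le : bracket z.1 ≤ c * (1 + ‖q‖) := by
    have : |z.1| ≤ 2 * Real.pi * (1 + |σ|) * ‖q‖ := by
      have h₀ := PiLp.norm_apply_le q 0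
      have h₁ := PiLp.norm_apply_le q 1
      rw [Real.norm_eq_abs] at h₀ h₁
      calc |z.1| = 2 * Real.pi * |q 0 + σ * q 1| := by
            rw [fst_eq, abs_mul, abs_of_pos Real.two_pi_pos]
        _ ≤ 2 * Real.pi * (|q 0| + |σ| * |q 1|) := by
            rw [← abs_mul]
            gcongr
            exact abs_add_le _ _
        _ ≤ 2 * Real.pi * (‖q‖ + |σ| * ‖q‖) := by gcongr
        _ = 2 * Real.pi * (1 + |σ|) * ‖q‖ := by ring
    have : 0 ≤ 2 * Real.pi * (1 + |σ|) := by positivity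
    linarith [bracket_le_one_add_abs z.1, norm_nonneg q]
  have hb := bracket_pos z.1
  rw [symbol, hq, Real.rpow_neg hb.le, ← div_eq_mul_inv, le_div_iff₀ (by positivity),
    Real.rpow_ofNat]
  calc ‖(𝓕⁻ Φ) q‖ * bracket z.1 ^ 2 ≤ ‖(𝓕⁻ Φ) q‖ * (c * (1 + ‖q‖)) ^ 2 := by gcongr
    _ = ((1 + ‖q‖) ^ 2 * ‖(𝓕⁻ Φ) q‖) * c ^ 2 := by ring
    _ ≤ N * c ^ 2 := by gcongr

section Pairing

variable {E : Type*} [NormedAddCommGroup E] [InnerProductSpace ℝ E] [FiniteDimensional ℝ E]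
  [MeasurableSpace E] [BorelSpace E] {u : 𝓢'(E, ℂ)} {G : E → ℂ}

theorem IsFourierTransform.integrable_mul_fourierInv (h : IsFourierTransform u G) (φ : 𝓢(E, ℂ)) :
    Integrable fun p => G p * (𝓕⁻ φ) ((2 * Real.pi)⁻¹ • p) := by
  rw [← integrable_comp_smul_iff volume _ Real.two_pi_pos.ne']
  simpa only [inv_smul_smul₀ Real.two_pi_pos.ne'] using (h.2 (𝓕⁻ φ)).1

theorem IsFourierTransform.apply_eq_integral (h : IsFourierTransform u G) (φ : 𝓢(E, ℂ)) :
    u φ = ((2 * Real.pi : ℂ) ^ Module.finrank ℝ E)⁻¹ *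
      ∫ p, G p * (𝓕⁻ φ) ((2 * Real.pi)⁻¹ • p) := by
  have := Measure.integral_comp_smul (volume : Measure E)
    (fun p => G p * (𝓕⁻ φ) ((2 * Real.pi)⁻¹ • p)) (2 * Real.pi)
  simp only [inv_smul_smul₀ Real.two_pi_pos.ne'] at this
  rw [h.apply_eq, this, abs_of_pos (by positivity), Complex.real_smul]
  push_cast
  rfl

end Pairing

theorem IsFourierTransform.apply_eq_integral_symbol {u : 𝓢'(SpaceTime, ℂ)} {G : SpaceTime → ℂ}
    (h : IsFourierTransform u G) (σ : ℝ) (Φ : 𝓢(SpaceTime, ℂ)) :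
    u Φ = ((2 * Real.pi : ℂ) ^ 2)⁻¹ *
      ∫ ξ : ℝ, ∫ θ : ℝ, G (freqChart σ (θ, ξ)) * symbol σ Φ (θ, ξ) := by
  have integrable : Integrable fun z => G (freqChart σ z) * symbol σ Φ z :=
    ((measurePreserving_freqChart σ).integrable_comp_emb (measurableEmbedding_freqChart σ)).2
      (h.integrable_mul_fourierInv Φ)
  rw [h.apply_eq_integral, finrank_euclideanSpace_fin,
    ← (measurePreserving_freqChart σ).integral_comp (measurableEmbedding_freqChart σ)]
  congr 1
  exact integral_prod_symm _ integrable

/-- The kernels whose inverse Fourier transform, without the normalizing constant, is equal to `2 π`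
on `[-1, 1]`: multiplication by this inverse transform is a cutoff in time. -/
def IsCutoffKernel (K : 𝓢(ℝ, ℂ)) : Prop :=
  ∀ t : ℝ, |t| ≤ 1 → ∫ v : ℝ, Complex.exp (↑(t * v) * Complex.I) * K v = 2 * Real.pi

theorem exists_isCutoffKernel : ∃ K, IsCutoffKernel K := by
  obtain ⟨ρ, hρ, -⟩ := exists_cutoff one_pos
  obtain ⟨K, hK⟩ := exists_schwartz_comp_mul_left (𝓕 ρ) (inv_ne_zero Real.two_pi_pos.ne')
  refine ⟨K, fun t ht => ?_⟩
  have inversion :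
      ∫ k : ℝ, Complex.exp (↑(2 * Real.pi * inner ℝ k t) * Complex.I) * (𝓕 ρ) k = 1 := by
    rw [← fourierInv_schwartz_apply, FourierTransform.fourierInv_fourier_eq, hρ t ht]
  have rescale := Measure.integral_comp_mul_left (fun k : ℝ =>
    Complex.exp (↑(2 * Real.pi * inner ℝ k t) * Complex.I) * (𝓕 ρ) k) (2 * Real.pi)⁻¹
  rw [inversion, inv_inv, abs_of_pos Real.two_pi_pos, Complex.real_smul, mul_one] at rescale
  push_cast at rescale
  rw [← rescale]
  refine integral_congr_ae (.of_forall fun v => ?_)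
  simp only [hK, RCLike.inner_apply, conj_trivial]
  congr 3
  have : (Real.pi : ℂ) ≠ 0 := Complex.ofReal_ne_zero.2 Real.pi_ne_zero
  push_cast
  field_simp

theorem integrable_scaled_kernel (K : 𝓢(ℝ, ℂ)) {S : ℝ} (hS : S ≠ 0) (θ : ℝ) :
    Integrable fun ω : ℝ => (S : ℂ) * K (S * (ω - θ)) :=
  (((integrable_comp_mul_left_iff K hS).2 K.integrable).comp_sub_right θ).const_mul _

theorem IsCutoffKernel.integral_exp_mul {K : 𝓢(ℝ, ℂ)} (hK : IsCutoffKernel K) {S t : ℝ}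
    (hS : 0 < S) (ht : |t| ≤ S) (θ : ℝ) :
    ∫ ω : ℝ, Complex.exp (↑(t * ω) * Complex.I) * (S * K (S * (ω - θ))) =
      2 * Real.pi * Complex.exp (↑(t * θ) * Complex.I) := by
  have rescale := Measure.integral_comp_mul_left (fun v : ℝ =>
    Complex.exp (↑(S⁻¹ * t * v) * Complex.I) * K v) S
  rw [hK _ (by rwa [abs_mul, abs_of_pos (inv_pos.2 hS), inv_mul_le_one₀ hS]),
    abs_of_pos (inv_pos.2 hS), ← integral_sub_right_eq_self _ θ] at rescale
  calc _ = ∫ ω : ℝ, Complex.exp (↑(t * θ) * Complex.I) * S *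
        (Complex.exp (↑(S⁻¹ * t * (S * (ω - θ))) * Complex.I) * K (S * (ω - θ))) := by
        refine integral_congr_ae (.of_forall fun ω => ?_)
        have : t * ω = t * θ + S⁻¹ * t * (S * (ω - θ)) := by field_simp; ring
        simp only
        rw [this, Complex.ofReal_add, add_mul, Complex.exp_add]
        ring
    _ = _ := by
        have : (S : ℂ) ≠ 0 := Complex.ofReal_ne_zero.2 hS.ne'
        rw [integral_const_mul, rescale, Complex.real_smul]
        push_cast
        field_simp

/-- The restriction to a fixed spatial frequency of the symbol of a test function supported in the
strip of half-width `T`, reduced to what the pairing with the Duhamel extension needs: the kernel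
`K` reproduces it at all scales `S ≥ T`. -/
structure IsReproduced (K : 𝓢(ℝ, ℂ)) (T : ℝ) (B : ℝ → ℂ) : Prop where
  continuous : Continuous B
  integrable : Integrable B
  exists_norm_le : ∃ M, ∀ ω, ‖B ω‖ ≤ M
  integral_mul_eq : ∀ S, T ≤ S → ∀ θ, ∫ ω, B ω * (S * K (S * (ω - θ))) = 2 * Real.pi * B θ

theorem IsCutoffKernel.integral_symbol_mul {K : 𝓢(ℝ, ℂ)} (hK : IsCutoffKernel K) {σ T S : ℝ}
    (hS : 0 < S) (hTS : T ≤ S) {Φ : 𝓢(SpaceTime, ℂ)} (hΦ : tsupport Φ ⊆ strip T) (θ ξ : ℝ) :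
    ∫ ω, symbol σ Φ (ω, ξ) * (S * K (S * (ω - θ))) = 2 * Real.pi * symbol σ Φ (θ, ξ) := by
  have phase (p : SpaceTime) (ω : ℝ) :
      Complex.exp (↑(p 0 * (ω - σ * ξ) + p 1 * ξ) * Complex.I) =
        Complex.exp (↑(p 1 * ξ - p 0 * (σ * ξ)) * Complex.I) *
          Complex.exp (↑(p 0 * ω) * Complex.I) := by
    rw [← Complex.exp_add, ← add_mul, ← Complex.ofReal_add]
    congr 3
    ring
  have integrable : Integrable (fun y : ℝ × SpaceTime =>
      Complex.exp (↑(y.2 0 * (y.1 - σ * ξ) + y.2 1 * ξ) * Complex.I) *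
        (S * K (S * (y.1 - θ)) * Φ y.2)) (volume.prod volume) := by
    refine ((integrable_scaled_kernel K hS.ne' θ).mul_prod Φ.integrable).bdd_mul (c := 1)
      (Continuous.aestronglyMeasurable (by fun_prop)) (.of_forall fun y => ?_)
    rw [Complex.norm_exp_ofReal_mul_I]
  calc _ = ∫ ω, ∫ p : SpaceTime, Complex.exp (↑(p 0 * (ω - σ * ξ) + p 1 * ξ) * Complex.I) *
        (S * K (S * (ω - θ)) * Φ p) := by
        simp only [symbol_eq_integral, ← integral_mul_const, mul_right_comm _ (Φ _), mul_assoc]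
    _ = ∫ p : SpaceTime, ∫ ω, Complex.exp (↑(p 0 * (ω - σ * ξ) + p 1 * ξ) * Complex.I) *
        (S * K (S * (ω - θ)) * Φ p) := integral_integral_swap integrable
    _ = ∫ p : SpaceTime, 2 * Real.pi *
        (Complex.exp (↑(p 0 * (θ - σ * ξ) + p 1 * ξ) * Complex.I) * Φ p) := by
        refine integral_congr_ae (.of_forall fun p => ?_)
        simp only [phase, ← mul_assoc _ _ (Φ p), integral_mul_const]
        by_cases hp : Φ p = 0
        · simp only [hp, mul_zero]
        simp only [mul_assoc _ (Complex.exp (↑(p 0 * _) * Complex.I)), integral_const_mul,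
          hK.integral_exp_mul hS ((abs_lt_of_ne_zero hΦ hp).le.trans hTS)]
        ring
    _ = _ := by rw [integral_const_mul, symbol_eq_integral]

theorem IsCutoffKernel.isReproduced_symbol {K : 𝓢(ℝ, ℂ)} (hK : IsCutoffKernel K) {T : ℝ}
    (hT : 0 < T) (σ : ℝ) {Φ : 𝓢(SpaceTime, ℂ)} (hΦ : tsupport Φ ⊆ strip T) (ξ : ℝ) :
    IsReproduced K T fun ω => symbol σ Φ (ω, ξ) := by
  obtain ⟨M, hM₀, hM⟩ := exists_norm_symbol_le σ Φ
  have continuous : Continuous fun ω => symbol σ Φ (ω, ξ) := by fun_prop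
  refine ⟨continuous, ?_, ⟨M, fun ω => (hM (ω, ξ)).trans ?_⟩,
    fun S hS θ => hK.integral_symbol_mul (hT.trans_le hS) hS hΦ θ ξ⟩
  · exact ((integrable_bracket_rpow (by norm_num)).const_mul M).mono'
      continuous.aestronglyMeasurable (.of_forall fun ω => hM (ω, ξ))
  · exact mul_le_of_le_one_right hM₀
      (Real.rpow_le_one_of_one_le_of_nonpos (one_le_bracket ω) (by norm_num))

section Fiber

variable {K : 𝓢(ℝ, ℂ)} {T δ : ℝ} {B h : ℝ → ℂ}

theorem integrable_highPart (hT : 0 < T) (hT1 : T ≤ 1) (hδ : 0 ≤ δ) (hh : Measurable h)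
    (hfin : ∫⁻ θ, ENNReal.ofReal (bracket θ ^ (-1 + δ)) * ‖h θ‖ₑ ≠ ⊤) :
    Integrable (highPart T h) := by
  refine ⟨(measurable_highPart T hh).aestronglyMeasurable,
    (lintegral_enorm_highPart_le hT hT1 hδ).trans_lt ?_⟩
  exact ENNReal.mul_lt_top (ENNReal.mul_lt_top ENNReal.ofNat_lt_top ENNReal.ofReal_lt_top)
    hfin.lt_top

theorem integrableOn_ball_of_lintegral_ne_top (R : ℝ) (hδ : 0 ≤ δ) (hh : Measurable h)
    (hfin : ∫⁻ θ, ENNReal.ofReal (bracket θ ^ (-1 + δ)) * ‖h θ‖ₑ ≠ ⊤) :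
    IntegrableOn h (Metric.ball 0 R) := by
  refine ⟨hh.aestronglyMeasurable, ?_⟩
  calc ∫⁻ θ in Metric.ball 0 R, ‖h θ‖ₑ
      ≤ ∫⁻ θ in Metric.ball 0 R,
          ENNReal.ofReal (1 + R) * (ENNReal.ofReal (bracket θ ^ (-1 + δ)) * ‖h θ‖ₑ) := by
        refine setLIntegral_mono' measurableSet_ball fun θ hθ => ?_
        have hθ : |θ| < R := by simpa using hθ
        rw [← mul_assoc, ← ENNReal.ofReal_mul (by linarith [abs_nonneg θ])]
        refine le_mul_of_one_le_left' (ENNReal.one_le_ofReal.2 ?_)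
        calc 1 = bracket θ * bracket θ ^ (-1 : ℝ) := by
              rw [Real.rpow_neg_one, mul_inv_cancel₀ (bracket_pos θ).ne']
          _ ≤ (1 + R) * bracket θ ^ (-1 + δ) := by
              have := bracket_pos θ
              refine mul_le_mul (by linarith [bracket_le_one_add_abs θ]) ?_ (by positivity)
                (by linarith [abs_nonneg θ])
              exact Real.rpow_le_rpow_of_exponent_le (one_le_bracket θ) (by linarith)
    _ ≤ ∫⁻ θ, ENNReal.ofReal (1 + R) * (ENNReal.ofReal (bracket θ ^ (-1 + δ)) * ‖h θ‖ₑ) :=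
        setLIntegral_le_lintegral _ _
    _ < ⊤ := by
        rw [lintegral_const_mul' _ _ ENNReal.ofReal_ne_top]
        exact ENNReal.mul_lt_top ENNReal.ofReal_lt_top hfin.lt_top

theorem exists_norm_lowKernel_le (K : 𝓢(ℝ, ℂ)) (hT : 0 < T) :
    ∃ A, ∀ ω, ∀ θ ∈ Metric.ball 0 T⁻¹, ‖lowKernel K T ω θ‖ ≤ A := by
  obtain ⟨A, hA₀, hA⟩ := exists_difference_quotient_le K
  refine ⟨T * (A * (T * 1)), fun ω θ hθ => ?_⟩
  rw [mem_ball_zero_iff, Real.norm_eq_abs] at hθ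
  rw [lowKernel, ← mul_sub, mul_div_assoc, norm_mul, Complex.norm_of_nonneg hT.le]
  gcongr
  refine (hA T hT θ ω hθ.le).trans ?_
  gcongr
  exact Real.rpow_le_one_of_one_le_of_nonpos (one_le_bracket _) (by norm_num)

theorem IsReproduced.integrable_mul (hB : IsReproduced K T B) {k : ℝ → ℂ} (hk : Integrable k) :
    Integrable fun ω => k ω * B ω := by
  obtain ⟨M, hM⟩ := hB.exists_norm_le
  exact hk.mul_bdd (c := M) hB.continuous.aestronglyMeasurable (.of_forall hM)

theorem IsReproduced.integrable_mul_lowKernel (hB : IsReproduced K T B) (hT : 0 < T)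
    (hi : IntegrableOn h (Metric.ball 0 T⁻¹)) :
    Integrable (fun y : ℝ × ℝ => B y.1 * (h y.2 * lowKernel K T y.1 y.2))
      (volume.prod (volume.restrict (Metric.ball 0 T⁻¹))) := by
  obtain ⟨A, hA⟩ := exists_norm_lowKernel_le K hT
  simp only [← mul_assoc]
  refine (hB.integrable.mul_prod hi).mul_bdd (c := A)
    (measurable_lowKernel K T).aestronglyMeasurable ?_
  exact Measure.quasiMeasurePreserving_snd.ae
    ((ae_restrict_of_forall_mem measurableSet_ball fun θ hθ ω => hA ω θ hθ)) |>.mono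
    fun y hy => hy y.1

theorem IsReproduced.integral_mul_lowKernel (hB : IsReproduced K T B) (hT : 0 < T) (c : ℂ)
    (θ : ℝ) : ∫ ω, B ω * (c * lowKernel K T ω θ) =
      2 * Real.pi * (c * ((B θ - B 0) / (Complex.I * θ))) := by
  have integrable (θ : ℝ) : Integrable fun ω => B ω * (T * K (T * (ω - θ))) := by
    simpa only [mul_comm] using hB.integrable_mul (integrable_scaled_kernel K hT.ne' θ)
  calc _ = ∫ ω, c / (Complex.I * θ) *
        (B ω * (T * K (T * (ω - θ))) - B ω * (T * K (T * (ω - 0)))) := by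
        refine integral_congr_ae (.of_forall fun ω => ?_)
        simp only [lowKernel, sub_zero]
        ring
    _ = _ := by
        rw [integral_const_mul, integral_sub (integrable θ) (integrable 0),
          hB.integral_mul_eq T le_rfl θ, hB.integral_mul_eq T le_rfl 0]
        ring

theorem IsReproduced.integral_mul_integral_lowKernel (hB : IsReproduced K T B) (hT : 0 < T)
    (hi : IntegrableOn h (Metric.ball 0 T⁻¹)) :
    ∫ ω, B ω * ∫ θ in Metric.ball 0 T⁻¹, h θ * lowKernel K T ω θ =
      2 * Real.pi * ∫ θ in Metric.ball 0 T⁻¹, h θ * ((B θ - B 0) / (Complex.I * θ)) := by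
  simp only [← integral_const_mul]
  rw [integral_integral_swap (hB.integrable_mul_lowKernel hT hi)]
  simp only [hB.integral_mul_lowKernel hT]

theorem IsReproduced.integrableOn_divided_difference (hB : IsReproduced K T B) (hT : 0 < T)
    (hi : IntegrableOn h (Metric.ball 0 T⁻¹)) :
    IntegrableOn (fun θ : ℝ => h θ * ((B θ - B 0) / (Complex.I * θ))) (Metric.ball 0 T⁻¹) := by
  have := (hB.integrable_mul_lowKernel hT hi).integral_prod_right
  simp only [hB.integral_mul_lowKernel hT] at this
  have two_pi_ne_zero : (2 * Real.pi : ℂ) ≠ 0 := by exact_mod_cast Real.two_pi_pos.ne'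
  exact (integrable_const_mul_iff (IsUnit.mk0 _ two_pi_ne_zero) _).1 this

theorem IsReproduced.integral_divided_difference (hB : IsReproduced K T B) (hT : 0 < T)
    (hi : IntegrableOn h (Metric.ball 0 T⁻¹))
    (hhigh : Integrable (highPart T h)) :
    ∫ θ : ℝ, h θ * ((B θ - B 0) / (Complex.I * θ)) =
      (∫ θ in Metric.ball 0 T⁻¹, h θ * ((B θ - B 0) / (Complex.I * θ))) +
        ((∫ θ, highPart T h θ * B θ) - (∫ θ, highPart T h θ) * B 0) := by
  have high_eq : (fun θ : ℝ => highPart T h θ * B θ - highPart T h θ * B 0) =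
      (Metric.ball 0 T⁻¹)ᶜ.indicator fun θ : ℝ => h θ * ((B θ - B 0) / (Complex.I * θ)) := by
    ext θ
    by_cases hθ : θ ∈ Metric.ball 0 T⁻¹
    · simp only [highPart, indicator_of_notMem (notMem_compl_iff.2 hθ), zero_mul, sub_zero]
    · simp only [highPart, indicator_of_mem (mem_compl hθ)]
      ring
  have integrable_high := (hB.integrable_mul hhigh).sub (hhigh.mul_const (B 0))
  rw [← integral_mul_const, ← integral_sub (hB.integrable_mul hhigh) (hhigh.mul_const _), high_eq,
    integral_indicator measurableSet_ball.compl]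
  refine (integral_add_compl measurableSet_ball ?_).symm
  rw [← integrableOn_univ, ← union_compl_self (Metric.ball 0 T⁻¹)]
  exact (hB.integrableOn_divided_difference hT hi).union
    ((integrable_indicator_iff measurableSet_ball.compl).1 (high_eq ▸ integrable_high))

theorem IsReproduced.integral_duhamel_mul (hB : IsReproduced K T B) (hT : 0 < T) (hT1 : T ≤ 1)
    (hδ : 0 ≤ δ) (a : ℂ) (hh : Measurable h)
    (hfin : ∫⁻ θ, ENNReal.ofReal (bracket θ ^ (-1 + δ)) * ‖h θ‖ₑ ≠ ⊤) :
    ∫ ω, duhamel K T a h ω * B ω =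
      2 * Real.pi * a * B 0 + ∫ θ : ℝ, h θ * ((B θ - B 0) / (Complex.I * θ)) := by
  have hhigh := integrable_highPart hT hT1 hδ hh hfin
  have hi := integrableOn_ball_of_lintegral_ne_top T⁻¹ hδ hh hfin
  have free_eq : ∫ ω, K ω * B ω = 2 * Real.pi * B 0 := by
    simpa [mul_comm] using hB.integral_mul_eq 1 hT1 0
  have integrable_low :
      Integrable fun ω => B ω * ∫ θ in Metric.ball 0 T⁻¹, h θ * lowKernel K T ω θ := by
    simpa only [integral_const_mul] using
      (hB.integrable_mul_lowKernel hT hi).integral_prod_left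
  have expand (ω : ℝ) : duhamel K T a h ω * B ω =
      (a - (2 * Real.pi : ℂ)⁻¹ * ∫ θ, highPart T h θ) * (K ω * B ω) + highPart T h ω * B ω +
        (2 * Real.pi : ℂ)⁻¹ * (B ω * ∫ θ in Metric.ball 0 T⁻¹, h θ * lowKernel K T ω θ) := by
    rw [duhamel]
    ring
  have integrable_free := (hB.integrable_mul K.integrable).const_mul
    (a - (2 * Real.pi : ℂ)⁻¹ * ∫ θ, highPart T h θ)
  simp only [expand]
  rw [integral_add (by exact integrable_free.add (hB.integrable_mul hhigh))
      (integrable_low.const_mul _),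
    integral_add integrable_free (hB.integrable_mul hhigh), integral_const_mul,
    integral_const_mul, free_eq, hB.integral_mul_integral_lowKernel hT hi,
    hB.integral_divided_difference hT hi hhigh]
  have hπ : (Real.pi : ℂ) ≠ 0 := Complex.ofReal_ne_zero.2 Real.pi_ne_zero
  field_simp
  ring

end Fiber

theorem ae_lintegral_ne_top_of_ySq {s r : ℝ} {h : ℝ × ℝ → ℂ} (hh : Measurable h)
    (hy : ySq s r h ≠ ⊤) :
    ∀ᵐ ξ : ℝ, ∫⁻ θ, ENNReal.ofReal (bracket θ ^ r) * ‖h (θ, ξ)‖ₑ ≠ ⊤ := by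
  have := measurable_lintegral_fiber r hh
  filter_upwards [ae_lt_top (by fun_prop) hy] with ξ hξ htop
  have := bracket_rpow_pos ξ s
  rw [htop, ENNReal.mul_top (by simpa using this)] at hξ
  simp at hξ

theorem integrable_of_ySq {s δ : ℝ} (hδ : 0 ≤ δ) {h : ℝ × ℝ → ℂ} (hh : Measurable h)
    (hy : ySq s (-1 + δ) h ≠ ⊤) (χ : 𝓢(ℝ, ℂ)) :
    Integrable fun z : ℝ × ℝ => bracket z.1 ^ (-1 : ℝ) * ‖h z * χ z.2‖ := by
  have hχ : Measurable χ := χ.continuous.measurable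
  have measurable_integrand :
      Measurable fun z : ℝ × ℝ => bracket z.1 ^ (-1 : ℝ) * ‖h z * χ z.2‖ := by fun_prop
  refine ⟨measurable_integrand.aestronglyMeasurable, ?_⟩
  let Y : ℝ → ℝ≥0∞ := fun ξ => ∫⁻ θ, ENNReal.ofReal (bracket θ ^ (-1 + δ)) * ‖h (θ, ξ)‖ₑ
  have : Measurable Y := measurable_lintegral_fiber (-1 + δ) hh
  have fiber_le (ξ : ℝ) : ∫⁻ θ, ‖bracket θ ^ (-1 : ℝ) * ‖h (θ, ξ) * χ ξ‖‖ₑ ≤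
      ENNReal.ofReal (bracket ξ ^ (-s)) * ‖χ ξ‖ₑ * (ENNReal.ofReal (bracket ξ ^ s) * Y ξ) := by
    have cancel : ENNReal.ofReal (bracket ξ ^ (-s)) * ENNReal.ofReal (bracket ξ ^ s) = 1 := by
      rw [← ENNReal.ofReal_mul (bracket_rpow_pos ξ _).le, bracket_rpow_mul_rpow, neg_add_cancel,
        Real.rpow_zero, ENNReal.ofReal_one]
    calc _ ≤ ∫⁻ θ, ‖χ ξ‖ₑ * (ENNReal.ofReal (bracket θ ^ (-1 + δ)) * ‖h (θ, ξ)‖ₑ) := by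
          refine lintegral_mono fun θ => ?_
          rw [enorm_mul, enorm_norm, enorm_mul, mul_comm ‖h _‖ₑ, mul_left_comm,
            Real.enorm_of_nonneg (bracket_rpow_pos θ _).le]
          gcongr
          · exact one_le_bracket θ
          · linarith
      _ = ‖χ ξ‖ₑ * Y ξ := lintegral_const_mul' _ _ enorm_ne_top
      _ = ENNReal.ofReal (bracket ξ ^ (-s)) * ENNReal.ofReal (bracket ξ ^ s) *
          (‖χ ξ‖ₑ * Y ξ) := by rw [cancel, one_mul]
      _ = _ := by ring
  have schwartz_ne_top : ∫⁻ ξ, (ENNReal.ofReal (bracket ξ ^ (-s)) * ‖χ ξ‖ₑ) ^ 2 ≠ ⊤ := by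
    obtain ⟨C, hC⟩ := exists_lintegral_weight_mul_schwartz_sq_le le_rfl (-s) χ
    have := hC 0
    simp only [Real.rpow_zero, one_mul, ENNReal.ofReal_one, one_pow, mul_one] at this
    exact ne_top_of_le_ne_top ENNReal.coe_ne_top this
  refine lt_of_le_of_lt (b := ∫⁻ ξ, ENNReal.ofReal (bracket ξ ^ (-s)) * ‖χ ξ‖ₑ *
    (ENNReal.ofReal (bracket ξ ^ s) * Y ξ)) ?_ ?_
  · rw [Measure.volume_eq_prod, lintegral_prod_symm _ measurable_integrand.enorm.aemeasurable]
    exact lintegral_mono fiber_le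
  · refine (ENNReal.pow_lt_top_iff (n := 2)).1 ?_ |>.resolve_right two_ne_zero
    exact (lintegral_mul_sq_le (by fun_prop) (by fun_prop)).trans_lt
      (ENNReal.mul_lt_top schwartz_ne_top.lt_top hy.lt_top)

/-! ### Limits along dilations of a Schwartz function -/

theorem exists_dilation_quotient_le (g : 𝓢(ℝ, ℂ)) :
    ∃ C : ℝ, ∀ δ : ℝ, 0 < δ → δ ≤ 1 → ∀ θ ω : ℝ,
      ‖(g (δ * (ω - θ)) - g (δ * ω)) / (Complex.I * θ)‖ ≤ C * bracket θ ^ (-1 : ℝ) := by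
  obtain ⟨A, hA₀, hA⟩ := exists_difference_quotient_le g
  set M := SchwartzMap.seminorm ℝ 0 0 g
  have hM (x : ℝ) : ‖g x‖ ≤ M := SchwartzMap.norm_le_seminorm ℝ g x
  have hM₀ : 0 ≤ M := (norm_nonneg _).trans (hM 0)
  refine ⟨2 * A + 4 * M, fun δ hδ hδ1 θ ω => ?_⟩
  have one_le_inv : 1 ≤ δ⁻¹ := (one_le_inv₀ hδ).2 hδ1
  have bracket_le := bracket_le_one_add_abs θ
  rw [Real.rpow_neg_one, ← div_eq_mul_inv, le_div_iff₀ (bracket_pos θ)]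
  rcases le_or_gt |θ| δ⁻¹ with small | large
  · have quotient_le : ‖(g (δ * (ω - θ)) - g (δ * ω)) / (Complex.I * θ)‖ ≤ A * (δ * 1) := by
      refine (hA δ hδ θ ω small).trans ?_
      gcongr
      exact Real.rpow_le_one_of_one_le_of_nonpos (one_le_bracket _) (by norm_num)
    calc _ ≤ A * (δ * 1) * (δ⁻¹ + δ⁻¹) := by
          refine mul_le_mul quotient_le (by linarith) (bracket_pos θ).le (by positivity)
      _ = 2 * A := by field_simp; ring
      _ ≤ 2 * A + 4 * M := by linarith
  · have hθ : 0 < |θ| := by linarith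
    rw [norm_div, norm_mul, Complex.norm_I, one_mul, Complex.norm_real, Real.norm_eq_abs,
      div_mul_eq_mul_div, div_le_iff₀ hθ]
    calc _ ≤ (M + M) * (|θ| + |θ|) :=
          mul_le_mul ((norm_sub_le _ _).trans (add_le_add (hM _) (hM _))) (by linarith)
            (bracket_pos θ).le (by positivity)
      _ = 4 * M * |θ| := by ring
      _ ≤ (2 * A + 4 * M) * |θ| := by gcongr; linarith

theorem exists_norm_mul_dilation_quotient_le (g : 𝓢(ℝ, ℂ)) :
    ∃ C : ℝ, ∀ δ : ℝ, 0 < δ → δ ≤ 1 → ∀ (c : ℂ) (θ ω : ℝ),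
      ‖c * ((g (δ * (ω - θ)) - g (δ * ω)) / (Complex.I * θ))‖ ≤
        C * (bracket θ ^ (-1 : ℝ) * ‖c‖) := by
  obtain ⟨C, hC⟩ := exists_dilation_quotient_le g
  refine ⟨C, fun δ hδ hδ1 c θ ω => ?_⟩
  rw [norm_mul, mul_comm, ← mul_assoc]
  gcongr
  exact hC δ hδ hδ1 θ ω

section Dilation

variable {α : Type*} [MeasurableSpace α] {μ : Measure α} {k : α → ℂ} {θ ω : α → ℝ}

theorem integrable_mul_dilation (g : 𝓢(ℝ, ℂ)) (hk : Integrable k μ) (hω : Measurable ω) (δ : ℝ) :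
    Integrable (fun a => k a * g (δ * ω a)) μ :=
  hk.mul_bdd (c := SchwartzMap.seminorm ℝ 0 0 g)
    (g.continuous.measurable.comp (hω.const_mul δ)).aestronglyMeasurable
    (.of_forall fun _ => SchwartzMap.norm_le_seminorm ℝ g _)

theorem tendsto_integral_mul_dilation (g : 𝓢(ℝ, ℂ)) (hk : Integrable k μ) (hω : Measurable ω) :
    Filter.Tendsto (fun δ => ∫ a, k a * g (δ * ω a) ∂μ) (nhds 0) (nhds ((∫ a, k a ∂μ) * g 0)) := by
  rw [← integral_mul_const]
  refine tendsto_integral_filter_of_dominated_convergence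
    (fun a => ‖k a‖ * SchwartzMap.seminorm ℝ 0 0 g)
    (.of_forall fun δ => (integrable_mul_dilation g hk hω δ).aestronglyMeasurable)
    (.of_forall fun δ => .of_forall fun a => ?_) (hk.norm.mul_const _) (.of_forall fun a => ?_)
  · rw [norm_mul]
    gcongr
    exact SchwartzMap.norm_le_seminorm ℝ g _
  · have : Continuous fun δ => k a * g (δ * ω a) := by fun_prop
    simpa only [zero_mul] using this.tendsto 0

theorem aestronglyMeasurable_mul_dilation_quotient (g : 𝓢(ℝ, ℂ)) (hk : AEStronglyMeasurable k μ)
    (hθ : Measurable θ) (hω : Measurable ω) (δ : ℝ) : AEStronglyMeasurable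
      (fun a => k a * ((g (δ * (ω a - θ a)) - g (δ * ω a)) / (Complex.I * θ a))) μ := by
  have := g.continuous.measurable
  exact hk.mul (Measurable.aestronglyMeasurable (by fun_prop))

theorem integrable_mul_dilation_quotient (g : 𝓢(ℝ, ℂ)) (hk : AEStronglyMeasurable k μ)
    (hθ : Measurable θ) (hω : Measurable ω)
    (hi : Integrable (fun a => bracket (θ a) ^ (-1 : ℝ) * ‖k a‖) μ) {δ : ℝ} (hδ : 0 < δ)
    (hδ1 : δ ≤ 1) : Integrable
      (fun a => k a * ((g (δ * (ω a - θ a)) - g (δ * ω a)) / (Complex.I * θ a))) μ := by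
  obtain ⟨C, hC⟩ := exists_norm_mul_dilation_quotient_le g
  exact (hi.const_mul C).mono' (aestronglyMeasurable_mul_dilation_quotient g hk hθ hω δ)
    (.of_forall fun a => hC δ hδ hδ1 _ _ _)

theorem tendsto_integral_mul_dilation_quotient (g : 𝓢(ℝ, ℂ)) (hk : AEStronglyMeasurable k μ)
    (hθ : Measurable θ) (hω : Measurable ω)
    (hi : Integrable (fun a => bracket (θ a) ^ (-1 : ℝ) * ‖k a‖) μ) :
    Filter.Tendsto (fun δ => ∫ a, k a * ((g (δ * (ω a - θ a)) - g (δ * ω a)) /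
      (Complex.I * θ a)) ∂μ) (nhdsWithin 0 (Ioi 0)) (nhds 0) := by
  obtain ⟨C, hC⟩ := exists_norm_mul_dilation_quotient_le g
  rw [← integral_zero α ℂ (μ := μ)]
  refine tendsto_integral_filter_of_dominated_convergence _
    (.of_forall (aestronglyMeasurable_mul_dilation_quotient g hk hθ hω)) ?_ (hi.const_mul C)
    (.of_forall fun a => ?_)
  · filter_upwards [Ioc_mem_nhdsGT one_pos] with δ hδ
    exact .of_forall fun a => hC δ hδ.1 hδ.2 _ _ _
  · have : Continuous fun δ => k a * ((g (δ * (ω a - θ a)) - g (δ * ω a)) / (Complex.I * θ a)) := by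
      fun_prop
    simpa using (this.tendsto 0).mono_left nhdsWithin_le_nhds

end Dilation

/-! ### The Duhamel formula -/

theorem symbol_lineDerivOp (σ : ℝ) (Ψ : 𝓢(SpaceTime, ℂ)) (z : ℝ × ℝ) :
    symbol σ (∂_{direction σ} Ψ) z = -(Complex.I * z.1) * symbol σ Ψ z := by
  have growth : (fun p : SpaceTime => inner ℝ p (direction σ)).HasTemperateGrowth := by fun_prop
  rw [symbol, SchwartzMap.fourierInv_lineDerivOp_eq, smul_apply,
    SchwartzMap.smulLeftCLM_apply_apply growth, symbol, inner_smul_left, inner_spaceTime]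
  have hπ : (Real.pi : ℂ) ≠ 0 := Complex.ofReal_ne_zero.2 Real.pi_ne_zero
  simp only [freqChart_zero, freqChart_one, direction_zero, direction_one, Complex.real_smul,
    smul_eq_mul, conj_trivial]
  push_cast
  field_simp
  ring

theorem symbol_tensor (σ : ℝ) (η χ : 𝓢(ℝ, ℂ)) (z : ℝ × ℝ) :
    symbol σ (shearTensor 0 η χ) z =
      (𝓕 η) ((2 * Real.pi)⁻¹ * (σ * z.2 - z.1)) * (𝓕⁻ χ) ((2 * Real.pi)⁻¹ * z.2) := by
  rw [symbol, fourierInv_tensor, SchwartzMap.fourierInv_coe η, Real.fourierInv_eq_fourier_neg,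
    ← SchwartzMap.fourier_coe]
  simp only [PiLp.smul_apply, freqChart_zero, freqChart_one, smul_eq_mul]
  congr 2
  ring

/-- The action on the test function `Φ` of the solution of the transport equation, by Duhamel's
formula; `a` is the Fourier transform of the initial value, and `h` is that of the forcing term, in
the coordinates `θ = τ + σ ξ` and `ξ`. -/
noncomputable def solutionPairing (σ : ℝ) (a : ℝ → ℂ) (h : ℝ × ℝ → ℂ) (Φ : 𝓢(SpaceTime, ℂ)) : ℂ :=
  ((2 * Real.pi : ℂ) ^ 2)⁻¹ * ∫ ξ : ℝ, (2 * Real.pi * a ξ * symbol σ Φ (0, ξ) +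
    ∫ θ : ℝ, h (θ, ξ) * ((symbol σ Φ (θ, ξ) - symbol σ Φ (0, ξ)) / (Complex.I * θ)))

theorem IsFourierTransform.apply_eq_solutionPairing {K : 𝓢(ℝ, ℂ)} (hK : IsCutoffKernel K)
    {s δ σ T : ℝ} (hT : 0 < T) (hT1 : T ≤ 1) (hδ : 0 ≤ δ) {a : ℝ → ℂ} {h : ℝ × ℝ → ℂ}
    (hh : Measurable h) (hy : ySq s (-1 + δ) h ≠ ⊤) {g : 𝓢'(SpaceTime, ℂ)} {G : SpaceTime → ℂ}
    (hg : IsFourierTransform g G)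
    (hG : ∀ z, G (freqChart σ z) = duhamel K T (a z.2) (fun θ => h (θ, z.2)) z.1)
    {Φ : 𝓢(SpaceTime, ℂ)} (hΦ : tsupport Φ ⊆ strip T) : g Φ = solutionPairing σ a h Φ := by
  rw [hg.apply_eq_integral_symbol σ Φ, solutionPairing]
  congr 1
  refine integral_congr_ae ?_
  filter_upwards [ae_lintegral_ne_top_of_ySq hh hy] with ξ hξ
  simp only [hG]
  exact (hK.isReproduced_symbol hT σ hΦ ξ).integral_duhamel_mul hT hT1 hδ (a ξ) (by fun_prop) hξ

theorem IsFourierTransform.solutionPairing_lineDerivOp {F : 𝓢'(SpaceTime, ℂ)}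
    {H : SpaceTime → ℂ} (hH : IsFourierTransform F H) (σ : ℝ) (a : ℝ → ℂ)
    (Ψ : 𝓢(SpaceTime, ℂ)) :
    solutionPairing σ a (H ∘ freqChart σ) (∂_{direction σ} Ψ) = -F Ψ := by
  rw [solutionPairing, hH.apply_eq_integral_symbol σ Ψ, ← mul_neg, ← integral_neg]
  congr 2 with ξ
  simp only [symbol_lineDerivOp, Complex.ofReal_zero, mul_zero, neg_zero, zero_mul, zero_add,
    sub_zero]
  rw [← integral_neg]
  refine integral_congr_ae ?_
  filter_upwards [Measure.ae_ne volume (0 : ℝ)] with θ hθ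
  have : (θ : ℂ) ≠ 0 := Complex.ofReal_ne_zero.2 hθ
  simp only [Function.comp_apply]
  field_simp

section Mollifier

variable {s σ : ℝ} {g : 𝓢(ℝ, ℂ)} {m : ℝ → 𝓢(ℝ, ℂ)} {a : ℝ → ℂ} {h : ℝ × ℝ → ℂ}

theorem IsMollifier.solutionPairing_tensor (hm : IsMollifier g m) {δ : ℝ} (hδ : 0 < δ)
    (hδ1 : δ ≤ 1) {χ κ : 𝓢(ℝ, ℂ)} (hκ : ∀ ξ, κ ξ = (𝓕⁻ χ) ((2 * Real.pi)⁻¹ * ξ))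
    (ha : Integrable fun ξ => a ξ * κ ξ) (hh : Measurable h)
    (hi : Integrable fun z : ℝ × ℝ => bracket z.1 ^ (-1 : ℝ) * ‖h z * κ z.2‖) :
    solutionPairing σ a h (shearTensor 0 (m δ) χ) = ((2 * Real.pi : ℂ) ^ 2)⁻¹ *
      (2 * Real.pi * (∫ ξ, a ξ * κ ξ * g (δ * (2 * Real.pi)⁻¹ * (σ * ξ))) +
        ∫ z : ℝ × ℝ, h z * κ z.2 * ((g (δ * (2 * Real.pi)⁻¹ * (σ * z.2 - z.1)) -
          g (δ * (2 * Real.pi)⁻¹ * (σ * z.2))) / (Complex.I * z.1))) := by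
  have scale_pos : 0 < δ * (2 * Real.pi)⁻¹ := by positivity
  have scale_le : δ * (2 * Real.pi)⁻¹ ≤ 1 :=
    mul_le_one₀ hδ1 (by positivity) (inv_le_one_of_one_le₀ (by linarith [Real.pi_gt_three]))
  have integrable_free := (integrable_mul_dilation g (ω := fun ξ => σ * ξ) ha (by fun_prop)
    (δ * (2 * Real.pi)⁻¹)).const_mul (2 * Real.pi : ℂ)
  have hκm := κ.continuous.measurable
  have integrable_forced := integrable_mul_dilation_quotient g (k := fun z => h z * κ z.2)
    (Measurable.aestronglyMeasurable (by fun_prop)) measurable_fst (measurable_snd.const_mul σ) hi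
    scale_pos scale_le
  have symbol_eq (z : ℝ × ℝ) : symbol σ (shearTensor 0 (m δ) χ) z =
      g (δ * (2 * Real.pi)⁻¹ * (σ * z.2 - z.1)) * κ z.2 := by
    rw [symbol_tensor, hm.fourier_apply hδ, hκ, mul_assoc]
  rw [solutionPairing, Measure.volume_eq_prod, integral_prod_symm _ integrable_forced]
  congr 1
  rw [← integral_const_mul, ← integral_add integrable_free integrable_forced.integral_prod_right]
  congr 1 with ξ
  simp only [symbol_eq, sub_zero]
  congr 1
  · ring
  · congr 1 with θ
    ring

theorem IsMollifier.tendsto_solutionPairing (hm : IsMollifier g m) {f : 𝓢'(ℝ, ℂ)}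
    (hf : IsFourierTransform f a) {δ₀ : ℝ} (hδ₀ : 0 ≤ δ₀) (hh : Measurable h)
    (hy : ySq s (-1 + δ₀) h ≠ ⊤) (σ : ℝ) (χ : 𝓢(ℝ, ℂ)) :
    Filter.Tendsto (fun δ => solutionPairing σ a h (shearTensor 0 (m δ) χ))
      (nhdsWithin 0 (Ioi 0)) (nhds (f χ)) := by
  obtain ⟨κ, hκ⟩ := exists_schwartz_comp_mul_left (𝓕⁻ χ) (inv_ne_zero Real.two_pi_pos.ne')
  have ha : Integrable fun ξ => a ξ * κ ξ := by
    simpa only [hκ, smul_eq_mul] using hf.integrable_mul_fourierInv χ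
  have hi := integrable_of_ySq hδ₀ hh hy κ
  have scale : Filter.Tendsto (fun δ : ℝ => δ * (2 * Real.pi)⁻¹) (nhdsWithin 0 (Ioi 0))
      (nhdsWithin 0 (Ioi 0)) := by
    refine tendsto_nhdsWithin_iff.2 ⟨?_, ?_⟩
    · have : Continuous fun δ : ℝ => δ * (2 * Real.pi)⁻¹ := by fun_prop
      simpa only [zero_mul] using (this.tendsto 0).mono_left nhdsWithin_le_nhds
    · filter_upwards [self_mem_nhdsWithin] with δ hδ
      exact mul_pos (mem_Ioi.1 hδ) (inv_pos.2 Real.two_pi_pos)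
  have hκm := κ.continuous.measurable
  have tendsto_free := (tendsto_integral_mul_dilation g (ω := fun ξ => σ * ξ) ha
    (by fun_prop)).comp (scale.mono_right nhdsWithin_le_nhds)
  have tendsto_forced := (tendsto_integral_mul_dilation_quotient g (k := fun z => h z * κ z.2)
    (Measurable.aestronglyMeasurable (by fun_prop)) measurable_fst
    (measurable_snd.const_mul σ) hi).comp scale
  have limit := ((tendsto_free.const_mul (2 * Real.pi : ℂ)).add tendsto_forced).const_mul
    ((2 * Real.pi : ℂ) ^ 2)⁻¹
  have limit_eq : ((2 * Real.pi : ℂ) ^ 2)⁻¹ *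
      (2 * Real.pi * ((∫ ξ, a ξ * κ ξ) * g 0) + 0) = f χ := by
    have hπ : (Real.pi : ℂ) ≠ 0 := Complex.ofReal_ne_zero.2 Real.pi_ne_zero
    rw [hf.apply_eq_integral χ, Module.finrank_self, hm.apply_zero]
    simp only [hκ, smul_eq_mul]
    field_simp
    ring
  rw [limit_eq] at limit
  refine limit.congr' ?_
  filter_upwards [Ioc_mem_nhdsGT one_pos] with δ hδ
  exact (hm.solutionPairing_tensor hδ.1 hδ.2 hκ ha hh hi).symm

end Mollifier

/-! ### The restriction norm of a solution -/

theorem norm_integral_mul_sub_le {m v : ℝ → ℂ} {δ r : ℝ} (hm : Continuous m)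
    (hsupp : tsupport m ⊆ Icc (-δ) δ) (hone : ∫ t, m t = 1) (hnorm : ∫ t, ‖m t‖ = 1)
    (hv : ContinuousOn v (Icc (-δ) δ)) (hr : ∀ t ∈ Icc (-δ) δ, ‖v t - v 0‖ ≤ r) :
    ‖(∫ t, m t * v t) - v 0‖ ≤ r := by
  have eq_zero {t : ℝ} (ht : t ∉ Icc (-δ) δ) : m t = 0 :=
    image_eq_zero_of_notMem_tsupport fun h => ht (hsupp h)
  have integrable_mul_v : Integrable fun t => m t * v t := by
    rw [← integrableOn_iff_integrable_of_support_subset (s := Icc (-δ) δ)]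
    · exact (hm.continuousOn.mul hv).integrableOn_Icc
    · exact fun t ht => by_contra fun hne => ht (by simp only [eq_zero hne, zero_mul])
  have integrable_m : Integrable m :=
    (integrable_norm_iff hm.aestronglyMeasurable).1 (integrable_of_integral_eq_one hnorm)
  calc ‖(∫ t, m t * v t) - v 0‖ = ‖∫ t, m t * (v t - v 0)‖ := by
        simp_rw [mul_sub]
        rw [integral_sub integrable_mul_v (integrable_m.mul_const _), integral_mul_const, hone,
          one_mul]
    _ ≤ ∫ t, ‖m t‖ * r := by
        refine norm_integral_le_of_norm_le (integrable_m.norm.mul_const _) (.of_forall fun t => ?_)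
        rw [norm_mul]
        by_cases ht : t ∈ Icc (-δ) δ
        · exact mul_le_mul_of_nonneg_left (hr t ht) (norm_nonneg _)
        · simp only [eq_zero ht, norm_zero, zero_mul, le_refl]
    _ = r := by rw [integral_mul_const, hnorm, one_mul]

theorem IsMollifier.tendsto_integral_mul {g : 𝓢(ℝ, ℂ)} {m : ℝ → 𝓢(ℝ, ℂ)} (hm : IsMollifier g m)
    {T : ℝ} (hT : 0 < T) {v : ℝ → ℂ} (hv : ContinuousOn v (Ioo (-T) T)) :
    Filter.Tendsto (fun δ => ∫ t, m δ t * v t) (nhdsWithin 0 (Ioi 0)) (nhds (v 0)) := by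
  have continuousAt_zero : ContinuousAt v 0 :=
    hv.continuousAt (Ioo_mem_nhds (neg_lt_zero.2 hT) hT)
  refine Metric.tendsto_nhds.2 fun r hr => ?_
  obtain ⟨d, hd, close⟩ := Metric.continuousAt_iff.1 continuousAt_zero (r / 2) (half_pos hr)
  filter_upwards [Ioo_mem_nhdsGT (lt_min hd hT)] with δ hδ
  rw [dist_eq_norm]
  refine (norm_integral_mul_sub_le (m δ).continuous (hm.tsupport_subset hδ.1)
    (hm.integral_eq_one hδ.1) (hm.integral_norm_eq_one hδ.1) ?_ fun t ht => ?_).trans_lt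
    (half_lt_self hr)
  · have hδT : δ < T := hδ.2.trans_le (min_le_right d T)
    exact hv.mono (Icc_subset_Ioo (neg_lt_neg hδT) hδT)
  · rw [← dist_eq_norm]
    refine (close ?_).le
    rw [Real.dist_0_eq_abs]
    exact (abs_le.2 ht).trans_lt (hδ.2.trans_le (min_le_left d T))

theorem HasInitialValue.tendsto {T : ℝ} (hT : 0 < T) {ψ : 𝓢'(SpaceTime, ℂ)} {f : 𝓢'(ℝ, ℂ)}
    (h : HasInitialValue T ψ f) {g : 𝓢(ℝ, ℂ)} {m : ℝ → 𝓢(ℝ, ℂ)} (hm : IsMollifier g m)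
    (χ : 𝓢(ℝ, ℂ)) :
    Filter.Tendsto (fun δ => ψ (shearTensor 0 (m δ) χ)) (nhdsWithin 0 (Ioi 0)) (nhds (f χ)) := by
  obtain ⟨u, hu, rfl, hψ⟩ := h
  have continuousOn_pairing : ContinuousOn (fun t => u t χ) (Ioo (-T) T) :=
    (PointwiseConvergenceCLM.evalCLM (RingHom.id ℂ) ℂ χ).continuous.comp_continuousOn hu
  refine (hm.tendsto_integral_mul hT continuousOn_pairing).congr' ?_
  filter_upwards [Ioo_mem_nhdsGT hT] with δ hδ
  refine (hψ (m δ) χ _ (hm.tsupport_subset_Ioo hδ.1 hδ.2) fun p => ?_).symm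
  rw [shearTensor_apply, zero_mul, sub_zero]

theorem transport_apply (σ : ℝ) (u : 𝓢'(SpaceTime, ℂ)) (Ψ : 𝓢(SpaceTime, ℂ)) :
    transport σ u Ψ = -u (∂_{direction σ} Ψ) := by
  have direction_eq : direction σ = EuclideanSpace.single (0 : Fin 2) (1 : ℝ) +
      σ • EuclideanSpace.single (1 : Fin 2) (1 : ℝ) := by
    ext i
    fin_cases i <;> simp
  have lineDeriv_eq : ∂_{direction σ} Ψ = ∂_{EuclideanSpace.single (0 : Fin 2) (1 : ℝ)} Ψ +
      (σ : ℂ) • ∂_{EuclideanSpace.single (1 : Fin 2) (1 : ℝ)} Ψ := by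
    ext p
    simp only [SchwartzMap.lineDerivOp_apply_eq_fderiv, add_apply, smul_apply, direction_eq,
      map_add, map_smul, Complex.real_smul, smul_eq_mul]
  rw [lineDeriv_eq, map_add, map_smul]
  change u (-∂_{EuclideanSpace.single (0 : Fin 2) (1 : ℝ)} Ψ) +
    (σ : ℂ) • u (-∂_{EuclideanSpace.single (1 : Fin 2) (1 : ℝ)} Ψ) = _
  rw [map_neg, map_neg, smul_neg, neg_add]

theorem IsSolution.eqOnStrip {σ T : ℝ} (hT : 0 < T) {ψ F F' u : 𝓢'(SpaceTime, ℂ)} {f : 𝓢'(ℝ, ℂ)}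
    (hψ : IsSolution σ T ψ F f) (hF : EqOnStrip T F' F)
    (hu : ∀ Ψ : 𝓢(SpaceTime, ℂ), tsupport Ψ ⊆ strip T → u (∂_{direction σ} Ψ) = -F' Ψ)
    {g : 𝓢(ℝ, ℂ)} {m : ℝ → 𝓢(ℝ, ℂ)} (hm : IsMollifier g m)
    (h₀ : ∀ χ : 𝓢(ℝ, ℂ), Filter.Tendsto (fun δ => u (shearTensor 0 (m δ) χ))
      (nhdsWithin 0 (Ioi 0)) (nhds (f χ))) :
    EqOnStrip T u ψ := by
  refine isVanishingOn_of_transport (σ := σ) hT (fun Ψ hΨ => ?_) hm fun χ => ?_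
  · have transport_ψ : transport σ ψ Ψ - F Ψ = 0 := hψ.1 Ψ hΨ
    have forcing : F' Ψ - F Ψ = 0 := hF Ψ hΨ
    rw [transport_apply] at transport_ψ
    change u (∂_{direction σ} Ψ) - ψ (∂_{direction σ} Ψ) = 0
    rw [hu Ψ hΨ]
    linear_combination transport_ψ - forcing
  · rw [← sub_self (f χ)]
    exact (h₀ χ).sub (hψ.2.tendsto hT hm χ)

theorem IsSolution.zNormStrip_le_zSq_duhamel {K : 𝓢(ℝ, ℂ)} (hK : IsCutoffKernel K)
    {σ s s' b δ T : ℝ} (hs : -1 ≤ s) (hb : 0 ≤ b) (hδ : 0 ≤ δ) (hT : 0 < T) (hT1 : T ≤ 1)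
    {ψ F F' : 𝓢'(SpaceTime, ℂ)} {f : 𝓢'(ℝ, ℂ)} (hψ : IsSolution σ T ψ F f)
    (hF : EqOnStrip T F' F) {a : ℝ → ℂ} (ha : IsFourierTransform f a) {H : SpaceTime → ℂ}
    (hH : IsFourierTransform F' H) (hy : ySq s' (-1 + δ) (H ∘ freqChart σ) ≠ ⊤) :
    ZNormStrip σ s b T ψ ≤ zSq σ s b (fun z =>
      duhamel K T (a z.2) (fun θ => (H ∘ freqChart σ) (θ, z.2)) z.1) ^ (1 / 2 : ℝ) := by
  set h := H ∘ freqChart σ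
  set D : ℝ × ℝ → ℂ := fun z => duhamel K T (a z.2) (fun θ => h (θ, z.2)) z.1
  have hh : Measurable h := hH.1.comp (measurable_freqChart σ)
  set G : SpaceTime → ℂ := fun p => D (p 0 + σ * p 1, p 1)
  have hG : Measurable G :=
    (measurable_duhamel_uncurry K T ha.1 hh).comp (g := D) (by fun_prop)
  have G_freqChart (z) : G (freqChart σ z) = D z := by
    simp only [G, freqChart_zero, freqChart_one, sub_add_cancel]
  have G_comp : G ∘ freqChart σ = D := funext G_freqChart
  by_cases infinite : zSq σ s b D = ⊤
  · rw [infinite, ENNReal.top_rpow_of_pos (by norm_num)]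
    exact le_top
  obtain ⟨u, hu⟩ := exists_isFourierTransform_of_zSq (σ := σ) hs hb hG (by rwa [G_comp])
  obtain ⟨g, m, hm⟩ := exists_isMollifier
  have apply_eq {Φ : 𝓢(SpaceTime, ℂ)} (hΦ : tsupport Φ ⊆ strip T) :
      u Φ = solutionPairing σ a h Φ :=
    hu.apply_eq_solutionPairing hK hT hT1 hδ hh hy G_freqChart hΦ
  have eqOnStrip : EqOnStrip T u ψ := by
    refine hψ.eqOnStrip hT hF (fun Ψ hΨ => ?_) hm fun χ => ?_
    · rw [apply_eq ((SchwartzMap.tsupport_lineDerivOp_subset _ _).trans hΨ),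
        hH.solutionPairing_lineDerivOp]
    · refine (hm.tendsto_solutionPairing ha hδ hh hy σ χ).congr' ?_
      filter_upwards [Ioo_mem_nhdsGT hT] with ε hε
      exact (apply_eq (tsupport_shearTensor_subset 0
        (hm.tsupport_subset_Ioo hε.1 hε.2) χ)).symm
  calc ZNormStrip σ s b T ψ ≤ ZNorm σ s b u := iInf₂_le u eqOnStrip
    _ = zSq σ s b D ^ (1 / 2 : ℝ) := by rw [zNorm_eq σ s b hu, G_comp]

theorem exists_of_iInf_ne_top {α : Type*} {p : α → Prop} {φ : α → ℝ≥0∞}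
    (h : ⨅ (x : α) (_ : p x), φ x ≠ ⊤) : ∃ x, p x := by
  by_contra! hp
  exact h (iInf₂_eq_top.2 fun x hx => (hp x hx).elim)

theorem rpow_half_mul_add_sq_mul_le (C a t y z : ℝ≥0∞) :
    (C * (a + t ^ 2 * (y + z))) ^ (1 / 2 : ℝ) ≤
      C ^ (1 / 2 : ℝ) * (a ^ (1 / 2 : ℝ) + t * (y ^ (1 / 2 : ℝ) + z ^ (1 / 2 : ℝ))) := by
  have sqrt_add_le (x w : ℝ≥0∞) : (x + w) ^ (1 / 2 : ℝ) ≤ x ^ (1 / 2 : ℝ) + w ^ (1 / 2 : ℝ) :=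
    ENNReal.rpow_add_le_add_rpow x w (by norm_num) (by norm_num)
  have sqrt_sq : (t ^ 2) ^ (1 / 2 : ℝ) = t := by
    rw [← ENNReal.rpow_natCast_mul]
    norm_num
  rw [ENNReal.mul_rpow_of_nonneg _ _ (by norm_num)]
  gcongr
  refine (sqrt_add_le _ _).trans ?_
  rw [ENNReal.mul_rpow_of_nonneg _ _ (by norm_num), sqrt_sq]
  gcongr
  exact sqrt_add_le y z

theorem exists_zNormStrip_le {s b δ : ℝ} (hs : -1 / 2 < s) (hs₀ : s ≤ 0) (hb₀ : 0 ≤ b)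
    (hb₁ : b ≤ 1) (hδ : 0 ≤ δ) (hbδ : b + δ < 3 / 2) :
    ∃ C : ℝ≥0, C ≠ 0 ∧ ∀ σ : ℝ, 1 / 2 ≤ |σ| → ∀ T : ℝ, 0 < T → T ≤ 1 →
      ∀ (ψ F F' : 𝓢'(SpaceTime, ℂ)) (f : 𝓢'(ℝ, ℂ)), IsSolution σ T ψ F f → EqOnStrip T F' F →
        ZNormStrip σ s b T ψ ≤ C * (HNorm s f +
          ENNReal.ofReal (T ^ δ) * (YNorm σ s (-1 + δ) F' + ZNorm σ s (b - 1 + δ) F')) := by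
  obtain ⟨K, hK⟩ := exists_isCutoffKernel
  obtain ⟨C, hC⟩ := exists_duhamel_zSq_le hs hs₀ hb₀ hb₁ hδ hbδ K
  refine ⟨1 + NNReal.sqrt C, by positivity, fun σ hσ T hT hT1 ψ F F' f hψ hF => ?_⟩
  have C_ne_zero : ((1 + NNReal.sqrt C : ℝ≥0) : ℝ≥0∞) ≠ 0 := ENNReal.coe_ne_zero.2 (by positivity)
  have power_ne_zero : ENNReal.ofReal (T ^ δ) ≠ 0 := by
    rw [ENNReal.ofReal_ne_zero_iff]
    positivity
  by_cases hf : HNorm s f = ⊤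
  · rw [hf, top_add, ENNReal.mul_top C_ne_zero]
    exact le_top
  by_cases hY : YNorm σ s (-1 + δ) F' = ⊤
  · rw [hY, top_add, ENNReal.mul_top power_ne_zero, add_top, ENNReal.mul_top C_ne_zero]
    exact le_top
  obtain ⟨a, ha⟩ := exists_of_iInf_ne_top hf
  obtain ⟨H, hH⟩ := exists_of_iInf_ne_top hY
  rw [yNorm_eq σ s _ hH] at hY ⊢
  rw [hNorm_eq s ha, zNorm_eq σ s _ hH]
  have ySq_ne_top : ySq s (-1 + δ) (H ∘ freqChart σ) ≠ ⊤ := fun infinite =>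
    hY (by rw [infinite, ENNReal.top_rpow_of_pos (by norm_num)])
  refine (hψ.zNormStrip_le_zSq_duhamel hK (by linarith) hb₀ hδ hT hT1 hF ha hH ySq_ne_top).trans ?_
  refine (ENNReal.rpow_le_rpow (hC σ hσ T hT hT1 a (H ∘ freqChart σ) ha.1
    (hH.1.comp (measurable_freqChart σ))) (by norm_num)).trans ?_
  refine (rpow_half_mul_add_sq_mul_le _ _ _ _ _).trans (mul_le_mul_left ?_ _)
  rw [← ENNReal.coe_rpow_of_nonneg _ (by norm_num), ← NNReal.sqrt_eq_rpow]
  exact ENNReal.coe_le_coe.2 le_add_self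

theorem add_ofReal_rpow_two_mul_le {T ε b : ℝ} (hT : 0 < T) (hT1 : T ≤ 1) (hε : 0 ≤ ε)
    (hb : 1 / 2 ≤ b) (A B : ℝ≥0∞) :
    A + ENNReal.ofReal (T ^ (2 * ε)) * B ≤
      ENNReal.ofReal (T ^ (1 / 2 - b)) * A + ENNReal.ofReal (T ^ ε) * B := by
  refine add_le_add (le_mul_of_one_le_left' (ENNReal.one_le_ofReal.2 ?_))
    (mul_le_mul_left (ENNReal.ofReal_le_ofReal ?_) B)
  · exact Real.one_le_rpow_of_pos_of_le_one_of_nonpos hT hT1 (by linarith)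
  · exact Real.rpow_le_rpow_of_exponent_ge hT hT1 (by linarith)

end NullSobolev

theorem corollary4p4_general {s b δ : ℝ} (hs : -1 / 2 < s) (hs₀ : s ≤ 0) (hb₀ : 0 ≤ b)
    (hb₁ : b ≤ 1) (hδ : 0 ≤ δ) (hbδ : b + δ < 3 / 2) :
    ∃ C : ℝ≥0, ∀ σ : ℝ, 1 / 2 ≤ |σ| → ∀ T : ℝ, 0 < T → T ≤ 1 →
      ∀ (ψ F : 𝓢'(NullSobolev.SpaceTime, ℂ)) (f : 𝓢'(ℝ, ℂ)),
        NullSobolev.IsSolution σ T ψ F f →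
        NullSobolev.ZNormStrip σ s b T ψ ≤
          C * (NullSobolev.HNorm s f + ENNReal.ofReal (T ^ δ) *
            ⨅ (F' : 𝓢'(NullSobolev.SpaceTime, ℂ)) (_ : NullSobolev.EqOnStrip T F' F),
              (NullSobolev.YNorm σ s (-1 + δ) F' + NullSobolev.ZNorm σ s (b - 1 + δ) F')) := by
  obtain ⟨C, hC₀, hC⟩ := NullSobolev.exists_zNormStrip_le hs hs₀ hb₀ hb₁ hδ hbδ
  refine ⟨C, fun σ hσ T hT hT1 ψ F f hψ => ?_⟩
  have power_ne_zero : ENNReal.ofReal (T ^ δ) ≠ 0 :=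
    ENNReal.ofReal_ne_zero_iff.2 (Real.rpow_pos_of_pos hT δ)
  simp only [ENNReal.mul_iInf_of_ne power_ne_zero ENNReal.ofReal_ne_top, ENNReal.add_iInf,
    ENNReal.mul_iInf_of_ne (ENNReal.coe_ne_zero.2 hC₀) ENNReal.coe_ne_top]
  exact le_iInf₂ fun F' hF => hC σ hσ T hT hT1 ψ F F' f hψ hF

theorem corollary4p4 (s ε b : ℝ) (hs : -1 / 2 < s) (hs' : s < 0) (hε : 0 < ε) (hε' : ε < 1 / 6)
    (hb : 1 / 2 < b) (hb' : b < min (1 + ε) (1 + s)) :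
    ∃ C : ℝ≥0, ∀ σ : ℝ, σ = 1 ∨ σ = -1 → ∀ T : ℝ, 0 < T → T < 1 →
      ∀ (ψ F : 𝓢'(NullSobolev.SpaceTime, ℂ)) (f : 𝓢'(ℝ, ℂ)),
        NullSobolev.IsSolution σ T ψ F f →
        NullSobolev.ZNormStrip σ s b T ψ ≤
          C * (ENNReal.ofReal (T ^ (1 / 2 - b)) * NullSobolev.HNorm s f +
            ENNReal.ofReal (T ^ ε) *
              ⨅ (F' : 𝓢'(NullSobolev.SpaceTime, ℂ)) (_ : NullSobolev.EqOnStrip T F' F),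
                (NullSobolev.YNorm σ s (-1 + 2 * ε) F' +
                  NullSobolev.ZNorm σ s (b - 1 + 2 * ε) F')) := by
  have hb₁ : b < 1 := by linarith [min_le_right (1 + ε) (1 + s)]
  obtain ⟨C, hC⟩ := corollary4p4_general hs hs'.le (by linarith) hb₁.le
    (mul_nonneg two_pos.le hε.le) (by linarith)
  refine ⟨C, fun σ hσ T hT hT1 ψ F f hψ => ?_⟩
  have half_le_abs : 1 / 2 ≤ |σ| := by rcases hσ with rfl | rfl <;> norm_num
  exact (hC σ half_le_abs T hT hT1.le ψ F f hψ).trans <| mul_le_mul_right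
    (NullSobolev.add_ofReal_rpow_two_mul_le hT hT1.le hε.le hb.le _ _) _
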